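/- Throughout, a polyhedron is a subset $X$ of a real normed space such that every point of $X$ has a neighbourhood in $X$ which is a compact polyhedron, i.e. a finite union of convex hulls of finite sets (for example, the underlying space of a locally finite simplicial complex). A compact sub-polyhedron of $X$ is a compact polyhedron contained in $X$, and PL means piecewise linear. For such an $X$ we say: * $X$ is wgsc (weakly geometrically simply connected) if $X$ is non-compact and $X=\bigcup_{j\ge 1}K_j$ for an exhaustion $K_1\subset K_2\subset\cdots$ by compact connected sub-polyhedra with $\pi_1(K_j)=0$ (exhaustion: every compact subset of $X$ lies in some $K_j$). * $X$ has small content if $X$ is simply connected and non-compact and, for any compact set $C\subset X$, there exist compact connected sub-polyhedra $D, E$ with $C\subset D\subset E\subset X$ such that: (1) the map $\pi_1(D)\to\pi_1(E)$ induced by the inclusion is zero; (2) if two points of $D$ are connected within $E\setminus C$, then they are connected within $D\setminus C$; (3) any loop in $E\setminus C$ based at a point of $D\setminus C$ is homotopic rel base point within $X\setminus C$ to a loop lying entirely in $D\setminus C$. * $X$ is 1-tame if any compact sub-polyhedron $C\subset X$ is contained in a compact sub-polyhedron $K\subset X$ such that any loop $\gamma$ in $K$ is freely homotopic within $K$ to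 a loop $\overline\gamma$ in $K\setminus C$ which is null-homotopic within $X\setminus C$. * $X$ is qsf (quasi-simply filtered) if $X$ is simply connected and non-compact and, for any compact sub-polyhedron $C\subset X$, there exist a simply connected compact polyhedron $K$ and a PL map $f:K\to X$ such that $C\subset f(K)$ and $f|_{f^{-1}(C)}:f^{-1}(C)\to C$ is a PL homeomorphism. **Proposition.** Let $X$ be a polyhedron. If $X$ is wgsc, then $X$ has small content and is 1-tame. If $X$ is connected and 1-tame, or if $X$ has small content, then $X$ is qsf. -/

import Mathlib

open Set Topology unitInterval

/-- A compact polyhedron in a real vector space: a finite union of convex cells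
(convex hulls of finite sets). -/
def IsCompactPolyhedron {E : Type*} [AddCommGroup E] [Module ℝ E] (C : Set E) : Prop :=
  ∃ S : Set (Finset E), S.Finite ∧ C = ⋃ s ∈ S, convexHull ℝ (s : Set E)

/-- A (not necessarily compact) polyhedron: every point of `X` has a neighbourhood in `X` that is a
compact polyhedron. Every locally finite simplicial complex can be realized in this way
in a normed space. -/
def IsPolyhedron {E : Type*} [NormedAddCommGroup E] [NormedSpace ℝ E] (X : Set E) : Prop :=
  ∀ x ∈ X, ∃ P : Set E, IsCompactPolyhedron P ∧ P ⊆ X ∧ P ∈ 𝓝[X] x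

theorem IsCompactPolyhedron.isCompact {E : Type*} [NormedAddCommGroup E] [NormedSpace ℝ E]
    {C : Set E} (h : IsCompactPolyhedron C) : IsCompact C := by
  obtain ⟨S, hS, rfl⟩ := h
  exact hS.isCompact_biUnion fun s _ => s.finite_toSet.isCompact_convexHull (𝕜 := ℝ)

/-- The compact polyhedra are exactly the polyhedra that are compact. -/
theorem isCompactPolyhedron_iff {E : Type*} [NormedAddCommGroup E] [NormedSpace ℝ E]
    {C : Set E} : IsCompactPolyhedron C ↔ IsCompact C ∧ IsPolyhedron C := by
  refine ⟨fun h => ⟨h.isCompact, fun x _ => ⟨C, h, subset_rfl, self_mem_nhdsWithin⟩⟩, ?_⟩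
  rintro ⟨hC, hP⟩
  choose! P hP1 hP2 hP3 using hP
  obtain ⟨t, ht, hcov⟩ := hC.elim_nhdsWithin_subcover P hP3
  choose! S hS hPS using hP1
  refine ⟨⋃ x ∈ t, S x, t.finite_toSet.biUnion fun x hx => hS x (ht x hx), ?_⟩
  apply Subset.antisymm
  · intro y hy
    obtain ⟨x, hx, hyx⟩ := mem_iUnion₂.1 (hcov hy)
    rw [hPS x (ht x hx)] at hyx
    obtain ⟨s, hs, hys⟩ := mem_iUnion₂.1 hyx
    exact mem_iUnion₂.2 ⟨s, mem_iUnion₂.2 ⟨x, hx, hs⟩, hys⟩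
  · intro y hy
    obtain ⟨s, hs, hys⟩ := mem_iUnion₂.1 hy
    obtain ⟨x, hx, hsx⟩ := mem_iUnion₂.1 hs
    apply hP2 x (ht x hx)
    rw [hPS x (ht x hx)]
    exact mem_iUnion₂.2 ⟨s, hsx, hys⟩

/-- The underlying space of a locally finite simplicial complex is a polyhedron. -/
theorem isPolyhedron_space {E : Type*} [NormedAddCommGroup E] [NormedSpace ℝ E]
    (T : Geometry.SimplicialComplex ℝ E)
    (hT : ∀ x ∈ T.space, ∃ U ∈ 𝓝 x, {s ∈ T.faces | (convexHull ℝ (s : Set E) ∩ U).Nonempty}.Finite) :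
    IsPolyhedron T.space := by
  intro x hx
  obtain ⟨U, hU, hfin⟩ := hT x hx
  refine ⟨_, ⟨_, hfin, rfl⟩, ?_, ?_⟩
  · exact iUnion₂_subset fun s hs => T.convexHull_subset_space hs.1
  · filter_upwards [self_mem_nhdsWithin, mem_nhdsWithin_of_mem_nhds hU] with y hy hyU
    obtain ⟨s, hs, hys⟩ := T.mem_space_iff.1 hy
    exact mem_iUnion₂.2 ⟨s, ⟨hs, y, hys, hyU⟩, hys⟩

/-- `f` is piecewise linear on the set `A` (which is then a compact polyhedron): it is continuous
on `A`, and `A` is a finite union of convex cells on each of which `f` is affine. -/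
def IsPLOn {F E : Type*} [NormedAddCommGroup F] [NormedSpace ℝ F]
    [NormedAddCommGroup E] [NormedSpace ℝ E] (f : F → E) (A : Set F) : Prop :=
  ContinuousOn f A ∧
    ∃ S : Set (Finset F), S.Finite ∧ A = ⋃ s ∈ S, convexHull ℝ (s : Set F) ∧
      ∀ s ∈ S, ∀ x ∈ convexHull ℝ (s : Set F), ∀ y ∈ convexHull ℝ (s : Set F),
        ∀ a b : ℝ, 0 ≤ a → 0 ≤ b → a + b = 1 → f (a • x + b • y) = a • f x + b • f y

/-- `f` restricts to a PL homeomorphism from `A` onto `B` (compact polyhedra). -/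
def IsPLHomeoOn {F E : Type*} [NormedAddCommGroup F] [NormedSpace ℝ F]
    [NormedAddCommGroup E] [NormedSpace ℝ E] (f : F → E) (A : Set F) (B : Set E) : Prop :=
  IsPLOn f A ∧ MapsTo f A B ∧ ∃ g : E → F, IsPLOn g B ∧ MapsTo g B A ∧ InvOn g f A B

/-- Free homotopy of two loops in a space `Y`. -/
def FreelyHomotopic {Y : Type*} [TopologicalSpace Y] {x y : Y} (γ : Path x x) (δ : Path y y) :
    Prop :=
  ∃ H : C(I × I, Y), (∀ t, H (0, t) = γ t) ∧ (∀ t, H (1, t) = δ t) ∧ ∀ s, H (s, 0) = H (s, 1)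

/-- Weakly geometrically simply connected: `X` is not compact and has an exhaustion by compact
connected sub-polyhedra `K 0 ⊆ K 1 ⊆ ...` with trivial fundamental group. As usual for an
exhaustion, every compact subset of `X` lies in some `K j`. -/
def IsWgsc {E : Type*} [NormedAddCommGroup E] [NormedSpace ℝ E] (X : Set E) : Prop :=
  ¬ IsCompact X ∧ ∃ K : ℕ → Set E, Monotone K ∧ (⋃ j, K j) = X ∧
    (∀ j, IsCompactPolyhedron (K j) ∧ IsSimplyConnected (K j)) ∧
    ∀ C ⊆ X, IsCompact C → ∃ j, C ⊆ K j

/-- Quasi-simply filtered. The compact polyhedron `K` is not required to lie in `X`; every compact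
polyhedron embeds in some `ℝⁿ`. -/
def IsQsf {E : Type*} [NormedAddCommGroup E] [NormedSpace ℝ E] (X : Set E) : Prop :=
  IsSimplyConnected X ∧ ¬ IsCompact X ∧
    ∀ C ⊆ X, IsCompactPolyhedron C →
      ∃ (n : ℕ) (K : Set (Fin n → ℝ)) (f : (Fin n → ℝ) → E),
        IsCompactPolyhedron K ∧ IsSimplyConnected K ∧ IsPLOn f K ∧ MapsTo f K X ∧
        C ⊆ f '' K ∧ IsPLHomeoOn f (K ∩ f ⁻¹' C) C

/-- Small content. Here `C` is an arbitrary compact subset of `X`. -/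
def HasSmallContent {E : Type*} [NormedAddCommGroup E] [NormedSpace ℝ E] (X : Set E) : Prop :=
  IsSimplyConnected X ∧ ¬ IsCompact X ∧
    ∀ C ⊆ X, IsCompact C →
      ∃ (D D' : Set E) (_ : C ⊆ D) (hDD' : D ⊆ D') (hD'X : D' ⊆ X),
        IsCompactPolyhedron D ∧ IsConnected D ∧ IsCompactPolyhedron D' ∧ IsConnected D' ∧
        -- the inclusion induces the zero map on fundamental groups
        (∀ (x : D) (γ : Path x x),
          (γ.map (continuous_inclusion hDD')).Homotopic (Path.refl (inclusion hDD' x))) ∧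
        -- points of `D` connected within `D' - C` are connected within `D - C`
        (∀ x ∈ D, ∀ y ∈ D, JoinedIn (D' \ C) x y → JoinedIn (D \ C) x y) ∧
        -- loops in `D' - C` based in `D - C` can be pushed into `D - C`, within `X - C` and
        -- rel base point
        (∀ (x : ↥(D \ C))
          (γ : Path (inclusion (sdiff_subset_sdiff_left hDD') x : ↥(D' \ C))
            (inclusion (sdiff_subset_sdiff_left hDD') x)),
          ∃ δ : Path x x,
            (γ.map (continuous_inclusion (sdiff_subset_sdiff_left (t := C) hD'X))).Homotopic
              (δ.map (continuous_inclusion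
                (sdiff_subset_sdiff_left (t := C) (hDD'.trans hD'X)))))

/-- 1-tameness: every compact sub-polyhedron `C` lies in a compact sub-polyhedron `K` such that
every loop in `K` is freely homotopic within `K` to a loop in `K - C` which is null-homotopic within
`X - C`. -/
def IsOneTame {E : Type*} [NormedAddCommGroup E] [NormedSpace ℝ E] (X : Set E) : Prop :=
  ∀ C ⊆ X, IsCompactPolyhedron C →
    ∃ (K : Set E) (_ : C ⊆ K) (hKX : K ⊆ X), IsCompactPolyhedron K ∧
      ∀ (x : K) (γ : Path x x), ∃ (y : ↥(K \ C)) (δ : Path y y),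
        FreelyHomotopic γ (δ.map (continuous_inclusion (sdiff_subset : K \ C ⊆ K))) ∧
        (δ.map (continuous_inclusion (sdiff_subset_sdiff_left (t := C) hKX))).Homotopic
          (Path.refl (inclusion (sdiff_subset_sdiff_left hKX) y))

/-! For a wgsc polyhedron the exhaustion does everything. A simply connected `K j` containing `C`
serves as both polyhedra in the definition of small content. If it also contains a point outside
`C`, every loop in it shrinks to that point, which gives 1-tameness.

Both routes to qsf rest on one construction, `exists_simplyConnected_model`. Let `L` be a path
connected compact subpolyhedron containing `C`, and suppose that π₁(L) is normally generated by
"killed" loops: conjugates of loops of `L \ C` that are null-homotopic in `X \ C`. As π₁(L) is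
finitely generated, finitely many of them suffice. Attaching a disc to `L` along each makes it
simply connected, and the discs map into `X \ C`, so over `C` the map to `X` is still injective. To
keep this PL, the null-homotopies are replaced by triangulated grids (`exists_nullGrid`), and each
interior vertex of a grid is lifted along a coordinate of its own in `E × ℝ^N`; the map to `X` is
then a restricted linear projection.

If `X` is connected and 1-tame, enlarge `C` to be path connected and let `L` be the path component
of `K` containing it: every loop of `L` is killed, directly from the definition.

If `X` has small content, let Q be π₁(D) modulo the normal closure of the killed loops. The
tautological local system on `D` with values in Q extends over `D'`: conditions (2) and (3) replace
paths of `D' \ C₁` between points of `D` by paths in `D \ C₁` with the same class in `X \ C`. By (1)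
every loop of `D` bounds in `D'`, so the local system is trivial on it, and Q = 1
(`normalClosure_killedLoops_eq_top`). For the gluing, `D` has to be a neighbourhood of `C` in `D'`.
This is why small content is applied to a larger set `C₁`, obtained from `C` by adding points,
isolated off `C`, which accumulate at `C` so fast that every compact polyhedron containing them is a
neighbourhood of `C` in `X` (`IsPolyhedron.exists_surrounding_set`). At the added points the local
systems are trivialised on small stars (`exists_star_coboundary`). -/

set_option linter.unusedSectionVars false

open Metric

/-! ### Path classes in subsets of a normed space -/

/-- Homotopy classes of paths rel endpoints. -/
abbrev PathClass {Y : Type*} [TopologicalSpace Y] (x y : Y) := Path.Homotopic.Quotient x y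

/-- The class of a path. -/
abbrev pathClass {Y : Type*} [TopologicalSpace Y] {x y : Y} (p : Path x y) : PathClass x y :=
  Path.Homotopic.Quotient.mk p

theorem trans_mem {A : Type*} [TopologicalSpace A] {x y z : A} {p : Path x y} {q : Path y z}
    {P : A → Prop} (hp : ∀ t, P (p t))
    (hq : ∀ t, P (q t)) (t : I) : P (p.trans q t) := by
  have : p.trans q t ∈ range (p.trans q) := mem_range_self t
  rw [Path.trans_range] at this
  rcases this with ⟨s, hs⟩ | ⟨s, hs⟩
  · rw [← hs]; exact hp s
  · rw [← hs]; exact hq s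

section Classes

variable {E : Type*} [NormedAddCommGroup E] [NormedSpace ℝ E] {A B C : Set E}

/-- The map on path classes induced by an inclusion of sets. -/
def PathClass.incl (h : A ⊆ B) {x y : A} (p : PathClass x y) :
    PathClass (⟨x.1, h x.2⟩ : B) ⟨y.1, h y.2⟩ :=
  Path.Homotopic.Quotient.map p ⟨inclusion h, continuous_inclusion h⟩

theorem PathClass.incl_trans (h : A ⊆ B) {x y z : A} (p : PathClass x y) (q : PathClass y z) :
    PathClass.incl h (p.trans q) = (PathClass.incl h p).trans (PathClass.incl h q) := by
  induction p using Path.Homotopic.Quotient.ind with | mk p =>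
  induction q using Path.Homotopic.Quotient.ind with | mk q =>
  exact congrArg Path.Homotopic.Quotient.mk (p.map_trans q (continuous_inclusion h))

theorem PathClass.incl_symm (h : A ⊆ B) {x y : A} (p : PathClass x y) :
    PathClass.incl h p.symm = (PathClass.incl h p).symm := by
  induction p using Path.Homotopic.Quotient.ind with | mk p => rfl

theorem PathClass.incl_refl (h : A ⊆ B) (x : A) :
    PathClass.incl h (Path.Homotopic.Quotient.refl x) = Path.Homotopic.Quotient.refl _ := rfl

theorem PathClass.incl_incl (h : A ⊆ B) (h' : B ⊆ C) {x y : A} (p : PathClass x y) :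
    PathClass.incl h' (PathClass.incl h p) = PathClass.incl (h.trans h') p := by
  induction p using Path.Homotopic.Quotient.ind with | mk p => rfl

theorem pathClass_eq_of_simplyConnected {Y Z : Type*} [TopologicalSpace Y] [TopologicalSpace Z]
    [SimplyConnectedSpace Z] (f : C(Z, Y)) {x y : Z} (p q : PathClass x y) :
    p.map f = q.map f := by
  rw [Subsingleton.elim p q]

/-- Two paths of `A` running in a star convex subset are homotopic in `A`. -/
theorem pathClass_eq_of_starConvex {z : E} (hBA : B ⊆ A) (hB : StarConvex ℝ z B) {x y : A}
    (p q : Path x y) (hp : ∀ t, (p t : E) ∈ B) (hq : ∀ t, (q t : E) ∈ B) :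
    pathClass p = pathClass q := by
  have hx : (x : E) ∈ B := by simpa using hp 0
  have hy : (y : E) ∈ B := by simpa using hp 1
  have : ContractibleSpace B := hB.contractibleSpace ⟨_, hx⟩
  let p' : Path (⟨x, hx⟩ : B) ⟨y, hy⟩ :=
    ⟨⟨fun t => ⟨p t, hp t⟩, by fun_prop⟩, by simp, by simp⟩
  let q' : Path (⟨x, hx⟩ : B) ⟨y, hy⟩ :=
    ⟨⟨fun t => ⟨q t, hq t⟩, by fun_prop⟩, by simp, by simp⟩
  have h := pathClass_eq_of_simplyConnected (⟨inclusion hBA, continuous_inclusion hBA⟩ : C(B, A))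
    (pathClass p') (pathClass q')
  have hp' : pathClass p = PathClass.incl hBA (pathClass p') := rfl
  have hq' : pathClass q = PathClass.incl hBA (pathClass q') := rfl
  rw [hp', hq']; exact h

/-- The straight path between two points of `A`. -/
def segPath (x y : A) (h : segment ℝ (x : E) y ⊆ A) : Path x y where
  toFun t := ⟨AffineMap.lineMap (x : E) (y : E) (t : ℝ),
    h (by rw [segment_eq_image_lineMap]; exact ⟨t, t.2, rfl⟩)⟩
  continuous_toFun := by
    refine Continuous.subtype_mk ?_ _
    exact AffineMap.lineMap_continuous.comp continuous_subtype_val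
  source' := by simp
  target' := by simp

theorem segPath_mem (x y : A) (h : segment ℝ (x : E) y ⊆ A) (t : I) :
    (segPath x y h t : E) ∈ segment ℝ (x : E) y := by
  rw [segment_eq_image_lineMap]; exact ⟨t, t.2, rfl⟩

/-- The class of the straight path between two points of `A`. -/
def seg (x y : A) (h : segment ℝ (x : E) y ⊆ A) : PathClass x y := pathClass (segPath x y h)

theorem incl_seg (hAB : A ⊆ B) (x y : A) (h : segment ℝ (x : E) y ⊆ A) :
    PathClass.incl hAB (seg x y h) = seg ⟨x.1, hAB x.2⟩ ⟨y.1, hAB y.2⟩ (h.trans hAB) := rfl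

theorem seg_trans_of_starConvex {w : E} (hBA : B ⊆ A) (hB : StarConvex ℝ w B) (x y z : A)
    (hxy : segment ℝ (x : E) y ⊆ B) (hyz : segment ℝ (y : E) z ⊆ B)
    (hxz : segment ℝ (x : E) z ⊆ B) :
    (seg x y (hxy.trans hBA)).trans (seg y z (hyz.trans hBA)) = seg x z (hxz.trans hBA) := by
  refine pathClass_eq_of_starConvex hBA hB ((segPath x y _).trans (segPath y z _)) _ ?_ ?_
  · exact fun t => trans_mem (P := fun a => (a : E) ∈ B) (p := segPath x y _)
      (q := segPath y z _) (fun t => hxy (segPath_mem _ _ _ t))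
      (fun t => hyz (segPath_mem _ _ _ t)) t
  · exact fun t => hxz (segPath_mem _ _ _ t)

theorem seg_trans_of_convex (hBA : B ⊆ A) (hB : Convex ℝ B) (x y z : A)
    (hx : (x : E) ∈ B) (hy : (y : E) ∈ B) (hz : (z : E) ∈ B) :
    (seg x y ((hB.segment_subset hx hy).trans hBA)).trans
      (seg y z ((hB.segment_subset hy hz).trans hBA)) =
      seg x z ((hB.segment_subset hx hz).trans hBA) :=
  seg_trans_of_starConvex hBA (hB.starConvex hx) x y z (hB.segment_subset hx hy)
    (hB.segment_subset hy hz) (hB.segment_subset hx hz)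

theorem seg_trans (x y z : A) (h : convexHull ℝ {(x : E), (y : E), (z : E)} ⊆ A)
    (hxy : segment ℝ (x : E) y ⊆ A) (hyz : segment ℝ (y : E) z ⊆ A)
    (hxz : segment ℝ (x : E) z ⊆ A) :
    (seg x y hxy).trans (seg y z hyz) = seg x z hxz :=
  seg_trans_of_convex h (convex_convexHull ℝ _) x y z
    (subset_convexHull ℝ _ (by simp)) (subset_convexHull ℝ _ (by simp))
    (subset_convexHull ℝ _ (by simp))

theorem seg_self (x : A) (h : segment ℝ (x : E) x ⊆ A) :
    seg x x h = Path.Homotopic.Quotient.refl x := by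
  refine congrArg Path.Homotopic.Quotient.mk ?_
  ext t
  simp [segPath]

theorem seg_symm (x y : A) (h : segment ℝ (x : E) y ⊆ A) (h' : segment ℝ (y : E) x ⊆ A) :
    (seg x y h).symm = seg y x h' := by
  have h1 := seg_trans_of_convex h (convex_segment (x : E) y) x y x (left_mem_segment ℝ _ _)
    (right_mem_segment ℝ _ _) (left_mem_segment ℝ _ _)
  rw [seg_self] at h1
  have h2 : (seg x y h).symm.trans ((seg x y h).trans (seg y x h')) = (seg x y h).symm := by
    rw [h1]; simp
  rw [← h2, ← Path.Homotopic.Quotient.trans_assoc]; simp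

/-! ### Sets that are locally star convex -/

/-- Every point of `A` has arbitrarily small star convex neighbourhoods in `A` centred at it. -/
def LocStar (A : Set E) : Prop := ∀ x ∈ A, ∃ r > 0, StarConvex ℝ x (A ∩ ball x r)

theorem StarConvex.inter_ball_mono {x : E} {r s : ℝ} (hs : 0 < s) (hsr : s ≤ r)
    (h : StarConvex ℝ x (A ∩ ball x r)) : StarConvex ℝ x (A ∩ ball x s) := by
  have : A ∩ ball x s = (A ∩ ball x r) ∩ ball x s := by
    rw [inter_assoc, inter_eq_self_of_subset_right (ball_subset_ball hsr)]
  rw [this]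
  exact h.inter ((convex_ball x s).starConvex (mem_ball_self hs))

theorem LocStar.of_nhds {x : E} {P : Set E} (hP : ∃ r > 0, StarConvex ℝ x (P ∩ ball x r))
    (hPA : P ⊆ A) (hn : P ∈ 𝓝[A] x) : ∃ r > 0, StarConvex ℝ x (A ∩ ball x r) := by
  obtain ⟨r, hr, h⟩ := hP
  obtain ⟨s, hs, hs'⟩ := Metric.mem_nhdsWithin_iff.1 hn
  refine ⟨min r s, lt_min hr hs, ?_⟩
  have : A ∩ ball x (min r s) = P ∩ ball x (min r s) := by
    apply Subset.antisymm
    · exact fun y hy => ⟨hs' ⟨ball_subset_ball (min_le_right _ _) hy.2, hy.1⟩, hy.2⟩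
    · exact inter_subset_inter_left _ hPA
  rw [this]
  exact h.inter_ball_mono (lt_min hr hs) (min_le_left _ _)

theorem LocStar.of_mem_nhdsWithin (hA : LocStar A) (hBA : B ⊆ A)
    (h : ∀ x ∈ B, B ∈ 𝓝[A] x) : LocStar B := by
  intro x hx
  obtain ⟨r, hr, hst⟩ := hA x (hBA hx)
  obtain ⟨s, hs, hs'⟩ := Metric.mem_nhdsWithin_iff.1 (h x hx)
  refine ⟨min r s, lt_min hr hs, ?_⟩
  have : B ∩ ball x (min r s) = A ∩ ball x (min r s) := by
    apply Subset.antisymm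
    · exact inter_subset_inter_left _ hBA
    · exact fun y hy => ⟨hs' ⟨ball_subset_ball (min_le_right _ _) hy.2, hy.1⟩, hy.2⟩
  rw [this]
  exact hst.inter_ball_mono (lt_min hr hs) (min_le_left _ _)

theorem LocStar.diff (hA : LocStar A) (hC : IsClosed C) : LocStar (A \ C) :=
  hA.of_mem_nhdsWithin sdiff_subset fun _ hx =>
    Filter.inter_mem self_mem_nhdsWithin (mem_nhdsWithin_of_mem_nhds (hC.isOpen_compl.mem_nhds hx.2))

/-- Near `x`, only those members of a finite family of closed sets that contain `x` are visible. -/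
theorem exists_ball_of_finite_closed {Y ι : Type*} [PseudoMetricSpace Y] [Finite ι]
    (c : ι → Set Y) (hc : ∀ i, IsClosed (c i)) (x : Y) :
    ∃ r > 0, ∀ i, ∀ y ∈ c i, dist y x < r → x ∈ c i := by
  have h : ∀ i, ∀ᶠ y in 𝓝 x, y ∈ c i → x ∈ c i := by
    intro i
    by_cases hx : x ∈ c i
    · exact Filter.Eventually.of_forall fun _ _ => hx
    · filter_upwards [(hc i).isOpen_compl.mem_nhds hx] with y hy hy'
      exact absurd hy' hy
  obtain ⟨r, hr, h'⟩ := Metric.eventually_nhds_iff.1 (Filter.eventually_all.2 h)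
  exact ⟨r, hr, fun i y hy hyx => h' hyx i hy⟩

/-- The radius is so small that each cell meeting the ball contains `x`; convexity of that cell
supplies the radial segments. -/
theorem starConvex_iUnion_inter_ball {ι : Type*} {c : ι → Set E} (hcv : ∀ i, Convex ℝ (c i))
    {x : E} {r : ℝ} (hr : 0 < r) (h : ∀ i, ∀ y ∈ c i, dist y x < r → x ∈ c i) :
    StarConvex ℝ x ((⋃ i, c i) ∩ ball x r) := by
  rw [starConvex_iff_segment_subset]
  rintro y ⟨hy, hyr⟩ z hz
  obtain ⟨i, hi⟩ := mem_iUnion.1 hy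
  exact ⟨mem_iUnion.2 ⟨i, (hcv i).segment_subset (h i y hi hyr) hi hz⟩,
    (convex_ball x r).segment_subset (mem_ball_self hr) hyr hz⟩

theorem LocStar.iUnion {ι : Type*} [Finite ι] {c : ι → Set E} (hc : ∀ i, IsClosed (c i))
    (hcv : ∀ i, Convex ℝ (c i)) : LocStar (⋃ i, c i) := by
  intro x _
  obtain ⟨r, hr, h⟩ := exists_ball_of_finite_closed c hc x
  exact ⟨r, hr, starConvex_iUnion_inter_ball hcv hr h⟩

/-- A compact polyhedron as an indexed union of cells. -/
theorem IsCompactPolyhedron.exists_cells (h : IsCompactPolyhedron A) :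
    ∃ (S : Set (Finset E)), S.Finite ∧ A = ⋃ s : S, convexHull ℝ ((s : Finset E) : Set E) := by
  obtain ⟨S, hS, rfl⟩ := h
  exact ⟨S, hS, by rw [biUnion_eq_iUnion]⟩

theorem isClosed_convexHull_finset (s : Finset E) : IsClosed (convexHull ℝ (s : Set E)) :=
  (s.finite_toSet.isCompact_convexHull (𝕜 := ℝ)).isClosed

theorem IsCompactPolyhedron.locStar (h : IsCompactPolyhedron A) : LocStar A := by
  obtain ⟨S, hS, rfl⟩ := h.exists_cells
  have := hS.to_subtype
  exact LocStar.iUnion (fun s => isClosed_convexHull_finset s.1) fun s => convex_convexHull ℝ _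

theorem IsPolyhedron.locStar (h : IsPolyhedron A) : LocStar A := by
  intro x hx
  obtain ⟨P, hP, hPA, hn⟩ := h x hx
  exact LocStar.of_nhds (hP.locStar x (mem_of_mem_nhdsWithin hx hn)) hPA hn

/-- To prove something about all path classes it is enough to treat short radial segments. -/
theorem LocStar.path_induction {ρ : E → ℝ} (hρ : ∀ x ∈ A, 0 < ρ x)
    (hst : ∀ x ∈ A, StarConvex ℝ x (A ∩ ball x (ρ x)))
    (P : ∀ {x y : A}, PathClass x y → Prop)
    (htrans : ∀ {x y z : A} (p : PathClass x y) (q : PathClass y z), P p → P q → P (p.trans q))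
    (hout : ∀ (x y : A) (h : segment ℝ (x : E) y ⊆ A), dist (y : E) x < ρ x → P (seg x y h))
    (hin : ∀ (x y : A) (h : segment ℝ (y : E) x ⊆ A), dist (y : E) x < ρ x → P (seg y x h))
    {x y : A} (p : PathClass x y) : P p := by
  induction p using Path.Homotopic.Quotient.ind with | mk p =>
  -- Subdivide so that each piece stays in one star. There it is homotopic to the detour through the
  -- centre: one radial segment inwards, then one outwards.
  obtain ⟨t, ht0, htm, ⟨n, hn⟩, hcov⟩ := exists_monotone_Icc_subset_open_cover_unitInterval
    (c := fun z : A => {s | dist (p s : E) z < ρ z})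
    (fun z => isOpen_lt (by fun_prop) continuous_const)
    (fun s _ => mem_iUnion.2 ⟨p s, by simpa using hρ _ (p s).2⟩)
  have key : ∀ k, P (pathClass (p.subpath (t 0) (t k))) := by
    intro k
    induction k with
    | zero =>
      rw [Path.subpath_self]
      have hs : segment ℝ (p (t 0) : E) (p (t 0)) ⊆ A := by simp
      have := hout (p (t 0)) (p (t 0)) hs (by simpa using hρ _ (p (t 0)).2)
      rw [seg_self] at this
      exact this
    | succ k ih =>
      have h1 : pathClass (p.subpath (t 0) (t (k + 1))) =
          (pathClass (p.subpath (t 0) (t k))).trans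
            (pathClass (p.subpath (t k) (t (k + 1)))) := by
        rw [← Path.Homotopic.Quotient.mk_trans]
        exact (Path.Homotopic.Quotient.eq.2 ⟨Path.Homotopy.subpathTransSubpath p _ _ _⟩).symm
      rw [h1]
      refine htrans _ _ ih ?_
      obtain ⟨z, hz⟩ := hcov k
      have hst' := hst z z.2
      have hmem : ∀ s ∈ Icc (t k) (t (k + 1)), (p s : E) ∈ (A : Set E) ∩ ball (z : E) (ρ z) :=
        fun s hs => ⟨(p s).2, hz hs⟩
      have hk := hmem (t k) (left_mem_Icc.2 (htm (Nat.le_succ k)))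
      have hk' := hmem (t (k + 1)) (right_mem_Icc.2 (htm (Nat.le_succ k)))
      have s2 : segment ℝ (z : E) (p (t (k + 1))) ⊆ A ∩ ball (z : E) (ρ z) :=
        hst'.segment_subset hk'
      have s1 : segment ℝ (p (t k) : E) z ⊆ A ∩ ball (z : E) (ρ z) := by
        rw [segment_symm]; exact hst'.segment_subset hk
      have h2 : pathClass (p.subpath (t k) (t (k + 1))) =
          (seg (p (t k)) z (s1.trans inter_subset_left)).trans
            (seg z (p (t (k + 1))) (s2.trans inter_subset_left)) := by
        refine pathClass_eq_of_starConvex inter_subset_left hst' _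
          ((segPath (p (t k)) z (s1.trans inter_subset_left)).trans
            (segPath z (p (t (k + 1))) (s2.trans inter_subset_left))) ?_ ?_
        · intro s
          have : p.subpath (t k) (t (k + 1)) s ∈ range (p.subpath (t k) (t (k + 1))) :=
            mem_range_self s
          rw [Path.range_subpath_of_le _ _ _ (htm (Nat.le_succ k))] at this
          obtain ⟨s', hs', h'⟩ := this
          rw [← h']
          exact hmem s' hs'
        · exact trans_mem (P := fun a : A => (a : E) ∈ A ∩ ball (z : E) (ρ z))
            (p := segPath (p (t k)) z _) (q := segPath z (p (t (k + 1))) _)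
            (fun s => s1 (segPath_mem _ _ _ s)) (fun s => s2 (segPath_mem _ _ _ s))
      rw [h2]
      exact htrans _ _ (hin z _ _ hk.2) (hout z _ _ hk'.2)
  have hfin := key n
  rw [ht0, hn n le_rfl, Path.subpath_zero_one] at hfin
  have : ∀ (x' y' : A) (hx : x' = x) (hy : y' = y), P (pathClass (p.cast hx hy)) →
      P (pathClass p) := by
    rintro _ _ rfl rfl h; exact h
  exact this _ _ _ _ hfin

end Classes

/-! ### Combinatorial null-homotopies -/

section Grid

variable {E : Type*} [NormedAddCommGroup E] [NormedSpace ℝ E]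

/-- The triangle is the cone with apex `x` over its opposite side. -/
theorem StarConvex.convexHull_triple_subset {B : Set E} {x y z : E} (hB : StarConvex ℝ x B)
    (h : segment ℝ y z ⊆ B) : convexHull ℝ {x, y, z} ⊆ B := by
  rw [convexHull_insert (by simp), convexHull_pair]
  intro p hp
  obtain ⟨a, ha, q, hq, hpq⟩ := mem_convexJoin.1 hp
  rw [mem_singleton_iff] at ha
  subst ha
  exact hB.segment_subset (h hq) hpq

/-- A triangle lying in `Z` and in a member of the cover `𝒰`. -/
def SmallTriangle (Z : Set E) (𝒰 : Set (Set E)) (x y z : E) : Prop :=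
  ∃ u ∈ 𝒰, convexHull ℝ {x, y, z} ⊆ Z ∩ u

theorem SmallTriangle.rotate {Z : Set E} {𝒰 : Set (Set E)} {x y z : E}
    (h : SmallTriangle Z 𝒰 x y z) : SmallTriangle Z 𝒰 y z x := by
  have : ({y, z, x} : Set E) = {x, y, z} := by ext; simp; tauto
  rw [SmallTriangle, this]; exact h

theorem SmallTriangle.swap {Z : Set E} {𝒰 : Set (Set E)} {x y z : E}
    (h : SmallTriangle Z 𝒰 x y z) : SmallTriangle Z 𝒰 x z y := by
  have : ({x, z, y} : Set E) = {x, y, z} := by ext; simp; tauto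
  rw [SmallTriangle, this]; exact h

/-- A combinatorial null-homotopy in `Z`, subordinate to the cover `𝒰`, of a path class of loops
in `L`: a grid of points of `Z`, constant on three sides, such that the triangles formed by the
centre of a square, one of its corners and an adjacent midpoint of an edge are in `Z`. The fourth
side is a polygon in `L` that represents the given class. -/
structure NullGrid (Z L : Set E) (𝒰 : Set (Set E)) {y : L} (g : PathClass y y) where
  /-- the number of squares in a row -/
  n : ℕ
  /-- the vertices -/
  w : ℕ → ℕ → E
  boundary : ∀ a b, (a = 0 ∨ 2 * n ≤ a ∨ 2 * n ≤ b) → w a b = y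
  tri_h : ∀ i j ε δ, ε ≤ 1 → δ ≤ 1 → SmallTriangle Z 𝒰
    (w (2 * i + 1) (2 * j + 1)) (w (2 * i + 2 * ε) (2 * j + 2 * δ)) (w (2 * i + 1) (2 * j + 2 * δ))
  tri_v : ∀ i j ε δ, ε ≤ 1 → δ ≤ 1 → SmallTriangle Z 𝒰
    (w (2 * i + 1) (2 * j + 1)) (w (2 * i + 2 * ε) (2 * j + 2 * δ)) (w (2 * i + 2 * ε) (2 * j + 1))
  bot_mem : ∀ a, w a 0 ∈ L
  bot_seg : ∀ a, segment ℝ (w a 0) (w (a + 1) 0) ⊆ L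
  /-- the classes of the initial pieces of the polygon -/
  τ : ∀ a, PathClass y (⟨w a 0, bot_mem a⟩ : L)
  τ_zero : ∀ h, τ 0 = seg y ⟨w 0 0, bot_mem 0⟩ h
  τ_succ : ∀ a, (τ a).trans (seg _ _ (bot_seg a)) = τ (a + 1)
  τ_last : ∀ h, τ (2 * n) = g.trans (seg y ⟨w (2 * n) 0, bot_mem (2 * n)⟩ h)

/-- Every unit square of a triangulated grid is the union of two triangles. -/
theorem square_of_triangles {F : Type*} {Q : F → F → F → Prop}
    (rot : ∀ {x y z}, Q x y z → Q y z x) (swap : ∀ {x y z}, Q x y z → Q x z y) {w : ℕ → ℕ → F}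
    (tri_h : ∀ i j ε δ, ε ≤ 1 → δ ≤ 1 → Q (w (2 * i + 1) (2 * j + 1))
      (w (2 * i + 2 * ε) (2 * j + 2 * δ)) (w (2 * i + 1) (2 * j + 2 * δ)))
    (tri_v : ∀ i j ε δ, ε ≤ 1 → δ ≤ 1 → Q (w (2 * i + 1) (2 * j + 1))
      (w (2 * i + 2 * ε) (2 * j + 2 * δ)) (w (2 * i + 2 * ε) (2 * j + 1))) (a b : ℕ) :
    (Q (w a b) (w (a + 1) b) (w (a + 1) (b + 1)) ∧
      Q (w a b) (w a (b + 1)) (w (a + 1) (b + 1))) ∨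
    (Q (w (a + 1) b) (w a b) (w a (b + 1)) ∧
      Q (w (a + 1) b) (w (a + 1) (b + 1)) (w a (b + 1))) := by
  -- The parities of `a` and `b` tell which vertex of the unit square is a centre (odd, odd); the
  -- diagonal runs from it to the opposite (even, even) corner.
  obtain ⟨i, rfl | rfl⟩ := Nat.even_or_odd' a <;> obtain ⟨j, rfl | rfl⟩ := Nat.even_or_odd' b
  · exact Or.inl ⟨rot (tri_h i j 0 0 (by simp) (by simp)), rot (tri_v i j 0 0 (by simp) (by simp))⟩
  · exact Or.inr ⟨swap (tri_v i j 0 1 (by simp) (by simp)), swap (tri_h i j 0 1 (by simp) (by simp))⟩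
  · exact Or.inr ⟨rot (tri_h i j 1 0 (by simp) (by simp)), rot (tri_v i j 1 0 (by simp) (by simp))⟩
  · exact Or.inl ⟨swap (tri_v i j 1 1 (by simp) (by simp)), swap (tri_h i j 1 1 (by simp) (by simp))⟩

/-- Parallel transport over a grid with commuting squares. -/
theorem exists_grid_section {T : ℕ → ℕ → Type*} (h : ∀ a b, T a b → T (a + 1) b)
    (v : ∀ a b, T a b → T a (b + 1))
    (comm : ∀ a b x, v (a + 1) b (h a b x) = h a (b + 1) (v a b x))
    (τ₀ : ∀ a, T a 0) (h₀ : ∀ a, h a 0 (τ₀ a) = τ₀ (a + 1)) :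
    ∃ τ : ∀ a b, T a b, (∀ a, τ a 0 = τ₀ a) ∧ (∀ a b, h a b (τ a b) = τ (a + 1) b) ∧
      ∀ a b, v a b (τ a b) = τ a (b + 1) := by
  -- Only vertical transport enters the definition; horizontal compatibility climbs from the bottom
  -- row by commutativity of the squares.
  let τ : ∀ a b, T a b := fun a b => Nat.rec (τ₀ a) (fun b x => v a b x) b
  refine ⟨τ, fun _ => rfl, fun a b => ?_, fun _ _ => rfl⟩
  induction b with
  | zero => exact h₀ a
  | succ b ih =>
    change h a (b + 1) (v a b (τ a b)) = v (a + 1) b (τ (a + 1) b)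
    rw [← ih, comm]

theorem lebesgue_number_of_pos {K : Set E} (hK : IsCompact K) {Z : Set E} (hKZ : K ⊆ Z)
    {R : E → ℝ} (hR : ∀ z ∈ Z, 0 < R z) :
    ∃ l > 0, ∀ p ∈ K, ∃ z ∈ Z, ball p l ⊆ ball z (R z) := by
  obtain ⟨l, hl, h⟩ := lebesgue_number_lemma_of_metric (c := fun z : Z => ball (z : E) (R z)) hK
    (fun _ => isOpen_ball)
    (fun p hp => mem_iUnion.2 ⟨⟨p, hKZ hp⟩, mem_ball_self (hR p (hKZ hp))⟩)
  exact ⟨l, hl, fun p hp => by obtain ⟨z, hz⟩ := h p hp; exact ⟨z, z.2, hz⟩⟩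

theorem exists_fine_partition {M : Type*} [PseudoMetricSpace M] (H : I × I → M)
    (hH : Continuous H) {ε : ℝ} (hε : 0 < ε) :
    ∃ (n : ℕ) (t : ℕ → I), Monotone t ∧ t 0 = 0 ∧ (∀ i, n ≤ i → t i = 1) ∧
      ∀ i j, ∀ s ∈ Icc (t i) (t (i + 1)), ∀ s' ∈ Icc (t j) (t (j + 1)),
        dist (H (s, s')) (H (t i, t j)) < ε := by
  obtain ⟨t, h0, hm, ⟨n, hn⟩, h⟩ := exists_monotone_Icc_subset_open_cover_unitInterval_prod_self
    (c := fun p : I × I => {q | dist (H q) (H p) < ε / 2})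
    (fun p => isOpen_lt (by fun_prop) continuous_const)
    (fun p _ => mem_iUnion.2 ⟨p, by simpa using hε⟩)
  refine ⟨n, t, hm, h0, hn, fun i j s hs s' hs' => ?_⟩
  obtain ⟨p, hp⟩ := h i j
  have h1 : dist (H (s, s')) (H p) < ε / 2 := hp ⟨hs, hs'⟩
  have h2 : dist (H (t i, t j)) (H p) < ε / 2 :=
    hp ⟨left_mem_Icc.2 (hm (Nat.le_succ i)), left_mem_Icc.2 (hm (Nat.le_succ j))⟩
  linarith [dist_triangle_right (H (s, s')) (H (t i, t j)) (H p)]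

theorem seg_cast_seg {A : Set E} {x y : A} (γ : Path x y) (x' y' v : A) (hx : x' = x) (hy : y' = y)
    (h1 : segment ℝ (x : E) x' ⊆ A) (h2 : segment ℝ (y' : E) v ⊆ A)
    (h3 : segment ℝ (y : E) v ⊆ A) :
    (seg x x' h1).trans ((pathClass (γ.cast hx hy)).trans (seg y' v h2)) =
      (pathClass γ).trans (seg y v h3) := by
  subst hx hy
  rw [seg_self]
  simp

/-- The polygonal description of a loop along which consecutive pieces are in star convex sets. -/
theorem exists_polygon_classes {L : Set E} {y : L} (γ : Path y y) (n : ℕ) (t : ℕ → I)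
    (htm : Monotone t) (ht0 : t 0 = 0) (htn : t n = 1) (w : ℕ → E)
    (hw : ∀ i, w (2 * i) = γ (t i))
    (B : ℕ → Set E) (hBL : ∀ i, B i ⊆ L) (hB : ∀ i, StarConvex ℝ (w (2 * i + 1)) (B i))
    (hγB : ∀ i, ∀ s ∈ Icc (t i) (t (i + 1)), (γ s : E) ∈ B i)
    (hmem : ∀ a, w a ∈ L) (hseg : ∀ a, segment ℝ (w a) (w (a + 1)) ⊆ L) :
    ∃ τ : ∀ a, PathClass y (⟨w a, hmem a⟩ : L), (∀ h, τ 0 = seg y ⟨w 0, hmem 0⟩ h) ∧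
      (∀ a, (τ a).trans (seg _ _ (hseg a)) = τ (a + 1)) ∧
      ∀ h, τ (2 * n) = (pathClass γ).trans (seg y ⟨w (2 * n), hmem (2 * n)⟩ h) := by
  have h0 : w 0 = y := by have := hw 0; simpa [ht0] using this
  have hs0 : segment ℝ (y : E) (w 0) ⊆ L := by rw [h0]; simp
  let τ : ∀ a, PathClass y (⟨w a, hmem a⟩ : L) := fun a =>
    Nat.rec (seg y ⟨w 0, hmem 0⟩ hs0) (fun a x => x.trans (seg _ _ (hseg a))) a
  refine ⟨τ, fun _ => rfl, fun _ => rfl, ?_⟩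
  have hs1 : segment ℝ (y : E) (γ 0 : E) ⊆ L := by simp
  have hs2 : ∀ i, segment ℝ (γ (t i) : E) (w (2 * i)) ⊆ L := fun i => by rw [hw]; simp
  -- Between `t i` and `t (i + 1)` the path and two edges of the polygon run in the star `B i`, so
  -- they have the same class. The segments at the ends are constant and only mediate between points
  -- that are equal but not definitionally so.
  have key : ∀ i, τ (2 * i) = (seg y (γ 0) hs1).trans
      ((pathClass (γ.subpath 0 (t i))).trans (seg (γ (t i)) ⟨w (2 * i), hmem (2 * i)⟩ (hs2 i))) := by
    intro i
    induction i with
    | zero =>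
      have : ∀ (s : I) (hs : s = 0) (h : segment ℝ (γ s : E) (w 0) ⊆ L),
          seg y ⟨w 0, hmem 0⟩ hs0 = (seg y (γ 0) hs1).trans
          ((pathClass (γ.subpath 0 s)).trans (seg (γ s) ⟨w 0, hmem 0⟩ h)) := by
        rintro _ rfl h
        rw [Path.subpath_self]
        have h' : (seg y (γ 0) hs1).trans (seg (γ 0) ⟨w 0, hmem 0⟩ h) =
            seg y ⟨w 0, hmem 0⟩ hs0 := by
          refine seg_trans _ _ _ ?_ _ _ _
          simp [γ.source, h0]
        rw [← h']
        simp
      exact this (t 0) ht0 (hs2 0)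
    | succ i ih =>
      have e1 : τ (2 * (i + 1)) = ((τ (2 * i)).trans (seg _ _ (hseg (2 * i)))).trans
        (seg _ _ (hseg (2 * i + 1))) := rfl
      have e2 : pathClass (γ.subpath 0 (t (i + 1))) = (pathClass (γ.subpath 0 (t i))).trans
          (pathClass (γ.subpath (t i) (t (i + 1)))) := by
        rw [← Path.Homotopic.Quotient.mk_trans]
        exact (Path.Homotopic.Quotient.eq.2 ⟨Path.Homotopy.subpathTransSubpath γ _ _ _⟩).symm
      have hi := left_mem_Icc.2 (htm (Nat.le_succ i))
      have hi' := right_mem_Icc.2 (htm (Nat.le_succ i))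
      have hmid : ∀ s ∈ Icc (t i) (t (i + 1)), segment ℝ (w (2 * i + 1)) (γ s : E) ⊆ B i :=
        fun s hs => (hB i).segment_subset (hγB i s hs)
      have e3 : (seg (γ (t i)) ⟨w (2 * i), hmem (2 * i)⟩ (hs2 i)).trans
          ((seg _ _ (hseg (2 * i))).trans
            (seg ⟨w (2 * i + 1), hmem _⟩ ⟨w (2 * i + 1 + 1), hmem _⟩ (hseg (2 * i + 1)))) =
          (pathClass (γ.subpath (t i) (t (i + 1)))).trans
            (seg (γ (t (i + 1))) ⟨w (2 * (i + 1)), hmem (2 * (i + 1))⟩ (hs2 (i + 1))) := by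
        refine pathClass_eq_of_starConvex (hBL i) (hB i)
          ((segPath (γ (t i)) ⟨w (2 * i), hmem (2 * i)⟩ (hs2 i)).trans
            ((segPath ⟨w (2 * i), hmem (2 * i)⟩ ⟨w (2 * i + 1), hmem (2 * i + 1)⟩
                (hseg (2 * i))).trans
              (segPath ⟨w (2 * i + 1), hmem (2 * i + 1)⟩ ⟨w (2 * i + 1 + 1), hmem _⟩
                (hseg (2 * i + 1)))))
          ((γ.subpath (t i) (t (i + 1))).trans
            (segPath (γ (t (i + 1))) ⟨w (2 * (i + 1)), hmem (2 * (i + 1))⟩ (hs2 (i + 1)))) ?_ ?_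
        · refine fun s => trans_mem (P := fun a : L => (a : E) ∈ B i) (fun s => ?_)
            (fun s => trans_mem (P := fun a : L => (a : E) ∈ B i) (fun s => ?_) (fun s => ?_) s) s
          · have h5 : segment ℝ (γ (t i) : E) (w (2 * i)) = {(γ (t i) : E)} := by
              rw [hw, segment_same]
            have h6 := h5.subset (segPath_mem (γ (t i)) ⟨w (2 * i), hmem _⟩ (hs2 i) s)
            rw [mem_singleton_iff.1 h6]; exact hγB i _ hi
          · have := segPath_mem ⟨w (2 * i), hmem _⟩ ⟨w (2 * i + 1), hmem _⟩ (hseg (2 * i)) s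
            refine hmid (t i) hi ?_
            rw [← hw, segment_symm]
            exact this
          · have := segPath_mem ⟨w (2 * i + 1), hmem _⟩ ⟨w (2 * i + 1 + 1), hmem _⟩
              (hseg (2 * i + 1)) s
            refine hmid (t (i + 1)) hi' ?_
            rw [← hw]
            exact this
        · refine fun s => trans_mem (P := fun a : L => (a : E) ∈ B i) (fun s => ?_)
            (fun s => ?_) s
          · have : γ.subpath (t i) (t (i + 1)) s ∈ range (γ.subpath (t i) (t (i + 1))) :=
              mem_range_self s
            rw [Path.range_subpath_of_le _ _ _ (htm (Nat.le_succ i))] at this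
            obtain ⟨s', hs', h'⟩ := this
            rw [← h']
            exact hγB i _ hs'
          · have h5 : segment ℝ (γ (t (i + 1)) : E) (w (2 * (i + 1))) = {(γ (t (i + 1)) : E)} := by
              rw [hw, segment_same]
            have h6 := h5.subset (segPath_mem (γ (t (i + 1))) ⟨w (2 * (i + 1)), hmem _⟩ (hs2 (i + 1)) s)
            rw [mem_singleton_iff.1 h6]; exact hγB i _ hi'
      rw [e1, ih, e2]
      simp only [Path.Homotopic.Quotient.trans_assoc]
      rw [← e3]
      rfl
  intro h
  rw [key n]
  have : ∀ (s : I) (hs : s = 1) (h' : segment ℝ (γ s : E) (w (2 * n)) ⊆ L),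
      (seg y (γ 0) hs1).trans ((pathClass (γ.subpath 0 s)).trans
        (seg (γ s) ⟨w (2 * n), hmem (2 * n)⟩ h')) =
      (pathClass γ).trans (seg y ⟨w (2 * n), hmem (2 * n)⟩ h) := by
    rintro _ rfl h'
    rw [Path.subpath_zero_one]
    exact seg_cast_seg γ _ _ _ _ _ _ _ _
  exact this _ htn _

/-- Two scales of stars are used. The homotopy is sampled on a mesh so fine that each mesh edge fits
in a small star, whose centre becomes the middle vertex of the edge, and that each square, with
these small stars, fits in a big star inside a member of `𝒰`, whose centre becomes the middle vertex
of the square. Half-edges are then radial segments, and the triangles are cones over them. Small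
stars on the bottom row are centred in `L`, so the polygon stays in `L`. The first index follows the
loop, the second the homotopy; beyond the mesh the grid is constant. -/
theorem exists_nullGrid {Z L : Set E} (hZ : LocStar Z) (hL : LocStar L) (hLZ : L ⊆ Z)
    (𝒰 : Set (Set E)) (h𝒰 : ∀ z ∈ Z, ∃ u ∈ 𝒰, u ∈ 𝓝[Z] z) {y : L} (g : PathClass y y)
    (hg : PathClass.incl hLZ g = Path.Homotopic.Quotient.refl _) :
    Nonempty (NullGrid Z L 𝒰 g) := by
  classical
  induction g using Path.Homotopic.Quotient.ind with | mk γ =>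
  obtain ⟨F⟩ := Path.Homotopic.Quotient.eq.1 hg
  set H : I × I → E := fun p => (F p : E) with hH
  have hHc : Continuous H := by fun_prop
  have hHZ : ∀ p, H p ∈ Z := fun p => (F p).2
  have hHγ : ∀ s, H (0, s) = γ s := fun s => congrArg Subtype.val (F.apply_zero s)
  have hH1 : ∀ s, H (1, s) = y := fun s => congrArg Subtype.val (F.apply_one s)
  have hHl : ∀ s, H (s, 0) = y := fun s => congrArg Subtype.val (F.source s)
  have hHr : ∀ s, H (s, 1) = y := fun s => congrArg Subtype.val (F.target s)
  have hK : IsCompact (range H) := isCompact_range hHc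
  have hKZ : range H ⊆ Z := range_subset_iff.2 hHZ
  -- big stars
  have hR : ∀ z, ∃ r, z ∈ Z → 0 < r ∧ StarConvex ℝ z (Z ∩ ball z r) ∧
      ∃ u ∈ 𝒰, Z ∩ ball z r ⊆ u := by
    intro z
    by_cases hz : z ∈ Z
    · obtain ⟨r, hr, hst⟩ := hZ z hz
      obtain ⟨u, hu, hun⟩ := h𝒰 z hz
      obtain ⟨s, hs, hs'⟩ := Metric.mem_nhdsWithin_iff.1 hun
      refine ⟨min r s, fun _ => ⟨lt_min hr hs, hst.inter_ball_mono (lt_min hr hs)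
        (min_le_left _ _), u, hu, fun p hp => hs' ⟨ball_subset_ball (min_le_right _ _) hp.2, hp.1⟩⟩⟩
    · exact ⟨0, fun h => absurd h hz⟩
  choose R hR using hR
  obtain ⟨l, hl, hlR⟩ := lebesgue_number_of_pos hK hKZ (fun z hz => (hR z hz).1)
  -- small stars
  have hρ : ∀ z, ∃ r, z ∈ Z → 0 < r ∧ r ≤ l / 4 ∧ StarConvex ℝ z (Z ∩ ball z r) ∧
      (z ∈ L → StarConvex ℝ z (L ∩ ball z r)) := by
    intro z
    by_cases hz : z ∈ Z
    · obtain ⟨r, hr, hst⟩ := hZ z hz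
      by_cases hzL : z ∈ L
      · obtain ⟨s, hs, hst'⟩ := hL z hzL
        have hm : 0 < min (l / 4) (min r s) := lt_min (by linarith) (lt_min hr hs)
        exact ⟨_, fun _ => ⟨hm, min_le_left _ _, hst.inter_ball_mono hm
          ((min_le_right _ _).trans (min_le_left _ _)), fun _ => hst'.inter_ball_mono hm
          ((min_le_right _ _).trans (min_le_right _ _))⟩⟩
      · have hm : 0 < min (l / 4) r := lt_min (by linarith) hr
        exact ⟨_, fun _ => ⟨hm, min_le_left _ _, hst.inter_ball_mono hm (min_le_right _ _),
          fun h => absurd h hzL⟩⟩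
    · exact ⟨0, fun h => absurd h hz⟩
  choose ρ hρ using hρ
  obtain ⟨l₂, hl₂, hlρ⟩ := lebesgue_number_of_pos hK hKZ (fun z hz => (hρ z hz).1)
  -- A separate Lebesgue number for stars with centre in `L`, used on the bottom row only; there `ρ`
  -- is also a radius for stars of `L`.
  obtain ⟨l₃, hl₃, hlL⟩ := lebesgue_number_of_pos (K := range fun s => (γ s : E)) (Z := L)
    (isCompact_range (by fun_prop)) (range_subset_iff.2 fun s => (γ s).2) (R := ρ)
    (fun z hz => (hρ z (hLZ hz)).1)
  obtain ⟨n, t, htm, ht0, htn, ht⟩ := exists_fine_partition H hHc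
    (lt_min (show 0 < l / 4 by linarith) (lt_min hl₂ hl₃))
  set g : ℕ → ℕ → E := fun i j => H (t j, t i) with hg'
  have hdist : ∀ i j, ∀ s ∈ Icc (t i) (t (i + 1)), ∀ s' ∈ Icc (t j) (t (j + 1)),
      dist (H (s', s)) (g i j) < min (l / 4) (min l₂ l₃) := fun i j s hs s' hs' => ht j i s' hs' s hs
  have hl4 : ∀ {x : ℝ}, x < min (l / 4) (min l₂ l₃) → x < l / 4 ∧ x < l₂ ∧ x < l₃ := fun h =>
    ⟨lt_of_lt_of_le h (min_le_left _ _),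
      lt_of_lt_of_le h ((min_le_right _ _).trans (min_le_left _ _)),
      lt_of_lt_of_le h ((min_le_right _ _).trans (min_le_right _ _))⟩
  have hm0 : ∀ i, t i ∈ Icc (t i) (t (i + 1)) := fun i => left_mem_Icc.2 (htm (Nat.le_succ i))
  have hm1 : ∀ i, t (i + 1) ∈ Icc (t i) (t (i + 1)) := fun i =>
    right_mem_Icc.2 (htm (Nat.le_succ i))
  have hgy : ∀ i j, i = 0 ∨ n ≤ i ∨ n ≤ j → g i j = y := by
    rintro i j (rfl | h | h)
    · simp only [hg', ht0, hHl]
    · simp only [hg', htn i h, hHr]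
    · simp only [hg', htn j h, hH1]
  choose X hXZ hX using fun i j => hlR (g i j) (mem_range_self _)
  choose e heZ he using fun i j => hlρ (g i j) (mem_range_self _)
  choose f hfL hf using fun i => hlL (γ (t i)) (mem_range_self (f := fun s => (γ s : E)) (t i))
  have hyZ : (y : E) ∈ Z := hLZ y.2
  -- Midpoints on constant edges are set to `y`, since a star centre there need not be `y`.
  set hm : ℕ → ℕ → E := fun i j => if n ≤ i ∨ n ≤ j then y else if j = 0 then f i else e i j
    with hhm
  set vm : ℕ → ℕ → E := fun i j => if i = 0 ∨ n ≤ i ∨ n ≤ j then y else e i j with hvm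
  set cm : ℕ → ℕ → E := fun i j => if n ≤ i ∨ n ≤ j then y else X i j with hcm
  -- The bound `ρ ≤ l / 4` keeps a half-edge within `l / 2` of any point `q` of its small star.
  -- Adding `l / 4` for the distance between mesh corners stays below `l`, the radius that a big
  -- star absorbs.
  have star_seg : ∀ z ∈ Z, ∀ p ∈ Z, ∀ q, dist q z < ρ z → dist p z < ρ z →
      segment ℝ z p ⊆ Z ∩ ball q (l / 2) := by
    intro z hz p hp q hqz hpz x hx
    obtain ⟨h1, h2, h3, -⟩ := hρ z hz
    have := h3.segment_subset ⟨hp, hpz⟩ hx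
    refine ⟨this.1, ?_⟩
    have h4 : dist x z < ρ z := this.2
    rw [mem_ball]
    linarith [dist_triangle_right x q z]
  have hhm_seg : ∀ i j ε, ε ≤ 1 → segment ℝ (hm i j) (g (i + ε) j) ⊆ Z ∩ ball (g i j) (l / 2) := by
    intro i j ε hε
    by_cases h : n ≤ i ∨ n ≤ j
    · have h1 : hm i j = y := if_pos h
      rw [h1, hgy (i + ε) j (by omega), hgy i j (by omega)]
      simpa [hyZ] using hl
    have hz : ∀ s ∈ Icc (t i) (t (i + 1)), dist (H (t j, s)) (hm i j) < ρ (hm i j) := by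
      intro s hs
      have hd := hl4 (hdist i j s hs (t j) (hm0 j))
      by_cases hj : j = 0
      · have h1 : hm i j = f i := (if_neg h).trans (if_pos hj)
        rw [h1]
        refine hf i ?_
        rw [← hHγ]
        have : g i j = H (0, t i) := by rw [hj]; simp only [hg', ht0]
        rw [← this]; exact hd.2.2
      · have h1 : hm i j = e i j := (if_neg h).trans (if_neg hj)
        rw [h1]
        exact he i j hd.2.1
    have hzZ : hm i j ∈ Z := by
      by_cases hj : j = 0
      · rw [show hm i j = f i from (if_neg h).trans (if_pos hj)]
        exact hLZ (hfL i)
      · rw [show hm i j = e i j from (if_neg h).trans (if_neg hj)]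
        exact heZ i j
    refine star_seg _ hzZ _ (hHZ _) _ (hz _ (hm0 i)) ?_
    interval_cases ε
    · exact hz _ (hm0 i)
    · exact hz _ (hm1 i)
  have hvm_seg : ∀ i j δ, δ ≤ 1 → segment ℝ (vm i j) (g i (j + δ)) ⊆ Z ∩ ball (g i j) (l / 2) := by
    intro i j δ hδ
    by_cases h : i = 0 ∨ n ≤ i ∨ n ≤ j
    · have h1 : vm i j = y := if_pos h
      rw [h1, hgy i (j + δ) (by omega), hgy i j (by omega)]
      simpa [hyZ] using hl
    have h1 : vm i j = e i j := if_neg h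
    have hz : ∀ s ∈ Icc (t j) (t (j + 1)), dist (H (s, t i)) (e i j) < ρ (e i j) := fun s hs =>
      he i j (hl4 (hdist i j (t i) (hm0 i) s hs)).2.1
    rw [h1]
    refine star_seg _ (heZ i j) _ (hHZ _) _ (hz _ (hm0 j)) ?_
    interval_cases δ
    · exact hz _ (hm0 j)
    · exact hz _ (hm1 j)
  have htri : ∀ i j p q c, segment ℝ p q ⊆ Z ∩ ball c (l / 2) → dist c (g i j) < l / 4 →
      SmallTriangle Z 𝒰 (X i j) q p := by
    intro i j p q c hpq hc
    obtain ⟨h1, h2, u, hu, hu'⟩ := hR _ (hXZ i j)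
    refine ⟨u, hu, ?_⟩
    have hsub : segment ℝ q p ⊆ Z ∩ ball (X i j) (R (X i j)) := by
      rw [segment_symm]
      intro x hx
      refine ⟨(hpq hx).1, hX i j ?_⟩
      have : dist x c < l / 2 := (hpq hx).2
      rw [mem_ball]
      linarith [dist_triangle x c (g i j)]
    intro x hx
    have := h2.convexHull_triple_subset hsub hx
    exact ⟨this.1, hu' this⟩
  have hdeg : SmallTriangle Z 𝒰 y y y := by
    obtain ⟨u, hu, hun⟩ := h𝒰 y hyZ
    exact ⟨u, hu, by simpa using ⟨hyZ, mem_of_mem_nhdsWithin hyZ hun⟩⟩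
  set w : ℕ → ℕ → E := fun a b => if a % 2 = 0 then
    (if b % 2 = 0 then g (a / 2) (b / 2) else vm (a / 2) (b / 2)) else
    (if b % 2 = 0 then hm (a / 2) (b / 2) else cm (a / 2) (b / 2)) with hw
  have hwg : ∀ i j, w (2 * i) (2 * j) = g i j := fun i j => by simp [hw]
  have hwv : ∀ i j, w (2 * i) (2 * j + 1) = vm i j := fun i j => by
    have h1 : (2 * j + 1) % 2 = 1 := by omega
    have h2 : (2 * j + 1) / 2 = j := by omega
    simp [hw, h1, h2]
  have hwh : ∀ i j, w (2 * i + 1) (2 * j) = hm i j := fun i j => by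
    have h1 : (2 * i + 1) % 2 = 1 := by omega
    have h2 : (2 * i + 1) / 2 = i := by omega
    simp [hw, h1, h2]
  have hwc : ∀ i j, w (2 * i + 1) (2 * j + 1) = cm i j := fun i j => by
    have h1 : (2 * i + 1) % 2 = 1 := by omega
    have h2 : (2 * i + 1) / 2 = i := by omega
    have h3 : (2 * j + 1) % 2 = 1 := by omega
    have h4 : (2 * j + 1) / 2 = j := by omega
    simp [hw, h1, h2, h3, h4]
  have hbd : ∀ a b, (a = 0 ∨ 2 * n ≤ a ∨ 2 * n ≤ b) → w a b = y := by
    intro a b h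
    obtain ⟨i, rfl | rfl⟩ := Nat.even_or_odd' a <;> obtain ⟨j, rfl | rfl⟩ := Nat.even_or_odd' b
    · rw [hwg]; exact hgy i j (by omega)
    · rw [hwv]; exact if_pos (by omega)
    · rw [hwh]; exact if_pos (by omega)
    · rw [hwc]; exact if_pos (by omega)
  have hbot : ∀ i, ∃ B ⊆ L, StarConvex ℝ (w (2 * i + 1) 0) B ∧
      ∀ s ∈ Icc (t i) (t (i + 1)), (γ s : E) ∈ B := by
    intro i
    have e0 : w (2 * i + 1) 0 = hm i 0 := hwh i 0
    rw [e0]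
    by_cases h : n ≤ i
    · have h1 : hm i 0 = y := if_pos (Or.inl h)
      refine ⟨{(y : E)}, by simp, ?_, ?_⟩
      · rw [h1]; exact starConvex_singleton _
      · intro s hs
        rw [htn i h, htn (i + 1) (by omega), Icc_self, mem_singleton_iff] at hs
        simp [hs]
    by_cases h' : n = 0
    · omega
    have h1 : hm i 0 = f i := by simp [hhm, h, h']
    rw [h1]
    refine ⟨L ∩ ball (f i) (ρ (f i)), inter_subset_left, (hρ _ (hLZ (hfL i))).2.2.2 (hfL i), ?_⟩
    intro s hs
    refine ⟨(γ s).2, hf i ?_⟩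
    have hd := (hl4 (hdist i 0 s hs (t 0) (hm0 0))).2.2
    have e1 : g i 0 = γ (t i) := by simp only [hg', ht0, hHγ]
    rw [e1, ht0, hHγ] at hd
    exact hd
  choose B hBL hBst hBγ using hbot
  have hwγ : ∀ i, w (2 * i) 0 = γ (t i) := fun i => by
    have := hwg i 0
    simp only [mul_zero] at this
    rw [this]; simp only [hg', ht0, hHγ]
  have hodd : ∀ i, w (2 * i + 1) 0 ∈ B i := fun i =>
    (hBst i).mem ⟨_, hBγ i _ (hm0 i)⟩
  have hbm : ∀ a, w a 0 ∈ L := by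
    intro a
    obtain ⟨i, rfl | rfl⟩ := Nat.even_or_odd' a
    · rw [hwγ]; exact (γ (t i)).2
    · exact hBL i (hodd i)
  have hbs : ∀ a, segment ℝ (w a 0) (w (a + 1) 0) ⊆ L := by
    intro a
    obtain ⟨i, rfl | rfl⟩ := Nat.even_or_odd' a
    · rw [hwγ, segment_symm]
      exact ((hBst i).segment_subset (hBγ i _ (hm0 i))).trans (hBL i)
    · have : 2 * i + 1 + 1 = 2 * (i + 1) := by ring
      rw [this, hwγ]
      exact ((hBst i).segment_subset (hBγ i _ (hm1 i))).trans (hBL i)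
  obtain ⟨τ, hτ0, hτs, hτn⟩ := exists_polygon_classes γ n t htm ht0 (htn n le_rfl)
    (fun a => w a 0) hwγ B hBL hBst hBγ hbm hbs
  refine ⟨⟨n, w, hbd, ?_, ?_, hbm, hbs, τ, hτ0, hτs, hτn⟩⟩
  · intro i j ε δ hε hδ
    have e1 : 2 * i + 2 * ε = 2 * (i + ε) := by ring
    have e2 : 2 * j + 2 * δ = 2 * (j + δ) := by ring
    rw [e1, e2, hwc, hwg, hwh]
    by_cases h : n ≤ i ∨ n ≤ j
    · have h1 : cm i j = y := if_pos h
      have h2 : hm i (j + δ) = y := if_pos (by omega)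
      rw [h1, h2, hgy _ _ (by omega)]
      exact hdeg
    · have h1 : cm i j = X i j := if_neg h
      rw [h1]
      refine htri i j _ _ (g i (j + δ)) (hhm_seg i (j + δ) ε hε) ?_
      interval_cases δ
      · simpa using hl
      · exact (hl4 (hdist i j _ (hm0 i) _ (hm1 j))).1
  · intro i j ε δ hε hδ
    have e1 : 2 * i + 2 * ε = 2 * (i + ε) := by ring
    have e2 : 2 * j + 2 * δ = 2 * (j + δ) := by ring
    rw [e1, e2, hwc, hwg, hwv]
    by_cases h : n ≤ i ∨ n ≤ j
    · have h1 : cm i j = y := if_pos h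
      have h2 : vm (i + ε) j = y := if_pos (by omega)
      rw [h1, h2, hgy _ _ (by omega)]
      exact hdeg
    · have h1 : cm i j = X i j := if_neg h
      rw [h1]
      refine htri i j _ _ (g (i + ε) j) (hvm_seg (i + ε) j δ hδ) ?_
      interval_cases ε
      · simpa using hl
      · exact (hl4 (hdist i j _ (hm1 i) _ (hm0 j))).1

end Grid

/-! ### Groupoid identities -/

section Groupoid

variable {Y : Type*} [TopologicalSpace Y] {x y z w : Y}

theorem PathClass.trans_symm_cancel_left (p : PathClass x y) (q : PathClass x z) :
    p.trans (p.symm.trans q) = q := by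
  rw [← Path.Homotopic.Quotient.trans_assoc]; simp

theorem PathClass.symm_trans_cancel_left (p : PathClass x y) (q : PathClass y z) :
    p.symm.trans (p.trans q) = q := by
  rw [← Path.Homotopic.Quotient.trans_assoc]; simp

theorem PathClass.symm_symm (p : PathClass x y) :
    Path.Homotopic.Quotient.symm (Path.Homotopic.Quotient.symm p) = p := by
  induction p using Path.Homotopic.Quotient.ind with | mk p =>
  rw [← Path.Homotopic.Quotient.mk_symm, ← Path.Homotopic.Quotient.mk_symm, Path.symm_symm]

theorem PathClass.trans_symm_rev (p : PathClass x y) (q : PathClass y z) :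
    (p.trans q).symm = q.symm.trans p.symm := by
  induction p using Path.Homotopic.Quotient.ind with | mk p =>
  induction q using Path.Homotopic.Quotient.ind with | mk q =>
  rw [← Path.Homotopic.Quotient.mk_trans, ← Path.Homotopic.Quotient.mk_symm, Path.trans_symm]
  rfl

theorem PathClass.trans_left_cancel {p : PathClass x y} {q r : PathClass y z}
    (h : p.trans q = p.trans r) : q = r := by
  rw [← PathClass.symm_trans_cancel_left p q, h, PathClass.symm_trans_cancel_left]

theorem PathClass.trans_right_cancel {p q : PathClass x y} {r : PathClass y z}
    (h : p.trans r = q.trans r) : p = q := by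
  have := congrArg (fun s => Path.Homotopic.Quotient.trans s r.symm) h
  simpa using this

theorem PathClass.nonempty_of_joined (h : Joined x y) : Nonempty (PathClass x y) :=
  ⟨pathClass h.somePath⟩

theorem PathClass.joined (p : PathClass x y) : Joined x y := by
  obtain ⟨q, -⟩ := Path.Homotopic.Quotient.mk_surjective p
  exact ⟨q⟩

/-- A compatible family `τ` is a section of the universal cover: each class from `x` to `y` must be
the inverse of `τ x` followed by `τ y`. -/
theorem simplyConnectedSpace_of_section {b : Y} (τ : ∀ x, PathClass b x)
    (h : ∀ {x y : Y} (p : PathClass x y), (τ x).trans p = τ y) : SimplyConnectedSpace Y := by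
  rw [simply_connected_iff_paths_homotopic]
  refine ⟨⟨⟨b⟩, fun x y => ((τ x).joined.symm).trans (τ y).joined⟩, fun x y => ⟨fun p q => ?_⟩⟩
  exact PathClass.trans_left_cancel ((h p).trans (h q).symm)

end Groupoid

/-! ### Finite unions of closed convex sets -/

section Cells

variable {E : Type*} [NormedAddCommGroup E] [NormedSpace ℝ E] {ι : Type*} [Finite ι]
  {c : ι → Set E} {A : Set E}

/-- Near a point only the cells through it are visible, so short radial segments lie in single
cells. -/
theorem path_induction_cells (hA : A = ⋃ i, c i) (hc : ∀ i, IsClosed (c i))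
    (hcv : ∀ i, Convex ℝ (c i))
    (P : ∀ {x y : A}, PathClass x y → Prop)
    (htrans : ∀ {x y z : A} (p : PathClass x y) (q : PathClass y z),
      P p → P q → P (p.trans q))
    (hseg : ∀ i (x y : A) (h : segment ℝ (x : E) y ⊆ A),
      (x : E) ∈ c i → (y : E) ∈ c i → P (seg x y h))
    {x y : A} (p : PathClass x y) : P p := by
  subst hA
  choose ρ hρ hr using exists_ball_of_finite_closed c hc
  refine LocStar.path_induction (A := ⋃ i, c i) (ρ := ρ) (fun x _ => hρ x)
    (fun x _ => starConvex_iUnion_inter_ball hcv (hρ x) (hr x)) P htrans ?_ ?_ p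
  · intro x y h hd
    obtain ⟨i, hi⟩ := mem_iUnion.1 y.2
    exact hseg i x y h (hr x i y hi hd) hi
  · intro x y h hd
    obtain ⟨i, hi⟩ := mem_iUnion.1 y.2
    exact hseg i y x h hi (hr x i y hi hd)

theorem isSimplyConnected_iUnion_of_section (hA : A = ⋃ i, c i) (hc : ∀ i, IsClosed (c i))
    (hcv : ∀ i, Convex ℝ (c i)) {b : A} (τ : ∀ x, PathClass b x)
    (h : ∀ i (x y : A) (h : segment ℝ (x : E) y ⊆ A),
      (x : E) ∈ c i → (y : E) ∈ c i → (τ x).trans (seg x y h) = τ y) :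
    IsSimplyConnected A :=
  simplyConnectedSpace_of_section τ fun p =>
    path_induction_cells hA hc hcv (fun {x y} p => (τ x).trans p = τ y)
      (fun p q hp hq => by rw [← Path.Homotopic.Quotient.trans_assoc, hp, hq])
      (fun i x y hs hx hy => h i x y hs hx hy) p

/-- The fundamental group of a path connected finite union of closed convex sets is finitely
generated. -/
theorem fundamentalGroup_iUnion_fg (hA : A = ⋃ i, c i) (hc : ∀ i, IsClosed (c i))
    (hcv : ∀ i, Convex ℝ (c i))
    (b : A) (hb : ∀ x, Nonempty (PathClass b x)) :
    Group.FG (FundamentalGroup A b) := by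
  classical
  have hcA : ∀ i, c i ⊆ A := fun i => hA ▸ subset_iUnion c i
  have hz : ∀ i, ∃ z : A, (c i).Nonempty → (z : E) ∈ c i := by
    intro i
    by_cases h : (c i).Nonempty
    · exact ⟨⟨h.some, hcA i h.some_mem⟩, fun _ => h.some_mem⟩
    · exact ⟨b, fun h' => absurd h' h⟩
  choose z hz using hz
  choose τ _ using fun x => exists_true_iff_nonempty.2 (hb x)
  have hsub : ∀ {i} {x y : A}, (x : E) ∈ c i → (y : E) ∈ c i → segment ℝ (x : E) y ⊆ A :=
    fun hx hy => ((hcv _).segment_subset hx hy).trans (hcA _)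
  -- One generator for each pair of cells that meet: from `b` to the marked point of the first cell,
  -- through a common point to the marked point of the second, and back to `b`.
  let g : ι × ι → FundamentalGroup A b := fun ij =>
    if h : (c ij.1 ∩ c ij.2).Nonempty then
      let p : A := ⟨h.some, hcA _ h.some_mem.1⟩
      ((τ (z ij.1)).trans (((seg (z ij.1) p (hsub (hz _ ⟨_, h.some_mem.1⟩) h.some_mem.1)).trans
        (seg p (z ij.2) (hsub h.some_mem.2 (hz _ ⟨_, h.some_mem.2⟩)))).trans (τ (z ij.2)).symm) :
          PathClass b b)
    else 1
  set H := Subgroup.closure (range g) with hH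
  choose k hk using fun x : A => mem_iUnion.1 (hA.subset x.2)
  let κ : ∀ x : A, PathClass b x := fun x =>
    (τ (z (k x))).trans (seg (z (k x)) x (hsub (hz _ ⟨_, hk x⟩) (hk x)))
  have hzm : ∀ {m} {x : A}, (x : E) ∈ c m → (z m : E) ∈ c m := fun h => hz _ ⟨_, h⟩
  have key : ∀ m (x : A) (hx : (x : E) ∈ c m),
      (((κ x).trans ((seg x (z m) (hsub hx (hzm hx))).trans (τ (z m)).symm) : PathClass b b) :
        FundamentalGroup A b) ∈ H := by
    intro m x hx
    have hne : (c (k x) ∩ c m).Nonempty := ⟨x, hk x, hx⟩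
    have : g (k x, m) = ((κ x).trans ((seg x (z m) (hsub hx (hzm hx))).trans (τ (z m)).symm) :
        PathClass b b) := by
      simp only [g, dif_pos hne]
      set p : A := ⟨hne.some, hcA _ hne.some_mem.1⟩
      have hp1 : (p : E) ∈ c (k x) := hne.some_mem.1
      have hp2 : (p : E) ∈ c m := hne.some_mem.2
      have e1 : (seg (z (k x)) p (hsub (hzm (hk x)) hp1)).trans (seg p x (hsub hp1 (hk x))) =
          seg (z (k x)) x (hsub (hzm (hk x)) (hk x)) :=
        seg_trans_of_convex (hcA _) (hcv _) _ _ _ (hzm (hk x)) hp1 (hk x)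
      have e2 : (seg p x (hsub hp2 hx)).trans (seg x (z m) (hsub hx (hzm hx))) =
          seg p (z m) (hsub hp2 (hzm hx)) :=
        seg_trans_of_convex (hcA _) (hcv _) _ _ _ hp2 hx (hzm hx)
      simp only [κ, ← e1, Path.Homotopic.Quotient.trans_assoc]
      rw [← Path.Homotopic.Quotient.trans_assoc (seg p x _) (seg x (z m) _), e2]
    rw [← this]
    exact Subgroup.subset_closure ⟨_, rfl⟩
  have main : ∀ {x y : A} (p : PathClass x y),
      (((κ x).trans (p.trans (κ y).symm) : PathClass b b) : FundamentalGroup A b) ∈ H := by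
    intro x y p
    refine path_induction_cells hA hc hcv (fun {x y} p =>
      (((κ x).trans (p.trans (κ y).symm) : PathClass b b) : FundamentalGroup A b) ∈ H) ?_ ?_ p
    · intro x y w p q hp hq
      -- Multiplication in `FundamentalGroup` composes in the order opposite to `trans`.
      have := H.mul_mem hq hp
      rw [FundamentalGroup.mul_def] at this
      simpa only [Path.Homotopic.Quotient.trans_assoc, PathClass.symm_trans_cancel_left] using this
    · intro i x y h hx hy
      have := H.mul_mem (H.inv_mem (key i y hy)) (key i x hx)
      rw [FundamentalGroup.mul_def, FundamentalGroup.inv_def] at this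
      have e : seg x y h = (seg x (z i) (hsub hx (hzm hx))).trans
          (seg y (z i) (hsub hy (hzm hy))).symm := by
        rw [seg_symm _ _ _ (hsub (hzm hy) hy)]
        exact (seg_trans_of_convex (hcA _) (hcv _) _ _ _ hx (hzm hx) hy).symm
      rw [e]
      simpa only [Path.Homotopic.Quotient.trans_assoc, PathClass.symm_trans_cancel_left,
        PathClass.trans_symm_rev, PathClass.symm_symm] using this
  refine ⟨⟨(finite_range g).toFinset, ?_⟩⟩
  rw [Finite.coe_toFinset, eq_top_iff]
  intro p _
  -- Conjugating beforehand undoes the conjugation by `κ b` built into `main`.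
  have := main ((κ b).symm.trans ((p : PathClass b b).trans (κ b)))
  simpa only [Path.Homotopic.Quotient.trans_assoc, PathClass.trans_symm_cancel_left,
    Path.Homotopic.Quotient.trans_symm, Path.Homotopic.Quotient.trans_refl] using this

/-- Membership in a normal closure involves only finitely many elements of `A`; collect these over a
finite generating set of `G`. -/
theorem exists_finite_normalClosure_eq_top {G : Type*} [Group G] [hG : Group.FG G] {A : Set G}
    (hA : Subgroup.normalClosure A = ⊤) :
    ∃ B ⊆ A, B.Finite ∧ Subgroup.normalClosure B = ⊤ := by
  obtain ⟨S, hS⟩ := hG.out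
  have h1 : ∀ g ∈ Subgroup.normalClosure A, ∃ B ⊆ A, B.Finite ∧ g ∈ Subgroup.normalClosure B := by
    intro g hg
    have mono : ∀ {B B' : Set G} {g : G}, g ∈ Subgroup.normalClosure B → B ⊆ B' →
      g ∈ Subgroup.normalClosure B' := fun h hB => Subgroup.normalClosure_mono hB h
    induction hg using Subgroup.closure_induction with
    | mem x hx =>
      obtain ⟨a, ha, hax⟩ := Group.mem_conjugatesOfSet_iff.1 hx
      refine ⟨{a}, singleton_subset_iff.2 ha, finite_singleton a, ?_⟩
      exact Subgroup.conjugatesOfSet_subset_normalClosure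
        (Group.mem_conjugatesOfSet_iff.2 ⟨a, rfl, hax⟩)
    | one => exact ⟨∅, empty_subset _, finite_empty, Subgroup.one_mem _⟩
    | mul x y _ _ hx hy =>
      obtain ⟨B, hB, hBf, hxB⟩ := hx
      obtain ⟨B', hB', hBf', hyB⟩ := hy
      exact ⟨B ∪ B', union_subset hB hB', hBf.union hBf',
        Subgroup.mul_mem _ (mono hxB subset_union_left) (mono hyB subset_union_right)⟩
    | inv x _ hx =>
      obtain ⟨B, hB, hBf, hxB⟩ := hx
      exact ⟨B, hB, hBf, Subgroup.inv_mem _ hxB⟩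
  choose! B hBA hBf hB using h1
  have hall : ∀ g, g ∈ Subgroup.normalClosure A := fun g => hA ▸ Subgroup.mem_top g
  refine ⟨⋃ g ∈ S, B g, iUnion₂_subset fun g _ => hBA g (hall g),
    S.finite_toSet.biUnion fun g _ => hBf g (hall g), ?_⟩
  rw [eq_top_iff, ← hS, Subgroup.closure_le]
  intro g hg
  exact Subgroup.normalClosure_mono (subset_biUnion_of_mem (u := B) hg) (hB g (hall g))

end Cells

/-! ### Constructions of compact polyhedra -/

section Polyhedra

variable {E F : Type*} [NormedAddCommGroup E] [NormedSpace ℝ E] [NormedAddCommGroup F]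
  [NormedSpace ℝ F] {A B : Set E}

theorem isCompactPolyhedron_convexHull {s : Set E} (hs : s.Finite) :
    IsCompactPolyhedron (convexHull ℝ s) :=
  ⟨{hs.toFinset}, finite_singleton _, by simp⟩

theorem IsCompactPolyhedron.iUnion {ι : Type*} [Finite ι] {c : ι → Set E}
    (h : ∀ i, IsCompactPolyhedron (c i)) : IsCompactPolyhedron (⋃ i, c i) := by
  choose S hS hc using h
  refine ⟨⋃ i, S i, finite_iUnion hS, ?_⟩
  rw [biUnion_iUnion]
  exact iUnion_congr hc

theorem IsCompactPolyhedron.union (hA : IsCompactPolyhedron A) (hB : IsCompactPolyhedron B) :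
    IsCompactPolyhedron (A ∪ B) := by
  rw [union_eq_iUnion]
  exact IsCompactPolyhedron.iUnion fun b => by cases b <;> assumption

theorem IsCompactPolyhedron.image (h : IsCompactPolyhedron A) (f : E →ₗ[ℝ] F) :
    IsCompactPolyhedron (f '' A) := by
  classical
  obtain ⟨S, hS, rfl⟩ := h
  refine ⟨(fun s => s.image f) '' S, hS.image _, ?_⟩
  rw [biUnion_image, image_iUnion₂]
  refine iUnion₂_congr fun s _ => ?_
  rw [LinearMap.image_convexHull, Finset.coe_image]

theorem mem_convexHull_triple {p q r x : E} (hx : x ∈ convexHull ℝ {p, q, r}) :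
    ∃ α β γ : ℝ, 0 ≤ α ∧ 0 ≤ β ∧ 0 ≤ γ ∧ α + β + γ = 1 ∧ x = α • p + β • q + γ • r := by
  rw [convexHull_insert (by simp), convexHull_pair] at hx
  obtain ⟨a, ha, z, hz, hx⟩ := mem_convexJoin.1 hx
  rw [mem_singleton_iff] at ha
  subst ha
  obtain ⟨s, t, hs, ht, hst, rfl⟩ := hz
  obtain ⟨u, v, hu, hv, huv, rfl⟩ := hx
  refine ⟨u, v * s, v * t, hu, by positivity, by positivity, ?_, ?_⟩
  · rw [add_assoc, ← mul_add, hst, mul_one, huv]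
  · rw [smul_add, smul_smul, smul_smul, add_assoc]

theorem seg_map {B : Set F} (f : E →ᵃ[ℝ] F) (φ : C(A, B)) (hφ : ∀ x, (φ x : F) = f x) (x y : A)
    (h : segment ℝ (x : E) y ⊆ A) (h' : segment ℝ (φ x : F) (φ y) ⊆ B) :
    Path.Homotopic.Quotient.map (seg x y h) φ = seg (φ x) (φ y) h' := by
  refine congrArg Path.Homotopic.Quotient.mk ?_
  ext t
  simp [segPath, hφ, AffineMap.apply_lineMap]

theorem map_trans {Y Z : Type*} [TopologicalSpace Y] [TopologicalSpace Z] (φ : C(Y, Z))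
    {x y z : Y} (p : PathClass x y) (q : PathClass y z) :
    Path.Homotopic.Quotient.map (p.trans q) φ =
      (Path.Homotopic.Quotient.map p φ).trans (Path.Homotopic.Quotient.map q φ) := by
  induction p using Path.Homotopic.Quotient.ind with | mk p =>
  induction q using Path.Homotopic.Quotient.ind with | mk q =>
  exact congrArg Path.Homotopic.Quotient.mk (p.map_trans q φ.continuous)

theorem map_symm {Y Z : Type*} [TopologicalSpace Y] [TopologicalSpace Z] (φ : C(Y, Z))
    {x y : Y} (p : PathClass x y) :
    Path.Homotopic.Quotient.map p.symm φ = (Path.Homotopic.Quotient.map p φ).symm := by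
  induction p using Path.Homotopic.Quotient.ind with | mk p =>
  rfl

end Polyhedra

/-! ### Transport over triangulated grids -/

section Transport

variable {E : Type*} [NormedAddCommGroup E] [NormedSpace ℝ E] {K : Set E}

/-- The triangles of the grid: centre, corner and adjacent midpoint of an edge of a square. -/
def IsGridTriangle (o e m : ℕ × ℕ) : Prop :=
  ∃ i l ε δ, ε ≤ 1 ∧ δ ≤ 1 ∧ o = (2 * i + 1, 2 * l + 1) ∧ e = (2 * i + 2 * ε, 2 * l + 2 * δ) ∧
    (m = (2 * i + 1, 2 * l + 2 * δ) ∨ m = (2 * i + 2 * ε, 2 * l + 1))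

/-- Whichever diagonal cuts the square, both routes are compared with it. -/
theorem seg_comm_of_triangles {p q r s : K} (h : 
    (convexHull ℝ {(p : E), (q : E), (s : E)} ⊆ K ∧ convexHull ℝ {(p : E), (r : E), (s : E)} ⊆ K) ∨
    (convexHull ℝ {(q : E), (p : E), (r : E)} ⊆ K ∧ convexHull ℝ {(q : E), (s : E), (r : E)} ⊆ K))
    (hpq : segment ℝ (p : E) q ⊆ K) (hqs : segment ℝ (q : E) s ⊆ K)
    (hpr : segment ℝ (p : E) r ⊆ K) (hrs : segment ℝ (r : E) s ⊆ K) :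
    (seg p q hpq).trans (seg q s hqs) = (seg p r hpr).trans (seg r s hrs) := by
  rcases h with ⟨h1, h2⟩ | ⟨h1, h2⟩
  · have hps : segment ℝ (p : E) s ⊆ K :=
      (segment_subset_convexHull (by simp) (by simp)).trans h1
    rw [seg_trans p q s h1 hpq hqs hps, seg_trans p r s h2 hpr hrs hps]
  · have hqr : segment ℝ (q : E) r ⊆ K :=
      (segment_subset_convexHull (by simp) (by simp)).trans h1
    have hqp : segment ℝ (q : E) p ⊆ K := by rw [segment_symm]; exact hpq
    have hsr : segment ℝ (s : E) r ⊆ K := by rw [segment_symm]; exact hrs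
    have e1 := seg_trans q p r h1 hqp hpr hqr
    have e2 := seg_trans q s r h2 hqs hsr hqr
    rw [← seg_symm p q hpq] at e1
    rw [← seg_symm r s hrs] at e2
    have e3 := e1.trans e2.symm
    have e4 := congrArg (fun t => (seg p q hpq).trans (t.trans (seg r s hrs))) e3
    simp only [Path.Homotopic.Quotient.trans_assoc, PathClass.trans_symm_cancel_left,
      Path.Homotopic.Quotient.symm_trans, Path.Homotopic.Quotient.trans_refl] at e4
    exact e4.symm

/-- A section over the bottom row of a grid of points of `K` extends to the grid. -/
theorem exists_transport (V : ℕ × ℕ → K)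
    (hV : ∀ o e m, IsGridTriangle o e m →
      convexHull ℝ {(V o : E), (V e : E), (V m : E)} ⊆ K) (b : K)
    (τ₀ : ∀ a, PathClass b (V (a, 0)))
    (h₀ : ∀ a h, (τ₀ a).trans (seg (V (a, 0)) (V (a + 1, 0)) h) = τ₀ (a + 1)) :
    ∃ τ : ∀ u, PathClass b (V u), (∀ a, τ (a, 0) = τ₀ a) ∧
      (∀ a b h, (τ (a, b)).trans (seg (V (a, b)) (V (a + 1, b)) h) = τ (a + 1, b)) ∧
      (∀ a b h, (τ (a, b)).trans (seg (V (a, b)) (V (a, b + 1)) h) = τ (a, b + 1)) ∧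
      ∀ o e m, IsGridTriangle o e m → ∀ u ∈ ({o, e, m} : Set (ℕ × ℕ)),
        ∀ v ∈ ({o, e, m} : Set (ℕ × ℕ)), ∀ h, (τ u).trans (seg (V u) (V v) h) = τ v := by
  have hsq := square_of_triangles (Q := fun x y z : E => convexHull ℝ {x, y, z} ⊆ K)
    (fun {x y z} h => by
      have : ({y, z, x} : Set E) = {x, y, z} := by ext; simp; tauto
      rw [this]; exact h)
    (fun {x y z} h => by
      have : ({x, z, y} : Set E) = {x, y, z} := by ext; simp; tauto
      rw [this]; exact h)
    (w := fun a b => (V (a, b) : E))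
    (fun i j ε δ hε hδ => hV _ _ _ ⟨i, j, ε, δ, hε, hδ, rfl, rfl, Or.inl rfl⟩)
    (fun i j ε δ hε hδ => hV _ _ _ ⟨i, j, ε, δ, hε, hδ, rfl, rfl, Or.inr rfl⟩)
  have hh : ∀ a b, segment ℝ (V (a, b) : E) (V (a + 1, b)) ⊆ K := by
    intro a b
    rcases hsq a b with h | h <;>
    exact (segment_subset_convexHull (by simp) (by simp)).trans h.1
  have hv : ∀ a b, segment ℝ (V (a, b) : E) (V (a, b + 1)) ⊆ K := by
    intro a b
    rcases hsq a b with h | h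
    · exact (segment_subset_convexHull (by simp) (by simp)).trans h.2
    · exact (segment_subset_convexHull (by simp) (by simp)).trans h.1
  obtain ⟨τ, hτ0, hτh, hτv⟩ := exists_grid_section (T := fun a c => PathClass b (V (a, c)))
    (fun a c x => x.trans (seg _ _ (hh a c))) (fun a c x => x.trans (seg _ _ (hv a c)))
    (fun a c x => by
      simp only [Path.Homotopic.Quotient.trans_assoc]
      rw [seg_comm_of_triangles (hsq a c)]) τ₀ (fun a => h₀ a _)
  have rev : ∀ u v : ℕ × ℕ, (∀ h, (τ u.1 u.2).trans (seg (V u) (V v) h) = τ v.1 v.2) →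
      ∀ h, (τ v.1 v.2).trans (seg (V v) (V u) h) = τ u.1 u.2 := by
    intro u v h h'
    have h'' : segment ℝ (V u : E) (V v) ⊆ K := by rw [segment_symm]; exact h'
    rw [← h h'', ← seg_symm _ _ h'']
    simp
  have hH : ∀ a a' c : ℕ, (a' = a + 1 ∨ a = a' + 1) → ∀ h,
      (τ a c).trans (seg (V (a, c)) (V (a', c)) h) = τ a' c := by
    rintro a a' c (rfl | rfl) h
    · exact hτh a c
    · exact rev (a', c) (a' + 1, c) (fun _ => hτh a' c) h
  have hW : ∀ a c c' : ℕ, (c' = c + 1 ∨ c = c' + 1) → ∀ h,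
      (τ a c).trans (seg (V (a, c)) (V (a, c')) h) = τ a c' := by
    rintro a c c' (rfl | rfl) h
    · exact hτv a c
    · exact rev (a, c') (a, c' + 1) (fun _ => hτv a c') h
  refine ⟨fun u => τ u.1 u.2, hτ0, fun a c _ => hτh a c, fun a c _ => hτv a c, ?_⟩
  intro o e m ht
  have hT := hV o e m ht
  have om : ∀ h, (τ o.1 o.2).trans (seg (V o) (V m) h) = τ m.1 m.2 := by
    obtain ⟨i, l, ε, δ, hε, hδ, rfl, rfl, rfl | rfl⟩ := ht
    · exact hW _ _ _ (by omega)
    · exact hH _ _ _ (by omega)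
  have me : ∀ h, (τ m.1 m.2).trans (seg (V m) (V e) h) = τ e.1 e.2 := by
    obtain ⟨i, l, ε, δ, hε, hδ, rfl, rfl, rfl | rfl⟩ := ht
    · exact hH _ _ _ (by omega)
    · exact hW _ _ _ (by omega)
  have oe : ∀ h, (τ o.1 o.2).trans (seg (V o) (V e) h) = τ e.1 e.2 := by
    intro h
    have h1 : segment ℝ (V o : E) (V m) ⊆ K :=
      (segment_subset_convexHull (by simp) (by simp)).trans hT
    have h2 : segment ℝ (V m : E) (V e) ⊆ K :=
      (segment_subset_convexHull (by simp) (by simp)).trans hT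
    have h3 := seg_trans_of_convex hT (convex_convexHull ℝ _) (V o) (V m) (V e)
      (subset_convexHull ℝ _ (by simp)) (subset_convexHull ℝ _ (by simp))
      (subset_convexHull ℝ _ (by simp))
    rw [← h3, ← Path.Homotopic.Quotient.trans_assoc, om h1, me h2]
  have self : ∀ u : ℕ × ℕ, ∀ h, (τ u.1 u.2).trans (seg (V u) (V u) h) = τ u.1 u.2 := by
    intro u h
    rw [seg_self]; simp
  rintro u (rfl | rfl | rfl) v (rfl | rfl | rfl)
  · exact self _
  · exact oe
  · exact om
  · exact rev _ _ oe
  · exact self _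
  · exact rev _ _ me
  · exact rev _ _ om
  · exact me
  · exact self _

end Transport

/-! ### Attaching discs to a polyhedron -/

section Discs

variable {E : Type*} [NormedAddCommGroup E] [NormedSpace ℝ E]

theorem seg_trans_of_eq {K : Set E} {p q r : K} (h1 : p = q) (h2 : q = r)
    (hpq : segment ℝ (p : E) q ⊆ K) (hqr : segment ℝ (q : E) r ⊆ K)
    (hpr : segment ℝ (p : E) r ⊆ K) : (seg p q hpq).trans (seg q r hqr) = seg p r hpr := by
  subst h1 h2
  rw [seg_self]; simp

theorem cast_trans_seg {K : Set E} {b x x' q q' : K} (p : PathClass b x) (h1 : q = x)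
    (h2 : q' = x') (h : segment ℝ (q : E) q' ⊆ K) (h' : segment ℝ (x : E) x' ⊆ K) :
    (p.cast rfl h1).trans (seg q q' h) = (p.trans (seg x x' h')).cast rfl h2 := by
  subst h1 h2
  simp

/-- This is transport along a side of a grid on which all vertices coincide; the segments are
constant paths between propositionally equal points. -/
theorem transport_const {K : Set E} {y b : K} (p : ℕ → K) (hp : ∀ k, p k = y)
    (D : PathClass b y) (t : ∀ k, PathClass b (p k))
    (h0 : ∀ h, t 0 = D.trans (seg y (p 0) h))
    (hs : ∀ k h, (t k).trans (seg (p k) (p (k + 1)) h) = t (k + 1)) (k : ℕ) :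
    ∀ h, t k = D.trans (seg y (p k) h) := by
  induction k with
  | zero => exact h0
  | succ k ih =>
    intro h
    have e1 : segment ℝ (y : E) (p k) ⊆ K := by rw [hp k]; simp
    have e2 : segment ℝ (p k : E) (p (k + 1)) ⊆ K := by rw [hp k, hp (k + 1)]; simp
    rw [← hs k e2, ih e1, Path.Homotopic.Quotient.trans_assoc,
      seg_trans_of_eq (hp k).symm ((hp k).trans (hp (k + 1)).symm) e1 e2 h]

/-- The space that contains the complexes made of a subset of `E` and grids indexed by `J`. -/
abbrev DiscSpace (E J : Type*) (M : ℕ) := E × (J × Fin M × Fin M → ℝ)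

variable {X C L : Set E} {J : Type*} [Fintype J] {y : J → ↥(L \ C)}
  {δ : ∀ j, PathClass (y j) (y j)} (G : ∀ j, NullGrid (X \ C) (L \ C) {univ} (δ j)) (M : ℕ)

/-- The vertices on the boundary of the grid. -/
def NullGrid.IsBoundary {Z L : Set E} {𝒰 : Set (Set E)} {y : L} {g : PathClass y y}
    (G : NullGrid Z L 𝒰 g) (u : ℕ × ℕ) : Prop :=
  u.1 = 0 ∨ 2 * G.n ≤ u.1 ∨ u.2 = 0 ∨ 2 * G.n ≤ u.2

theorem NullGrid.IsBoundary.mem {Z L : Set E} {𝒰 : Set (Set E)} {y : L} {g : PathClass y y}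
    {G : NullGrid Z L 𝒰 g} {u : ℕ × ℕ} (h : G.IsBoundary u) : G.w u.1 u.2 ∈ L := by
  by_cases hu : u.1 = 0 ∨ 2 * G.n ≤ u.1 ∨ 2 * G.n ≤ u.2
  · rw [G.boundary _ _ hu]; exact y.2
  · have : u.2 = 0 := by unfold NullGrid.IsBoundary at h; omega
    rw [this]; exact G.bot_mem _

open Classical in
/-- The heights of the vertices of the discs: one coordinate for each interior vertex. -/
noncomputable def discHeight (j : J) (u : ℕ × ℕ) : J × Fin M × Fin M → ℝ := fun v =>
  if ¬ (G j).IsBoundary u ∧ v.1 = j ∧ (v.2.1 : ℕ) = u.1 ∧ (v.2.2 : ℕ) = u.2 then 1 else 0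

/-- The vertices of the discs. -/
noncomputable def discVertex (j : J) (u : ℕ × ℕ) : DiscSpace E J M :=
  ((G j).w u.1 u.2, discHeight G M j u)

/-- The set `L`, at height zero, with the discs given by the grids attached. -/
def discComplex : Set (DiscSpace E J M) :=
  (fun x => (x, 0)) '' L ∪ {x | ∃ j o e m, IsGridTriangle o e m ∧
    x ∈ convexHull ℝ {discVertex G M j o, discVertex G M j e, discVertex G M j m}}

variable {G M}

theorem discHeight_nonneg (j : J) (u : ℕ × ℕ) (v) : 0 ≤ discHeight G M j u v := by
  unfold discHeight; split_ifs <;> simp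

theorem discHeight_ne_zero {j : J} {u : ℕ × ℕ} {v} (h : discHeight G M j u v ≠ 0) :
    ¬ (G j).IsBoundary u ∧ v.1 = j ∧ (v.2.1 : ℕ) = u.1 ∧ (v.2.2 : ℕ) = u.2 := by
  unfold discHeight at h
  by_contra h'
  exact h (if_neg h')

theorem discHeight_of_isBoundary {j : J} {u : ℕ × ℕ} (h : (G j).IsBoundary u) :
    discHeight G M j u = 0 := by
  ext v
  by_contra h'
  exact (discHeight_ne_zero h').1 h

theorem exists_discHeight_ne_zero (hM : ∀ j, 2 * (G j).n ≤ M) {j : J} {u : ℕ × ℕ}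
    (h : ¬ (G j).IsBoundary u) : ∃ v, discHeight G M j u v ≠ 0 := by
  have h' := h
  unfold NullGrid.IsBoundary at h
  have := hM j
  refine ⟨(j, ⟨u.1, by omega⟩, ⟨u.2, by omega⟩), ?_⟩
  unfold discHeight
  rw [if_pos ⟨h', rfl, rfl, rfl⟩]
  exact one_ne_zero

/-- Each coordinate belongs to a single interior vertex, so a nonzero height singles out a vertex
common to all triangles through the point. This takes the place of a proof that the triangles fit
together as a simplicial complex. -/
theorem exists_vertex_of_height_ne_zero {j : J} {o e m : ℕ × ℕ} {x : DiscSpace E J M}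
    (hx : x ∈ convexHull ℝ {discVertex G M j o, discVertex G M j e, discVertex G M j m}) {v}
    (hv : x.2 v ≠ 0) : v.1 = j ∧ ((v.2.1 : ℕ), (v.2.2 : ℕ)) ∈ ({o, e, m} : Set (ℕ × ℕ)) := by
  obtain ⟨α, β, γ, -, -, -, -, rfl⟩ := mem_convexHull_triple hx
  have : discHeight G M j o v ≠ 0 ∨ discHeight G M j e v ≠ 0 ∨ discHeight G M j m v ≠ 0 := by
    by_contra! h
    apply hv
    simp [discVertex, h.1, h.2.1, h.2.2]
  rcases this with h | h | h
  all_goals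
    obtain ⟨-, h1, h2, h3⟩ := discHeight_ne_zero h
    refine ⟨h1, ?_⟩
    simp [h2, h3]

/-- Heights are nonnegative and cannot cancel, so at height zero only boundary vertices carry
weight. A centre is a boundary vertex only beyond the mesh, where its triangle collapses to `y j`.
Otherwise the point is a boundary vertex or lies on a boundary half-edge, which is constant or
belongs to the bottom polygon. -/
theorem exists_boundary_vertex (hM : ∀ j, 2 * (G j).n ≤ M) {j : J} {o e m : ℕ × ℕ}
    (ht : IsGridTriangle o e m)
    {x : DiscSpace E J M}
    (hx : x ∈ convexHull ℝ {discVertex G M j o, discVertex G M j e, discVertex G M j m})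
    (hx0 : x.2 = 0) : ∃ u ∈ ({o, e, m} : Set (ℕ × ℕ)), (G j).IsBoundary u ∧
      segment ℝ ((G j).w u.1 u.2) x.1 ⊆ L := by
  have hLC : L \ C ⊆ L := sdiff_subset
  have hyL : (y j : E) ∈ L := hLC (y j).2
  obtain ⟨α, β, γ, hα, hβ, hγ, hsum, rfl⟩ := mem_convexHull_triple hx
  have hz : ∀ v, α * discHeight G M j o v + β * discHeight G M j e v +
      γ * discHeight G M j m v = 0 := by
    intro v
    have := congrFun hx0 v
    simpa [discVertex] using this
  have hz' : ∀ v, α * discHeight G M j o v = 0 ∧ β * discHeight G M j e v = 0 ∧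
      γ * discHeight G M j m v = 0 := by
    intro v
    have h1 := mul_nonneg hα (discHeight_nonneg (G := G) (M := M) j o v)
    have h2 := mul_nonneg hβ (discHeight_nonneg (G := G) (M := M) j e v)
    have h3 := mul_nonneg hγ (discHeight_nonneg (G := G) (M := M) j m v)
    have := hz v
    exact ⟨by linarith, by linarith, by linarith⟩
  have hb : ∀ u (a : ℝ), a ≠ 0 → (∀ v, a * discHeight G M j u v = 0) → (G j).IsBoundary u := by
    intro u a ha h
    by_contra hu
    obtain ⟨v, hv⟩ := exists_discHeight_ne_zero hM hu
    exact (mul_ne_zero ha hv) (h v)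
  have hbo := fun h => hb o α h fun v => (hz' v).1
  have hbe := fun h => hb e β h fun v => (hz' v).2.1
  have hbm := fun h => hb m γ h fun v => (hz' v).2.2
  have hfst : (α • discVertex G M j o + β • discVertex G M j e + γ • discVertex G M j m).1 =
      α • (G j).w o.1 o.2 + β • (G j).w e.1 e.2 + γ • (G j).w m.1 m.2 := rfl
  rw [hfst]
  by_cases ho : (G j).IsBoundary o
  · have hw : ∀ u ∈ ({o, e, m} : Set (ℕ × ℕ)), (G j).w u.1 u.2 = y j := by
      obtain ⟨i, l, ε, δ', hε, hδ, rfl, rfl, hm⟩ := ht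
      unfold NullGrid.IsBoundary at ho
      rintro u (rfl | rfl | hu)
      · exact (G j).boundary _ _ (by omega)
      · exact (G j).boundary _ _ (by simp only at ho ⊢; omega)
      · rw [mem_singleton_iff] at hu
        subst hu
        rcases hm with rfl | rfl
        · exact (G j).boundary _ _ (by simp only at ho ⊢; omega)
        · exact (G j).boundary _ _ (by simp only at ho ⊢; omega)
    refine ⟨o, by simp, ho, ?_⟩
    rw [hw o (by simp), hw e (by simp), hw m (by simp), ← add_smul, ← add_smul, hsum, one_smul]
    simpa using hyL
  have hα0 : α = 0 := by
    by_contra h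
    exact ho (hbo h)
  subst hα0
  by_cases hβ0 : β = 0
  · subst hβ0
    have hγ1 : γ = 1 := by linarith
    subst hγ1
    have hm := hbm one_ne_zero
    refine ⟨m, by simp, hm, ?_⟩
    simpa using hLC hm.mem
  by_cases hγ0 : γ = 0
  · subst hγ0
    have hβ1 : β = 1 := by linarith
    subst hβ1
    have he := hbe one_ne_zero
    refine ⟨e, by simp, he, ?_⟩
    simpa using hLC he.mem
  have he := hbe hβ0
  have hm := hbm hγ0
  have hseg : segment ℝ ((G j).w e.1 e.2) ((G j).w m.1 m.2) ⊆ L := by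
    by_cases h1 : (e.1 = 0 ∨ 2 * (G j).n ≤ e.1 ∨ 2 * (G j).n ≤ e.2) ∧
        (m.1 = 0 ∨ 2 * (G j).n ≤ m.1 ∨ 2 * (G j).n ≤ m.2)
    · rw [(G j).boundary _ _ h1.1, (G j).boundary _ _ h1.2]
      simpa using hyL
    · obtain ⟨i, l, ε, δ', hε, hδ, rfl, rfl, rfl | rfl⟩ := ht
      · unfold NullGrid.IsBoundary at ho he hm
        simp only at ho he hm h1
        have h0 : 2 * l + 2 * δ' = 0 := by omega
        simp only [h0]
        interval_cases ε
        · exact ((G j).bot_seg (2 * i)).trans hLC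
        · rw [segment_symm]
          exact ((G j).bot_seg (2 * i + 1)).trans hLC
      -- A vertical half-edge on the boundary of the mesh lies on a constant side, which was the
      -- case `h1`.
      · exfalso
        unfold NullGrid.IsBoundary at ho he hm
        simp only at ho he hm h1
        omega
  refine ⟨e, by simp, he, Subset.trans ?_ hseg⟩
  refine (convex_segment _ _).segment_subset (left_mem_segment ℝ _ _) ⟨β, γ, hβ, hγ, ?_, ?_⟩
  · linarith
  · simp

theorem discVertex_of_isBoundary {j : J} {u : ℕ × ℕ} (h : (G j).IsBoundary u) :
    discVertex G M j u = ((G j).w u.1 u.2, 0) := by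
  rw [discVertex, discHeight_of_isBoundary h]

theorem discTriangle_subset {j : J} {o e m : ℕ × ℕ} (ht : IsGridTriangle o e m) :
    convexHull ℝ {discVertex G M j o, discVertex G M j e, discVertex G M j m} ⊆
      discComplex G M :=
  fun _ hx => Or.inr ⟨j, o, e, m, ht, hx⟩

theorem fst_mem_of_mem_discTriangle {j : J} {o e m : ℕ × ℕ} (ht : IsGridTriangle o e m)
    {x : DiscSpace E J M}
    (hx : x ∈ convexHull ℝ {discVertex G M j o, discVertex G M j e, discVertex G M j m}) :
    x.1 ∈ X \ C := by
  have h1 : x.1 ∈ convexHull ℝ {(G j).w o.1 o.2, (G j).w e.1 e.2, (G j).w m.1 m.2} := by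
    have := mem_image_of_mem (LinearMap.fst ℝ E (J × Fin M × Fin M → ℝ)) hx
    rw [LinearMap.image_convexHull] at this
    simpa [image_insert_eq, discVertex] using this
  have h2 : SmallTriangle (X \ C) {univ} ((G j).w o.1 o.2) ((G j).w e.1 e.2) ((G j).w m.1 m.2) := by
    obtain ⟨i, l, ε, δ', hε, hδ, rfl, rfl, rfl | rfl⟩ := ht
    · exact (G j).tri_h i l ε δ' hε hδ
    · exact (G j).tri_v i l ε δ' hε hδ
  obtain ⟨u, -, hu⟩ := h2
  exact (hu h1).1

theorem discComplex_fst_mem (hLX : L ⊆ X) {x : DiscSpace E J M}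
    (hx : x ∈ discComplex G M) : x.1 ∈ X := by
  rcases hx with ⟨z, hz, rfl⟩ | ⟨j, o, e, m, ht, hx⟩
  · exact hLX hz
  · exact (fst_mem_of_mem_discTriangle ht hx).1

/-- The discs project into `X \ C`, so over `C` nothing is added to `L`. This makes the projection
to `X` injective over `C`. -/
theorem discComplex_height_eq_zero {x : DiscSpace E J M}
    (hx : x ∈ discComplex G M) (hxC : x.1 ∈ C) : x.2 = 0 := by
  rcases hx with ⟨z, hz, rfl⟩ | ⟨j, o, e, m, ht, hx⟩
  · rfl
  · exact absurd hxC (fst_mem_of_mem_discTriangle ht hx).2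

/-- The cells of the complex. -/
theorem exists_discComplex_cells (hM : ∀ j, 2 * (G j).n ≤ M) (hL : IsCompactPolyhedron L) :
    ∃ (S : Set (Finset E)), S.Finite ∧
      ∃ c : (S ⊕ (J × Fin M × Fin M × Fin 2 × Fin 2 × Bool)) →
        Set (DiscSpace E J M), discComplex G M = ⋃ k, c k ∧
      (∀ k, IsCompactPolyhedron (c k)) ∧ (∀ k, Convex ℝ (c k)) ∧
      ∀ k, (∃ s ⊆ L, Convex ℝ s ∧ c k = (fun x => (x, 0)) '' s) ∨
        ∃ j o e m, IsGridTriangle o e m ∧ c k =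
          convexHull ℝ {discVertex G M j o, discVertex G M j e, discVertex G M j m} := by
  obtain ⟨S, hS, hLS⟩ := hL.exists_cells
  let inl : E →ₗ[ℝ] E × (J × Fin M × Fin M → ℝ) := LinearMap.inl ℝ _ _
  let md : ℕ × ℕ → ℕ × ℕ → Bool → ℕ × ℕ := fun o e s => if s then (o.1, e.2) else (e.1, o.2)
  let c₁ : S → Set (DiscSpace E J M) := fun s => inl '' convexHull ℝ ((s : Finset E) : Set E)
  let c₂ : J × Fin M × Fin M × Fin 2 × Fin 2 × Bool → Set (DiscSpace E J M) :=
    fun ⟨j, i, l, ε, δ', s⟩ => convexHull ℝ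
      {discVertex G M j (2 * i + 1, 2 * l + 1),
        discVertex G M j (2 * i + 2 * ε, 2 * l + 2 * δ'),
        discVertex G M j (md (2 * i + 1, 2 * l + 1) (2 * i + 2 * ε, 2 * l + 2 * δ') s)}
  let c : (S ⊕ (J × Fin M × Fin M × Fin 2 × Fin 2 × Bool)) → Set (DiscSpace E J M) :=
    fun k => k.elim c₁ c₂
  have hc : ∀ k, (∃ s ⊆ L, Convex ℝ s ∧ c k = (fun x => (x, 0)) '' s) ∨
        ∃ j o e m, IsGridTriangle o e m ∧ c k =
          convexHull ℝ {discVertex G M j o, discVertex G M j e, discVertex G M j m} := by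
    rintro (s | ⟨j, i, l, ε, δ', s⟩)
    · refine Or.inl ⟨convexHull ℝ ((s : Finset E) : Set E), ?_, convex_convexHull ℝ _, rfl⟩
      rw [hLS]
      exact subset_iUnion (fun s : S => convexHull ℝ ((s : Finset E) : Set E)) s
    · refine Or.inr ⟨j, _, _, _, ⟨i, l, ε, δ', by omega, by omega, rfl, rfl, ?_⟩, rfl⟩
      cases s
      · exact Or.inr rfl
      · exact Or.inl rfl
  refine ⟨S, hS, c, ?_, ?_, ?_, hc⟩
  · apply Subset.antisymm
    · rintro x (⟨z, hz, rfl⟩ | ⟨j, o, e, m, ht, hx⟩)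
      · rw [hLS] at hz
        obtain ⟨s, hs⟩ := mem_iUnion.1 hz
        exact mem_iUnion.2 ⟨Sum.inl s, z, hs, rfl⟩
      -- The grid is infinite, but triangles beyond the mesh collapse to `y j`, which already lies
      -- in a cell of `L`; so finitely many indices suffice.
      · by_cases ho : (G j).IsBoundary o
        · obtain ⟨i, l, ε, δ', hε, hδ, rfl, rfl, hm⟩ := ht
          have hw : ∀ u : ℕ × ℕ, (2 * (G j).n ≤ u.1 ∨ 2 * (G j).n ≤ u.2) →
              discVertex G M j u = (((y j : E)), 0) := by
            intro u hu
            rw [discVertex_of_isBoundary (by unfold NullGrid.IsBoundary; tauto),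
              (G j).boundary _ _ (Or.inr hu)]
          have hx' : x = ((y j : E), 0) := by
            unfold NullGrid.IsBoundary at ho
            simp only at ho
            rw [hw _ (by simp only; omega), hw _ (by simp only; omega),
              hw m (by rcases hm with rfl | rfl <;> simp only <;> omega)] at hx
            simpa using hx
          obtain ⟨s, hs⟩ := mem_iUnion.1 (hLS.subset (y j).2.1)
          exact mem_iUnion.2 ⟨Sum.inl s, y j, hs, hx'.symm⟩
        · obtain ⟨i, l, ε, δ', hε, hδ, rfl, rfl, hm⟩ := ht
          have := hM j
          unfold NullGrid.IsBoundary at ho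
          simp only at ho
          rcases hm with rfl | rfl
          · exact mem_iUnion.2 ⟨Sum.inr (j, ⟨i, by omega⟩, ⟨l, by omega⟩, ⟨ε, by omega⟩,
              ⟨δ', by omega⟩, true), hx⟩
          · exact mem_iUnion.2 ⟨Sum.inr (j, ⟨i, by omega⟩, ⟨l, by omega⟩, ⟨ε, by omega⟩,
              ⟨δ', by omega⟩, false), hx⟩
    · refine iUnion_subset fun k => ?_
      rcases hc k with ⟨s, hs, -, h⟩ | ⟨j, o, e, m, ht, h⟩
      · rw [h]
        exact (image_mono hs).trans subset_union_left
      · rw [h]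
        exact discTriangle_subset ht
  · rintro (s | t)
    · exact (isCompactPolyhedron_convexHull (s : Finset E).finite_toSet).image inl
    · exact isCompactPolyhedron_convexHull (by simp)
  · rintro (s | t)
    · exact (convex_convexHull ℝ _).linear_image inl
    · exact convex_convexHull ℝ _

end Discs

/-! ### Loops killed by the discs -/

section DiscsSimplyConnected

variable {E : Type*} [NormedAddCommGroup E] [NormedSpace ℝ E]

theorem trans_seg_cast {K : Set E} {b x q q' : K} (D : PathClass b x) (h2 : q = q')
    (h : segment ℝ (x : E) q ⊆ K) (h' : segment ℝ (x : E) q' ⊆ K) :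
    D.trans (seg x q h) = (D.trans (seg x q' h')).cast rfl h2 := by
  subst h2
  simp

/-- The classes of loops in `L` at `b` that are conjugate to a loop in `L \ C` that is
null-homotopic in `X \ C`. -/
def killedLoops {X L : Set E} (C : Set E) (hLX : L ⊆ X) (b : L) : Set (FundamentalGroup L b) :=
  {g | ∃ (y : ↥(L \ C)) (δ : PathClass y y) (β : PathClass b ⟨y.1, y.2.1⟩),
    PathClass.incl (sdiff_subset_sdiff_left hLX : L \ C ⊆ X \ C) δ =
      Path.Homotopic.Quotient.refl _ ∧
    g = (β.trans ((PathClass.incl sdiff_subset δ).trans β.symm) : PathClass b b)}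

variable {X C L : Set E} {J : Type*} [Fintype J] {y : J → ↥(L \ C)}
  {δ : ∀ j, PathClass (y j) (y j)} (G : ∀ j, NullGrid (X \ C) (L \ C) {univ} (δ j)) (M : ℕ)

/-- The inclusion of `L` into the complex, at height zero. -/
def discIncl : C(L, discComplex G M) where
  toFun x := ⟨(x.1, 0), Or.inl ⟨x.1, x.2, rfl⟩⟩

variable {G M}

theorem map_discIncl_seg (x x' : L) (h : segment ℝ (x : E) x' ⊆ L)
    (h' : segment ℝ (discIncl G M x : DiscSpace E J M) (discIncl G M x') ⊆ discComplex G M) :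
    Path.Homotopic.Quotient.map (seg x x' h) (discIncl G M) =
      seg (discIncl G M x) (discIncl G M x') h' :=
  seg_map (LinearMap.inl ℝ E (J × Fin M × Fin M → ℝ)).toAffineMap (discIncl G M)
    (fun _ => rfl) x x' h h'

theorem discIncl_segment (x x' : L) (h : segment ℝ (x : E) x' ⊆ L) :
    segment ℝ (discIncl G M x : DiscSpace E J M) (discIncl G M x') ⊆ discComplex G M := by
  have := image_segment ℝ (LinearMap.inl ℝ E (J × Fin M × Fin M → ℝ)).toAffineMap (x : E) x'
  change segment ℝ (LinearMap.inl ℝ E (J × Fin M × Fin M → ℝ) (x : E))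
    (LinearMap.inl ℝ E (J × Fin M × Fin M → ℝ) (x' : E)) ⊆ _
  have h2 : LinearMap.inl ℝ E (J × Fin M × Fin M → ℝ) '' segment ℝ (x : E) x' =
    segment ℝ (LinearMap.inl ℝ E (J × Fin M × Fin M → ℝ) (x : E))
    (LinearMap.inl ℝ E (J × Fin M × Fin M → ℝ) (x' : E)) := this
  rw [← h2]
  rintro _ ⟨z, hz, rfl⟩
  exact Or.inl ⟨z, h hz, rfl⟩

variable (G M) in
/-- The vertices of the discs as points of the complex. -/
noncomputable def discPoint (j : J) (u : ℕ × ℕ) : discComplex G M :=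
  ⟨discVertex G M j u, by
    obtain ⟨a, b⟩ := u
    obtain ⟨i, rfl | rfl⟩ := Nat.even_or_odd' a <;> obtain ⟨l, rfl | rfl⟩ := Nat.even_or_odd' b
    · exact discTriangle_subset (j := j) (o := (2 * i + 1, 2 * l + 1)) (e := (2 * i, 2 * l))
        (m := (2 * i + 1, 2 * l)) ⟨i, l, 0, 0, by simp, by simp, rfl, rfl, Or.inl rfl⟩
        (subset_convexHull ℝ _ (by simp))
    · exact discTriangle_subset (j := j) (o := (2 * i + 1, 2 * l + 1)) (e := (2 * i, 2 * l))
        (m := (2 * i, 2 * l + 1)) ⟨i, l, 0, 0, by simp, by simp, rfl, rfl, Or.inr rfl⟩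
        (subset_convexHull ℝ _ (by simp))
    · exact discTriangle_subset (j := j) (o := (2 * i + 1, 2 * l + 1)) (e := (2 * i, 2 * l))
        (m := (2 * i + 1, 2 * l)) ⟨i, l, 0, 0, by simp, by simp, rfl, rfl, Or.inl rfl⟩
        (subset_convexHull ℝ _ (by simp))
    · exact discTriangle_subset (j := j) (o := (2 * i + 1, 2 * l + 1)) (e := (2 * i, 2 * l))
        (m := (2 * i + 1, 2 * l)) ⟨i, l, 0, 0, by simp, by simp, rfl, rfl, Or.inl rfl⟩
        (subset_convexHull ℝ _ (by simp))⟩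

theorem discPoint_of_isBoundary {j : J} {u : ℕ × ℕ} (h : (G j).IsBoundary u) :
    discPoint G M j u = discIncl G M ⟨(G j).w u.1 u.2, h.mem.1⟩ :=
  Subtype.ext (discVertex_of_isBoundary h)

theorem isBoundary_bot (j : J) (a : ℕ) : (G j).IsBoundary (a, 0) := Or.inr (Or.inr (Or.inl rfl))

/-- The boundary curves of the discs are null-homotopic in the complex. -/
theorem map_discIncl_eq_refl (j : J) :
    Path.Homotopic.Quotient.map (PathClass.incl sdiff_subset (δ j)) (discIncl G M) =
      Path.Homotopic.Quotient.refl _ := by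
  have hLC : L \ C ⊆ L := sdiff_subset
  let y' : L := ⟨y j, hLC (y j).2⟩
  set b := discIncl G M y' with hb
  have hV : ∀ a, discPoint G M j (a, 0) = discIncl G M ⟨(G j).w a 0, hLC ((G j).bot_mem a)⟩ :=
    fun a => discPoint_of_isBoundary (isBoundary_bot j a)
  let τ₀ : ∀ a, PathClass b (discPoint G M j (a, 0)) := fun a =>
    (Path.Homotopic.Quotient.map (PathClass.incl hLC ((G j).τ a)) (discIncl G M)).cast rfl (hV a)
  have hseg : ∀ a, segment ℝ ((G j).w a 0) ((G j).w (a + 1) 0) ⊆ L := fun a =>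
    ((G j).bot_seg a).trans hLC
  -- Transport the initial pieces of the bottom polygon over the disc. At the far corner, the route
  -- up the left side and along the top gives the trivial class, the route up the right side gives
  -- that of `δ j`.
  obtain ⟨τ, hτ0, hτh, hτv, -⟩ := exists_transport (discPoint G M j)
    (fun o e m ht => discTriangle_subset ht) b τ₀ (by
      intro a h
      have h' := discIncl_segment (G := G) (M := M) ⟨_, hLC ((G j).bot_mem a)⟩
        ⟨_, hLC ((G j).bot_mem (a + 1))⟩ (hseg a)
      rw [cast_trans_seg _ (hV a) (hV (a + 1)) h h', ← map_discIncl_seg _ _ (hseg a), ← map_trans]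
      simp only [τ₀]
      rw [← (G j).τ_succ a, PathClass.incl_trans, incl_seg])
  have hbd : ∀ u : ℕ × ℕ, (u.1 = 0 ∨ 2 * (G j).n ≤ u.1 ∨ 2 * (G j).n ≤ u.2) →
      discPoint G M j u = b := by
    intro u hu
    have hB : (G j).IsBoundary u := by unfold NullGrid.IsBoundary; tauto
    rw [discPoint_of_isBoundary hB]
    congr 2
    exact (G j).boundary _ _ hu
  have h0 : ∀ a, (a = 0 ∨ 2 * (G j).n ≤ a) → ∀ g : PathClass (y j) (y j),
      (∀ h, (G j).τ a = g.trans (seg (y j) ⟨(G j).w a 0, (G j).bot_mem a⟩ h)) →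
      ∀ h, τ (a, 0) = (Path.Homotopic.Quotient.map (PathClass.incl hLC g) (discIncl G M)).trans
        (seg b (discPoint G M j (a, 0)) h) := by
    intro a ha g hg h
    have e1 : (G j).w a 0 = y j := (G j).boundary _ _ (by tauto)
    have hs : segment ℝ (y j : E) ((G j).w a 0) ⊆ L \ C := by
      rw [e1, segment_same]; exact singleton_subset_iff.2 (y j).2
    have h' := discIncl_segment (G := G) (M := M) y' ⟨_, hLC ((G j).bot_mem a)⟩ (hs.trans hLC)
    rw [hτ0, trans_seg_cast _ (hV a) h h', ← map_discIncl_seg _ _ (hs.trans hLC), ← map_trans]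
    simp only [τ₀]
    rw [hg hs, PathClass.incl_trans, incl_seg]
  have h1 : ∀ k, ∀ h, τ (0, k) = (Path.Homotopic.Quotient.refl b).trans
      (seg b (discPoint G M j (0, k)) h) := by
    refine transport_const _ (fun k => hbd (0, k) (Or.inl rfl)) _ (fun k => τ (0, k)) ?_
      (fun k h => hτv 0 k h)
    intro h
    have := h0 0 (Or.inl rfl) (Path.Homotopic.Quotient.refl _) (fun h => by
      rw [(G j).τ_zero h]; simp) h
    rw [PathClass.incl_refl] at this
    exact this
  have h2 : ∀ k, ∀ h, τ (2 * (G j).n, k) =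
      (Path.Homotopic.Quotient.map (PathClass.incl hLC (δ j)) (discIncl G M)).trans
      (seg b (discPoint G M j (2 * (G j).n, k)) h) :=
    transport_const _ (fun k => hbd (_, k) (Or.inr (Or.inl le_rfl))) _
      (fun k => τ (2 * (G j).n, k)) (h0 _ (Or.inr le_rfl) _ (fun h => (G j).τ_last h))
      (fun k h => hτv _ k h)
  have h3 : ∀ k, ∀ h, τ (k, 2 * (G j).n) = (Path.Homotopic.Quotient.refl b).trans
      (seg b (discPoint G M j (k, 2 * (G j).n)) h) :=
    transport_const _ (fun k => hbd (k, _) (Or.inr (Or.inr le_rfl))) _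
      (fun k => τ (k, 2 * (G j).n)) (h1 _) (fun k h => hτh k _ h)
  have hs : segment ℝ (b : DiscSpace E J M) (discPoint G M j (2 * (G j).n, 2 * (G j).n)) ⊆
      discComplex G M := by
    rw [hbd _ (Or.inr (Or.inl le_rfl)), segment_same]
    exact singleton_subset_iff.2 b.2
  exact PathClass.trans_right_cancel ((h2 _ hs).symm.trans (h3 _ hs))

end DiscsSimplyConnected

/-! ### Simple connectivity of the complex with discs -/

section DiscsMain

variable {E : Type*} [NormedAddCommGroup E] [NormedSpace ℝ E]
variable {X C L : Set E} {J : Type*} [Fintype J] {y : J → ↥(L \ C)}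
  {δ : ∀ j, PathClass (y j) (y j)} {G : ∀ j, NullGrid (X \ C) (L \ C) {univ} (δ j)} {M : ℕ}

/-- If the boundary curves of the discs generate the fundamental group normally, all loops of `L`
are null-homotopic in the complex. -/
theorem map_discIncl_loop {b : L} (β : ∀ j, PathClass b ⟨y j, (y j).2.1⟩)
    (hJ : Subgroup.normalClosure (G := FundamentalGroup L b) (range (fun j =>
      (β j).trans ((PathClass.incl sdiff_subset (δ j)).trans (β j).symm) :
        J → FundamentalGroup L b)) = ⊤) (g : PathClass b b) :
    Path.Homotopic.Quotient.map g (discIncl G M) = Path.Homotopic.Quotient.refl _ := by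
  have h : Subgroup.normalClosure (G := FundamentalGroup L b) (range (fun j =>
      (β j).trans ((PathClass.incl sdiff_subset (δ j)).trans (β j).symm) :
        J → FundamentalGroup L b)) ≤ (FundamentalGroup.map (discIncl G M) b).ker := by
    refine Subgroup.normalClosure_le_normal ?_
    rintro _ ⟨j, rfl⟩
    change Path.Homotopic.Quotient.map _ (discIncl G M) = Path.Homotopic.Quotient.refl _
    rw [map_trans, map_trans, map_discIncl_eq_refl j, map_symm]
    simp
  rw [hJ] at h
  exact h (Subgroup.mem_top (G := FundamentalGroup L b) g)

theorem map_discIncl_eq {b x : L} (hb : ∀ g : PathClass b b,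
      Path.Homotopic.Quotient.map g (discIncl G M) = Path.Homotopic.Quotient.refl _)
    (q q' : PathClass b x) :
    Path.Homotopic.Quotient.map q (discIncl G M) =
      Path.Homotopic.Quotient.map q' (discIncl G M) := by
  have := hb (q.trans q'.symm)
  rw [map_trans, map_symm] at this
  have h2 := congrArg
    (fun s => Path.Homotopic.Quotient.trans s (Path.Homotopic.Quotient.map q' (discIncl G M))) this
  simpa [Path.Homotopic.Quotient.trans_assoc] using h2

variable (G M) in
/-- A class of paths in the complex that comes from `L`. -/
def IsFromBase {b : L} {p : discComplex G M} (t : PathClass (discIncl G M b) p) : Prop :=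
  ∃ (x : L) (q : PathClass b x) (hp : p = discIncl G M x),
    t = (Path.Homotopic.Quotient.map q (discIncl G M)).cast rfl hp

theorem discIncl_injective : Function.Injective (discIncl G M) := fun x x' h => by
  have h1 : ((discIncl G M x : DiscSpace E J M)).1 = (discIncl G M x' : DiscSpace E J M).1 := by
    rw [h]
  exact Subtype.ext h1

/-- When all loops of `L` die in the complex, a class coming from `L` depends only on its end point.
-/
theorem IsFromBase.eq {b : L} (hb : ∀ g : PathClass b b,
      Path.Homotopic.Quotient.map g (discIncl G M) = Path.Homotopic.Quotient.refl _)
    {p : discComplex G M} {t t' : PathClass (discIncl G M b) p}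
    (ht : IsFromBase G M t) (ht' : IsFromBase G M t') : t = t' := by
  obtain ⟨x, q, rfl, rfl⟩ := ht
  obtain ⟨x', q', h, rfl⟩ := ht'
  obtain rfl := discIncl_injective h
  rw [map_discIncl_eq hb q q']

theorem IsFromBase.trans_seg {b : L} {p p' : discComplex G M} {t : PathClass (discIncl G M b) p}
    (ht : IsFromBase G M t) (hp' : (p' : DiscSpace E J M).2 = 0)
    (hL : segment ℝ (p : DiscSpace E J M).1 (p' : DiscSpace E J M).1 ⊆ L)
    (h : segment ℝ (p : DiscSpace E J M) p' ⊆ discComplex G M) :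
    IsFromBase G M (t.trans (seg p p' h)) := by
  obtain ⟨x, q, rfl, rfl⟩ := ht
  obtain ⟨x', rfl⟩ : ∃ x', p' = discIncl G M x' :=
    ⟨⟨(p' : DiscSpace E J M).1, hL (right_mem_segment ℝ _ _)⟩, Subtype.ext (Prod.ext rfl hp')⟩
  refine ⟨x', q.trans (seg x x' hL), rfl, ?_⟩
  rw [map_trans, map_discIncl_seg x x' hL h]
  simp

/-- Arbitrary paths of `L` to the bottom vertices are compatible in the complex because loops of `L`
die there. Transport along the three constant sides preserves the property of coming from `L`, which
allows gluing the sections on the discs to one on `L`. -/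
theorem exists_disc_transport {b : L} (hb : ∀ g : PathClass b b,
      Path.Homotopic.Quotient.map g (discIncl G M) = Path.Homotopic.Quotient.refl _)
    (hL : ∀ x, Nonempty (PathClass b x)) (j : J) :
    ∃ τ : ∀ u, PathClass (discIncl G M b) (discPoint G M j u),
      (∀ u, (G j).IsBoundary u → IsFromBase G M (τ u)) ∧
      ∀ o e m, IsGridTriangle o e m → ∀ u ∈ ({o, e, m} : Set (ℕ × ℕ)),
        ∀ v ∈ ({o, e, m} : Set (ℕ × ℕ)), ∀ h,
          (τ u).trans (seg (discPoint G M j u) (discPoint G M j v) h) = τ v := by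
  have hLC : L \ C ⊆ L := sdiff_subset
  have hbot := fun a => hLC ((G j).bot_mem a)
  have hV : ∀ a, discPoint G M j (a, 0) = discIncl G M ⟨(G j).w a 0, hbot a⟩ :=
    fun a => discPoint_of_isBoundary (isBoundary_bot j a)
  let τ₀ : ∀ a, PathClass (discIncl G M b) (discPoint G M j (a, 0)) := fun a =>
    (Path.Homotopic.Quotient.map (hL ⟨(G j).w a 0, hbot a⟩).some (discIncl G M)).cast rfl (hV a)
  have hfst : ∀ u, (discPoint G M j u : DiscSpace E J M).1 = (G j).w u.1 u.2 := fun _ => rfl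
  have hsnd : ∀ u, (G j).IsBoundary u → (discPoint G M j u : DiscSpace E J M).2 = 0 :=
    fun u hu => discHeight_of_isBoundary hu
  have h₀ : ∀ a, IsFromBase G M (τ₀ a) := fun a => ⟨_, _, hV a, rfl⟩
  obtain ⟨τ, hτ0, hτh, hτv, hτ⟩ := exists_transport (discPoint G M j)
    (fun o e m ht => discTriangle_subset ht) _ τ₀ (fun a h =>
      ((h₀ a).trans_seg (hsnd _ (isBoundary_bot j _)) (((G j).bot_seg a).trans hLC) h).eq hb
        (h₀ (a + 1)))
  have hr : ∀ u v : ℕ × ℕ, (u.1 = 0 ∨ 2 * (G j).n ≤ u.1 ∨ 2 * (G j).n ≤ u.2) →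
      (v.1 = 0 ∨ 2 * (G j).n ≤ v.1 ∨ 2 * (G j).n ≤ v.2) → IsFromBase G M (τ u) →
      (∀ h, (τ u).trans (seg (discPoint G M j u) (discPoint G M j v) h) = τ v) →
      IsFromBase G M (τ v) := by
    intro u v hu hv ht h
    have hv' : (G j).IsBoundary v := by unfold NullGrid.IsBoundary; tauto
    have hu' : (G j).IsBoundary u := by unfold NullGrid.IsBoundary; tauto
    have e1 : segment ℝ (discPoint G M j u : DiscSpace E J M).1
        (discPoint G M j v : DiscSpace E J M).1 ⊆ L := by
      rw [hfst, hfst, (G j).boundary _ _ hu, (G j).boundary _ _ hv, segment_same]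
      exact singleton_subset_iff.2 (hLC (y j).2)
    have e2 : discPoint G M j u = discPoint G M j v := Subtype.ext (Prod.ext
      (by rw [hfst, hfst, (G j).boundary _ _ hu, (G j).boundary _ _ hv])
      (by rw [hsnd u hu', hsnd v hv']))
    have e3 : segment ℝ (discPoint G M j u : DiscSpace E J M) (discPoint G M j v) ⊆
        discComplex G M := by
      rw [e2, segment_same]
      exact singleton_subset_iff.2 (discPoint G M j v).2
    rw [← h e3]
    exact ht.trans_seg (hsnd v hv') e1 e3
  have hA : ∀ a, IsFromBase G M (τ (a, 0)) := fun a => by rw [hτ0]; exact h₀ a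
  have hB : ∀ a, (a = 0 ∨ 2 * (G j).n ≤ a) → ∀ k, IsFromBase G M (τ (a, k)) := by
    intro a ha k
    induction k with
    | zero => exact hA a
    | succ k ih => exact hr (a, k) (a, k + 1) (by tauto) (by tauto) ih (hτv a k)
  have hT : ∀ k, 2 * (G j).n ≤ k → ∀ a, IsFromBase G M (τ (a, k)) := by
    intro k hk a
    induction a with
    | zero => exact hB 0 (Or.inl rfl) k
    | succ a ih => exact hr (a, k) (a + 1, k) (by tauto) (by tauto) ih (hτh a k)
  refine ⟨τ, ?_, hτ⟩
  rintro ⟨a, k⟩ hu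
  unfold NullGrid.IsBoundary at hu
  rcases hu with h | h | h | h
  · exact hB _ (Or.inl h) _
  · exact hB _ (Or.inr h) _
  · simp only at h; subst h; exact hA _
  · exact hT _ h _

theorem trans_seg_trans_seg {A B : Set E} (hBA : B ⊆ A) (hB : Convex ℝ B) {b p q r : A}
    (t : PathClass b p) (hp : (p : E) ∈ B) (hq : (q : E) ∈ B) (hr : (r : E) ∈ B) (h h' h'') :
    (t.trans (seg p q h)).trans (seg q r h') = t.trans (seg p r h'') := by
  rw [Path.Homotopic.Quotient.trans_assoc, ← seg_trans_of_convex hBA hB p q r hp hq hr]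

theorem trans_seg_trans_seg_disc {j : J} {o e m : ℕ × ℕ} (ht : IsGridTriangle o e m)
    {b : discComplex G M} {p q r : discComplex G M} (t : PathClass b p)
    (hp : (p : DiscSpace E J M) ∈
      convexHull ℝ {discVertex G M j o, discVertex G M j e, discVertex G M j m})
    (hq : (q : DiscSpace E J M) ∈
      convexHull ℝ {discVertex G M j o, discVertex G M j e, discVertex G M j m})
    (hr : (r : DiscSpace E J M) ∈
      convexHull ℝ {discVertex G M j o, discVertex G M j e, discVertex G M j m}) (h) (h') (h'') :
    (t.trans (seg p q h)).trans (seg q r h') = t.trans (seg p r h'') := by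
  have h1 : convexHull ℝ {discVertex G M j o, discVertex G M j e, discVertex G M j m} ⊆
    discComplex G M := discTriangle_subset ht
  have h2 : Convex ℝ (convexHull ℝ
    {discVertex G M j o, discVertex G M j e, discVertex G M j m}) := convex_convexHull ℝ _
  generalize convexHull ℝ {discVertex G M j o, discVertex G M j e, discVertex G M j m} = B at *
  exact trans_seg_trans_seg h1 h2 t hp hq hr h h' h''

/-- The complex is simply connected. -/
theorem isSimplyConnected_discComplex {b : L} (hb : ∀ g : PathClass b b,
      Path.Homotopic.Quotient.map g (discIncl G M) = Path.Homotopic.Quotient.refl _)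
    (hM : ∀ j, 2 * (G j).n ≤ M) (hLp : IsCompactPolyhedron L)
    (hL : ∀ x, Nonempty (PathClass b x)) : IsSimplyConnected (discComplex G M) := by
  choose τ hτb hτ using exists_disc_transport (M := M) hb hL
  have hvert : ∀ {j : J} {o e m u : ℕ × ℕ}, u ∈ ({o, e, m} : Set (ℕ × ℕ)) →
      (discPoint G M j u : DiscSpace E J M) ∈
      convexHull ℝ {discVertex G M j o, discVertex G M j e, discVertex G M j m} := by
    intro j o e m u hu
    apply subset_convexHull
    rcases hu with rfl | rfl | rfl <;> simp [discPoint]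
  have hsegs : ∀ {j : J} {o e m : ℕ × ℕ}, IsGridTriangle o e m → ∀ {p q : DiscSpace E J M},
      p ∈ convexHull ℝ {discVertex G M j o, discVertex G M j e, discVertex G M j m} →
      q ∈ convexHull ℝ {discVertex G M j o, discVertex G M j e, discVertex G M j m} →
      segment ℝ p q ⊆ discComplex G M := fun ht _ _ hp hq =>
    ((convex_convexHull ℝ _).segment_subset hp hq).trans (discTriangle_subset ht)
  have hvv : ∀ {j : J} {o e m u v : ℕ × ℕ}, IsGridTriangle o e m →
      u ∈ ({o, e, m} : Set (ℕ × ℕ)) → v ∈ ({o, e, m} : Set (ℕ × ℕ)) → ∀ (x : discComplex G M),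
      (x : DiscSpace E J M) ∈
        convexHull ℝ {discVertex G M j o, discVertex G M j e, discVertex G M j m} → ∀ h h',
      (τ j u).trans (seg (discPoint G M j u) x h) =
        (τ j v).trans (seg (discPoint G M j v) x h') := by
    intro j o e m u v ht hu hv x hx h h'
    rw [← hτ j o e m ht u hu v hv (hsegs ht (hvert hu) (hvert hv))]
    exact (trans_seg_trans_seg_disc ht _ (hvert hu) (hvert hv) hx _ _ _).symm
  -- The section over the complex: at height zero use a path from `L`; otherwise go to a vertex
  -- singled out by a nonzero coordinate and continue straight. The class does not depend on the
  -- triangle and vertex used.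
  have hgood : ∀ x : discComplex G M, ∃ t : PathClass (discIncl G M b) x,
      (∀ j o e m, IsGridTriangle o e m → (x : DiscSpace E J M) ∈
        convexHull ℝ {discVertex G M j o, discVertex G M j e, discVertex G M j m} →
        ∀ u ∈ ({o, e, m} : Set (ℕ × ℕ)), ∀ h,
          (τ j u).trans (seg (discPoint G M j u) x h) = t) ∧
      ((x : DiscSpace E J M).2 = 0 → IsFromBase G M t) := by
    intro x
    by_cases hx0 : (x : DiscSpace E J M).2 = 0
    · have hxL : (x : DiscSpace E J M).1 ∈ L := by
        rcases x.2 with ⟨z, hz, h⟩ | ⟨j, o, e, m, ht, hx⟩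
        · rw [← h]; exact hz
        · obtain ⟨u, -, -, h⟩ := exists_boundary_vertex hM ht hx hx0
          exact h (right_mem_segment ℝ _ _)
      have hx' : x = discIncl G M ⟨_, hxL⟩ := Subtype.ext (Prod.ext rfl hx0)
      refine ⟨(Path.Homotopic.Quotient.map (hL ⟨_, hxL⟩).some (discIncl G M)).cast rfl hx', ?_,
        fun _ => ⟨_, _, hx', rfl⟩⟩
      intro j o e m ht hx u hu h
      obtain ⟨v, hv, hvb, hvs⟩ := exists_boundary_vertex hM ht hx hx0
      rw [hvv ht hu hv x hx h (hsegs ht (hvert hv) hx)]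
      exact ((hτb j v hvb).trans_seg hx0 hvs _).eq hb ⟨_, _, hx', rfl⟩
    · obtain ⟨v, hv⟩ : ∃ v, (x : DiscSpace E J M).2 v ≠ 0 := by
        by_contra! h
        exact hx0 (funext h)
      have hseg : segment ℝ (discPoint G M v.1 (v.2.1, v.2.2) : DiscSpace E J M) x ⊆
          discComplex G M := by
        rcases x.2 with ⟨z, hz, h⟩ | ⟨j, o, e, m, ht, hx⟩
        · exact absurd (by rw [← h]) hx0
        · obtain ⟨rfl, hu⟩ := exists_vertex_of_height_ne_zero hx hv
          exact hsegs ht (hvert hu) hx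
      refine ⟨(τ v.1 (v.2.1, v.2.2)).trans (seg _ x hseg), ?_, fun h => absurd h hx0⟩
      intro j o e m ht hx u hu h
      obtain ⟨rfl, hu'⟩ := exists_vertex_of_height_ne_zero hx hv
      exact hvv ht hu hu' x hx _ _
  choose t ht1 ht2 using hgood
  obtain ⟨S, hS, c, hKc, hcc, hcv, hc⟩ := exists_discComplex_cells hM hLp
  have := hS.to_subtype
  refine isSimplyConnected_iUnion_of_section hKc (fun k => (hcc k).isCompact.isClosed) hcv t ?_
  intro k x x' h hx hx'
  rcases hc k with ⟨s, hs, hscv, hk⟩ | ⟨j, o, e, m, htr, hk⟩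
  · rw [hk] at hx hx'
    obtain ⟨z, hz, hzx⟩ := hx
    obtain ⟨z', hz', hzx'⟩ := hx'
    have h1 : (x : DiscSpace E J M).2 = 0 := by rw [← hzx]
    have h2 : (x' : DiscSpace E J M).2 = 0 := by rw [← hzx']
    refine ((ht2 x h1).trans_seg h2 ?_ h).eq hb (ht2 x' h2)
    rw [← hzx, ← hzx']
    exact (hscv.segment_subset hz hz').trans hs
  · rw [hk] at hx hx'
    have ho : o ∈ ({o, e, m} : Set (ℕ × ℕ)) := by simp
    rw [← ht1 x j o e m htr hx o ho (hsegs htr (hvert ho) hx),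
      ← ht1 x' j o e m htr hx' o ho (hsegs htr (hvert ho) hx')]
    exact trans_seg_trans_seg_disc htr _ (hvert ho) hx hx' _ _ _

end DiscsMain

/-! ### Models in Euclidean space -/

section Transfer

variable {E F : Type*} [NormedAddCommGroup E] [NormedSpace ℝ E] [NormedAddCommGroup F]
  [NormedSpace ℝ F]

theorem LinearMap.isPLOn (f : F →ₗ[ℝ] E) {A : Set F} (hA : IsCompactPolyhedron A)
    (hf : ContinuousOn f A) : IsPLOn f A := by
  obtain ⟨S, hS, hAS⟩ := hA
  exact ⟨hf, S, hS, hAS, fun s _ x _ y _ a b _ _ _ => by simp⟩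

/-- A compact polyhedron in a normed space with a retraction onto `C` embeds, together with the
retraction, in some `ℝⁿ`. -/
theorem exists_euclidean_model {K : Set F} {X C : Set E} (hK : IsCompactPolyhedron K)
    (hKs : IsSimplyConnected K) (f : F →L[ℝ] E) (i : E →L[ℝ] F) (hfi : ∀ x, f (i x) = x)
    (hfK : MapsTo f K X) (hC : IsCompactPolyhedron C) (hKC : K ∩ f ⁻¹' C = i '' C) :
    ∃ (n : ℕ) (K : Set (Fin n → ℝ)) (f : (Fin n → ℝ) → E),
        IsCompactPolyhedron K ∧ IsSimplyConnected K ∧ IsPLOn f K ∧ MapsTo f K X ∧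
        C ⊆ f '' K ∧ IsPLHomeoOn f (K ∩ f ⁻¹' C) C := by
  obtain ⟨S, hS, hKS⟩ := id hK
  -- The polyhedron spans a finite dimensional subspace even if `F` is infinite dimensional.
  -- Coordinates on `W` are extended to `F` by linear algebra alone, so `Ψ` is only known to be
  -- continuous on `W`.
  let W : Submodule ℝ F := Submodule.span ℝ (⋃ s ∈ S, (s : Set F))
  have : FiniteDimensional ℝ W := FiniteDimensional.span_of_finite ℝ
    (hS.biUnion fun s _ => s.finite_toSet)
  have hKW : K ⊆ W := by
    rw [hKS]
    refine iUnion₂_subset fun s hs => convexHull_min ?_ W.convex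
    exact (subset_biUnion_of_mem (u := fun s : Finset F => (s : Set F)) hs).trans
      Submodule.subset_span
  let φ : W ≃L[ℝ] (Fin (Module.finrank ℝ W) → ℝ) :=
    ContinuousLinearEquiv.ofFinrankEq (by simp)
  obtain ⟨Ψ, hΨ⟩ := LinearMap.exists_extend (φ : W →ₗ[ℝ] (Fin (Module.finrank ℝ W) → ℝ))
  have hΨ' : ∀ w : W, Ψ w = φ w := fun w => DFunLike.congr_fun hΨ w
  let f' : (Fin (Module.finrank ℝ W) → ℝ) →L[ℝ] E := (f.comp W.subtypeL).comp (φ.symm : _ →L[ℝ] W)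
  have hf' : ∀ x ∈ W, f' (Ψ x) = f x := by
    intro x hx
    have := hΨ' ⟨x, hx⟩
    simp only at this
    simp [f', this]
  let K₀ : Set W := W.subtypeL ⁻¹' K
  have hK₀ : W.subtypeL '' K₀ = K := by
    rw [image_preimage_eq_inter_range]
    apply inter_eq_left.2
    intro x hx
    exact ⟨⟨x, hKW hx⟩, rfl⟩
  have hK₀' : φ '' K₀ = Ψ '' K := by
    rw [← hK₀, image_image]
    exact image_congr fun w _ => (hΨ' w).symm
  have hΨc : ContinuousOn Ψ W := by
    rw [continuousOn_iff_continuous_domRestrict]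
    exact φ.continuous.congr fun w => (hΨ' w).symm
  have hiC : MapsTo i C K := fun x hx => (hKC.symm.subset (mem_image_of_mem i hx)).1
  have hCK : (Ψ '' K) ∩ f' ⁻¹' C = (Ψ ∘ₗ (i : E →ₗ[ℝ] F)) '' C := by
    apply Subset.antisymm
    · rintro _ ⟨⟨x, hx, rfl⟩, hxC⟩
      rw [mem_preimage, hf' x (hKW hx)] at hxC
      obtain ⟨z, hz, rfl⟩ := hKC.subset ⟨hx, hxC⟩
      exact ⟨z, hz, rfl⟩
    · rintro _ ⟨z, hz, rfl⟩
      refine ⟨⟨i z, hiC hz, rfl⟩, ?_⟩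
      have := hf' (i z) (hKW (hiC hz))
      rw [hfi] at this
      simpa [this] using hz
  have hpl : ∀ z ∈ C, f' (Ψ (i z)) = z := fun z hz => by
    rw [hf' (i z) (hKW (hiC hz)), hfi]
  refine ⟨_, Ψ '' K, f', hK.image Ψ, ?_, ?_, ?_, ?_, ?_, ?_, Ψ ∘ₗ (i : E →ₗ[ℝ] F), ?_, ?_, ?_, ?_⟩
  · rw [← hK₀']
    refine (φ.toHomeomorph.isSimplyConnected_image (s := K₀)).2 ?_
    rw [← IsEmbedding.subtypeVal.isSimplyConnected_image]
    rw [← hK₀] at hKs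
    exact hKs
  · exact LinearMap.isPLOn (f' : _ →ₗ[ℝ] E) (hK.image Ψ) f'.continuous.continuousOn
  · rintro _ ⟨x, hx, rfl⟩
    rw [hf' x (hKW hx)]
    exact hfK hx
  · intro z hz
    exact ⟨_, ⟨i z, hiC hz, rfl⟩, hpl z hz⟩
  · rw [hCK]
    exact LinearMap.isPLOn (f' : (Fin (Module.finrank ℝ W) → ℝ) →ₗ[ℝ] E) (hC.image _)
      f'.continuous.continuousOn
  · intro x hx
    exact hx.2
  · refine LinearMap.isPLOn _ hC ?_
    exact hΨc.comp i.continuous.continuousOn fun z hz => hKW (hiC hz)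
  · rw [hCK]
    exact mapsTo_image _ _
  · rw [hCK]
    rintro _ ⟨z, hz, rfl⟩
    change Ψ (i (f' (Ψ (i z)))) = Ψ (i z)
    rw [hpl z hz]
  · intro z hz
    exact hpl z hz

end Transfer

/-! ### The simply connected model over a compact set -/

section Main

variable {E : Type*} [NormedAddCommGroup E] [NormedSpace ℝ E] {X C L : Set E}

/-- If the loops of `L \ C` that are null-homotopic in `X \ C` generate the fundamental group of `L`
normally, there is a simply connected compact polyhedron with a map to `X` that is injective
over `C`. -/
theorem exists_simplyConnected_model (hX : LocStar X) (hLX : L ⊆ X) (hCL : C ⊆ L)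
    (hL : IsCompactPolyhedron L) (hC : IsCompact C) (b : L) (hb : ∀ x, Nonempty (PathClass b x))
    (hN : Subgroup.normalClosure (killedLoops C hLX b) = ⊤)
    {C₀ : Set E} (hC₀ : IsCompactPolyhedron C₀) (hCC : C₀ ⊆ C) :
    ∃ (n : ℕ) (K : Set (Fin n → ℝ)) (f : (Fin n → ℝ) → E),
        IsCompactPolyhedron K ∧ IsSimplyConnected K ∧ IsPLOn f K ∧ MapsTo f K X ∧
        C₀ ⊆ f '' K ∧ IsPLHomeoOn f (K ∩ f ⁻¹' C₀) C₀ := by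
  obtain ⟨S, hS, hLS⟩ := hL.exists_cells
  have := hS.to_subtype
  have : Group.FG (FundamentalGroup L b) := fundamentalGroup_iUnion_fg hLS
    (fun s => isClosed_convexHull_finset (s : Finset E)) (fun s => convex_convexHull ℝ _) b hb
  obtain ⟨B, hB, hBf, hBN⟩ := exists_finite_normalClosure_eq_top hN
  have : Fintype B := hBf.fintype
  choose y δ β hδ hg using fun j : B => hB j.2
  have hG := fun j => exists_nullGrid (hX.diff hC.isClosed) (hL.locStar.diff hC.isClosed)
    (sdiff_subset_sdiff_left hLX) {univ} (fun z _ => ⟨univ, rfl, Filter.univ_mem⟩) (δ j) (hδ j)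
  let G := fun j => (hG j).some
  -- The sum serves only as a common bound for the sizes of the grids.
  let M := ∑ j, 2 * (G j).n
  have hM : ∀ j, 2 * (G j).n ≤ M := fun j =>
    Finset.single_le_sum (f := fun j => 2 * (G j).n) (fun _ _ => Nat.zero_le _)
      (Finset.mem_univ j)
  have hker : ∀ g : PathClass b b, Path.Homotopic.Quotient.map g (discIncl G M) =
      Path.Homotopic.Quotient.refl _ := by
    refine map_discIncl_loop β ?_
    rw [← hBN]
    congr 1
    ext g
    constructor
    · rintro ⟨j, rfl⟩
      have := j.2
      rw [hg j] at this
      exact this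
    · intro h
      exact ⟨⟨g, h⟩, (hg ⟨g, h⟩).symm⟩
  obtain ⟨S', hS', c, hKc, hcc, hcv, -⟩ := exists_discComplex_cells hM hL
  have := hS'.to_subtype
  refine exists_euclidean_model (K := discComplex G M) ?_
    (isSimplyConnected_discComplex hker hM hL hb) (ContinuousLinearMap.fst ℝ E _)
    (ContinuousLinearMap.inl ℝ E _) (fun x => rfl) (fun x hx => discComplex_fst_mem hLX hx)
    hC₀ ?_
  · rw [hKc]
    exact IsCompactPolyhedron.iUnion hcc
  · apply Subset.antisymm
    · rintro x ⟨hx, hxC⟩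
      exact ⟨x.1, hxC, Prod.ext rfl (discComplex_height_eq_zero hx (hCC hxC)).symm⟩
    · rintro _ ⟨x, hx, rfl⟩
      exact ⟨Or.inl ⟨x, hCL (hCC hx), rfl⟩, hx⟩

end Main

/-! ### Connectedness in polyhedra and tameness -/

section Connected

variable {E : Type*} [NormedAddCommGroup E] [NormedSpace ℝ E] {X A L : Set E}

theorem StarConvex.joinedIn {S : Set E} {x y : E} (h : StarConvex ℝ x S) (hy : y ∈ S) :
    JoinedIn S x y :=
  (JoinedIn.of_segment_subset (starConvex_iff_segment_subset.1 h hy))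

/-- Discard the cells of a polyhedral neighbourhood that miss `x`: nothing is lost near `x`, and the
remaining union is star convex. -/
theorem IsPolyhedron.exists_star_nhds (hX : IsPolyhedron X) {x : E} (hx : x ∈ X) :
    ∃ Q : Set E, IsCompactPolyhedron Q ∧ Q ⊆ X ∧ Q ∈ 𝓝[X] x ∧ StarConvex ℝ x Q := by
  obtain ⟨P, ⟨S, hS, hPS⟩, hPX, hP⟩ := hX x hx
  let T := {s ∈ S | x ∈ convexHull ℝ (s : Set E)}
  have hT : T ⊆ S := sep_subset _ _
  have hTP : ⋃ s ∈ T, convexHull ℝ (s : Set E) ⊆ P := by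
    rw [hPS]; exact biUnion_subset_biUnion_left hT
  refine ⟨⋃ s ∈ T, convexHull ℝ (s : Set E), ⟨T, hS.subset hT, rfl⟩, hTP.trans hPX, ?_, ?_⟩
  · have := hS.to_subtype
    obtain ⟨r, hr, h⟩ := exists_ball_of_finite_closed
      (fun s : S => convexHull ℝ ((s : Finset E) : Set E))
      (fun s => isClosed_convexHull_finset (s : Finset E)) x
    filter_upwards [hP, mem_nhdsWithin_of_mem_nhds (ball_mem_nhds x hr)] with y hy hyr
    rw [hPS] at hy
    obtain ⟨s, hs, hys⟩ := mem_iUnion₂.1 hy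
    exact mem_iUnion₂.2 ⟨s, ⟨hs, h ⟨s, hs⟩ y hys hyr⟩, hys⟩
  · exact starConvex_iUnion₂ fun s hs => (convex_convexHull ℝ _).starConvex hs.2

theorem IsPolyhedron.isPathConnected (hX : IsPolyhedron X) (hc : IsConnected X) :
    IsPathConnected X := by
  refine isPathConnected_iff.2 ⟨hc.nonempty, fun x hx y hy => ?_⟩
  refine hc.isPreconnected.induction₂' (JoinedIn X) ?_ (fun _ _ _ _ _ _ h h' => h.trans h') hx hy
  intro z hz
  obtain ⟨Q, -, hQX, hQ, hst⟩ := hX.exists_star_nhds hz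
  filter_upwards [hQ] with w hw
  have := (hst.joinedIn hw).mono hQX
  exact ⟨this, this.symm⟩

theorem isCompactPolyhedron_biUnion {ι : Type*} {t : Set ι} (ht : t.Finite) {c : ι → Set E}
    (h : ∀ i ∈ t, IsCompactPolyhedron (c i)) : IsCompactPolyhedron (⋃ i ∈ t, c i) := by
  rw [biUnion_eq_iUnion]
  have := ht.to_subtype
  exact IsCompactPolyhedron.iUnion fun i => h i i.2

theorem contractibleSpace_unitInterval : ContractibleSpace I :=
  (convex_Icc (0 : ℝ) 1).contractibleSpace ⟨0, by simp⟩

/-- A compact path connected subset of a polyhedron lies in a path connected compact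
subpolyhedron. -/
theorem IsPolyhedron.exists_isPathConnected_superset (hX : IsPolyhedron X) (hA : IsCompact A)
    (hAX : A ⊆ X) (hAc : IsPathConnected A) :
    ∃ R, A ⊆ R ∧ R ⊆ X ∧ IsCompactPolyhedron R ∧ IsPathConnected R := by
  choose! Q hQ1 hQ2 hQ3 hQ4 using fun x (hx : x ∈ X) => hX.exists_star_nhds hx
  obtain ⟨t, ht, hcov⟩ := hA.elim_nhdsWithin_subcover Q
    fun x hx => nhdsWithin_mono x hAX (hQ3 x (hAX hx))
  refine ⟨⋃ x ∈ t, Q x, hcov, iUnion₂_subset fun x hx => hQ2 x (hAX (ht x hx)),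
    isCompactPolyhedron_biUnion t.finite_toSet fun x hx => hQ1 x (hAX (ht x hx)), ?_⟩
  obtain ⟨a, ha, haA⟩ := hAc
  refine ⟨a, hcov ha, fun {y} hy => ?_⟩
  obtain ⟨x, hx, hyx⟩ := mem_iUnion₂.1 hy
  exact ((haA (ht x hx)).mono hcov).trans (((hQ4 x (hAX (ht x hx))).joinedIn hyx).mono
    (subset_biUnion_of_mem (u := Q) hx))

/-- A compact subset of a path connected polyhedron lies in a path connected compact
subpolyhedron. -/
theorem IsPolyhedron.exists_superset (hX : IsPolyhedron X) (hXc : IsPathConnected X)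
    (hA : IsCompact A) (hAX : A ⊆ X) :
    ∃ R, A ⊆ R ∧ R ⊆ X ∧ IsCompactPolyhedron R ∧ IsPathConnected R := by
  obtain ⟨b, hb, hbX⟩ := hXc
  choose! Q hQ1 hQ2 hQ3 hQ4 using fun x (hx : x ∈ X) => hX.exists_star_nhds hx
  have := contractibleSpace_unitInterval
  have h : ∀ x ∈ X, ∃ R, {b, x} ⊆ R ∧ R ⊆ X ∧ IsCompactPolyhedron R ∧ IsPathConnected R := by
    intro x hx
    have hj := hbX hx
    obtain ⟨R, h1, h2, h3, h4⟩ := hX.exists_isPathConnected_superset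
      (A := range hj.somePath) (isCompact_range hj.somePath.continuous)
      (by rintro _ ⟨s, rfl⟩; exact hj.somePath_mem s) (isPathConnected_range hj.somePath.continuous)
    exact ⟨R, (by
      rintro z (rfl | rfl)
      · exact h1 ⟨0, by simp⟩
      · exact h1 ⟨1, by simp⟩), h2, h3, h4⟩
  choose! R hR1 hR2 hR3 hR4 using h
  obtain ⟨t, ht, hcov⟩ := hA.elim_nhdsWithin_subcover Q
    fun x hx => nhdsWithin_mono x hAX (hQ3 x (hAX hx))
  have htX : ∀ x ∈ (insert b t : Set E), x ∈ X := by
    rintro x (rfl | hx)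
    · exact hb
    · exact hAX (ht x hx)
  refine ⟨⋃ x ∈ (insert b t : Set E), (R x ∪ Q x), ?_,
    iUnion₂_subset fun x hx => union_subset (hR2 x (htX x hx)) (hQ2 x (htX x hx)),
    isCompactPolyhedron_biUnion (t.finite_toSet.insert b) fun x hx =>
      (hR3 x (htX x hx)).union (hQ1 x (htX x hx)), b, ?_, ?_⟩
  · intro y hy
    obtain ⟨x, hx, hyx⟩ := mem_iUnion₂.1 (hcov hy)
    exact mem_iUnion₂.2 ⟨x, Or.inr hx, Or.inr hyx⟩
  · exact mem_iUnion₂.2 ⟨b, Or.inl rfl, Or.inl (hR1 b hb (Or.inl rfl))⟩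
  · intro y hy
    obtain ⟨x, hx, hyx⟩ := mem_iUnion₂.1 hy
    have hsub := subset_biUnion_of_mem (u := fun x => R x ∪ Q x) hx
    have hRx := hR4 x (htX x hx)
    have hbx := hR1 x (htX x hx)
    have h1 : ∀ z ∈ R x, JoinedIn (R x ∪ Q x) b z := fun z hz =>
      (hRx.joinedIn b (hbx (Or.inl rfl)) z hz).mono subset_union_left
    refine JoinedIn.mono ?_ hsub
    rcases hyx with hyx | hyx
    · exact h1 y hyx
    · exact (h1 x (hbx (Or.inr rfl))).trans
        (((hQ4 x (htX x hx)).joinedIn hyx).mono subset_union_right)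

/-- The path components of a compact polyhedron are compact polyhedra. -/
theorem IsCompactPolyhedron.pathComponentIn (hA : IsCompactPolyhedron A) (b : E) :
    IsCompactPolyhedron (pathComponentIn A b) := by
  obtain ⟨S, hS, hAS⟩ := hA
  have hsub : ∀ s ∈ S, convexHull ℝ (s : Set E) ⊆ A := fun s hs => by
    rw [hAS]; exact subset_biUnion_of_mem (u := fun s : Finset E => convexHull ℝ (s : Set E)) hs
  -- A cell is path connected, so it lies in the component as soon as it meets it.
  refine ⟨{s ∈ S | convexHull ℝ (s : Set E) ⊆ _root_.pathComponentIn A b},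
    hS.subset (sep_subset _ _), Subset.antisymm ?_ (iUnion₂_subset fun s hs => hs.2)⟩
  intro x hx
  obtain ⟨s, hs, hxs⟩ := mem_iUnion₂.1 (hAS.subset hx.target_mem)
  refine mem_iUnion₂.2 ⟨s, ⟨hs, fun y hy => ?_⟩, hxs⟩
  exact JoinedIn.trans hx
    ((((convex_convexHull ℝ (s : Set E)).starConvex hxs).joinedIn hy).mono (hsub s hs))

theorem nonempty_pathClass_of_joinedIn {b x : L} (h : JoinedIn L (b : E) x) :
    Nonempty (PathClass b x) :=
  PathClass.nonempty_of_joined h.joined_subtype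

/-- The two ways round the square `I × I` are homotopic because the square is contractible; the
track of the base point is the conjugating path. -/
theorem FreelyHomotopic.exists_conj {Y : Type*} [TopologicalSpace Y] {x y : Y} {γ : Path x x}
    {δ : Path y y} (h : FreelyHomotopic γ δ) :
    ∃ β : PathClass x y, pathClass γ = β.trans ((pathClass δ).trans β.symm) := by
  obtain ⟨H, h0, h1, hs⟩ := h
  have e0 : H (0, 0) = x := by rw [h0]; simp
  have e1 : H (1, 0) = y := by rw [h1]; simp
  have e2 : H (0, 1) = x := by rw [h0]; simp
  have e3 : H (1, 1) = y := by rw [h1]; simp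
  let β : Path x y := ⟨⟨fun s => H (s, 0), by fun_prop⟩, e0, e1⟩
  let hor : ∀ t : I, Path ((0 : I), t) (1, t) := fun t =>
    ⟨⟨fun s => (s, t), by fun_prop⟩, rfl, rfl⟩
  let ver : ∀ s : I, Path (s, (0 : I)) (s, 1) := fun s =>
    ⟨⟨fun t => (s, t), by fun_prop⟩, rfl, rfl⟩
  have := contractibleSpace_unitInterval
  have key := pathClass_eq_of_simplyConnected H
    (pathClass ((ver 0).trans (hor 1))) (pathClass ((hor 0).trans (ver 1)))
  have key2 : pathClass (γ.trans β) = pathClass (β.trans δ) := by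
    have g1 : ((ver 0).trans (hor 1)).map H.continuous = (γ.trans β).cast e0 e3 := by
      rw [Path.map_trans]
      ext t
      simp only [Path.cast_coe]
      rw [Path.trans_apply, Path.trans_apply]
      split_ifs
      · exact h0 _
      · exact (hs _).symm
    have g2 : ((hor 0).trans (ver 1)).map H.continuous = (β.trans δ).cast e0 e3 := by
      rw [Path.map_trans]
      ext t
      simp only [Path.cast_coe]
      rw [Path.trans_apply, Path.trans_apply]
      split_ifs
      · rfl
      · exact h1 _
    have key' : pathClass (((ver 0).trans (hor 1)).map H.continuous) =
        pathClass (((hor 0).trans (ver 1)).map H.continuous) := key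
    rw [g1, g2] at key'
    have := congrArg (fun q => Path.Homotopic.Quotient.cast q e0.symm e3.symm) key'
    exact this
  refine ⟨pathClass β, ?_⟩
  have key3 : (pathClass γ).trans (pathClass β) = (pathClass β).trans (pathClass δ) := key2
  rw [← Path.Homotopic.Quotient.trans_assoc, ← key3]
  simp

end Connected

/-! ### Tame and weakly geometrically simply connected polyhedra -/

section Tame

variable {E : Type*} [NormedAddCommGroup E] [NormedSpace ℝ E] {X : Set E}

/-- A compact `X` could itself be taken as `C`, leaving no room for a loop in `K \ C`. -/
theorem IsOneTame.not_isCompact (hX : IsPolyhedron X) (hne : X.Nonempty) (ht : IsOneTame X) :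
    ¬ IsCompact X := by
  intro hc
  obtain ⟨K, hCK, hKX, -, h⟩ := ht X subset_rfl (isCompactPolyhedron_iff.2 ⟨hc, hX⟩)
  obtain ⟨x, hx⟩ := hne
  obtain ⟨y, -⟩ := h ⟨x, hCK hx⟩ (Path.refl _)
  exact y.2.2 (hKX y.2.1)

/-- Choose `C` to contain the loop. In `K` the loop is conjugate to one that bounds in `X \ C`. -/
theorem IsOneTame.isSimplyConnected (hX : IsPolyhedron X) (hc : IsPathConnected X)
    (ht : IsOneTame X) : IsSimplyConnected X := by
  refine simply_connected_iff_loops_nullhomotopic.2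
    ⟨isPathConnected_iff_pathConnectedSpace.1 hc, fun x γ => ?_⟩
  obtain ⟨C, hC, hCX, hCp, -⟩ := hX.exists_superset hc
    (A := Subtype.val '' range γ) ((isCompact_range γ.continuous).image continuous_subtype_val)
    (by rintro _ ⟨z, -, rfl⟩; exact z.2)
  obtain ⟨K, hCK, hKX, -, h⟩ := ht C hCX hCp
  have hγK : ∀ t, (γ t : E) ∈ K := fun t => hCK (hC ⟨_, mem_range_self t, rfl⟩)
  have hxK : (x : E) ∈ K := by simpa using hγK 0
  let γ' : Path (⟨x, hxK⟩ : K) ⟨x, hxK⟩ :=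
    ⟨⟨fun t => ⟨γ t, hγK t⟩, by fun_prop⟩, by simp, by simp⟩
  obtain ⟨y, δ, hδ, hδ0⟩ := h _ γ'
  obtain ⟨β, hβ⟩ := hδ.exists_conj
  have h1 : pathClass γ = PathClass.incl hKX (pathClass γ') := rfl
  have h2 : PathClass.incl hKX (PathClass.incl (sdiff_subset : K \ C ⊆ K) (pathClass δ)) =
      PathClass.incl (sdiff_subset : X \ C ⊆ X) (PathClass.incl
        (sdiff_subset_sdiff_left hKX : K \ C ⊆ X \ C) (pathClass δ)) := rfl
  have h3 : PathClass.incl (sdiff_subset_sdiff_left hKX : K \ C ⊆ X \ C) (pathClass δ) =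
      Path.Homotopic.Quotient.refl _ := Quotient.sound hδ0
  have h4 : PathClass.incl hKX (PathClass.incl (sdiff_subset : K \ C ⊆ K) (pathClass δ)) =
      Path.Homotopic.Quotient.refl _ := by
    rw [h2, h3]; rfl
  have hβ' : pathClass γ' =
    β.trans ((PathClass.incl (sdiff_subset : K \ C ⊆ K) (pathClass δ)).trans β.symm) := hβ
  refine Path.Homotopic.Quotient.exact ?_
  change pathClass γ = _
  rw [h1, hβ', PathClass.incl_trans, PathClass.incl_trans, h4, PathClass.incl_symm]
  simp

theorem IsOneTame.isQsf (hX : IsPolyhedron X) (hc : IsConnected X) (ht : IsOneTame X) :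
    IsQsf X := by
  have hpc := hX.isPathConnected hc
  refine ⟨ht.isSimplyConnected hX hpc, ht.not_isCompact hX hc.nonempty, fun C₀ hC₀X hC₀ => ?_⟩
  obtain ⟨b, hb⟩ := hc.nonempty
  -- Making `C` path connected puts it inside a single path component of `K`.
  obtain ⟨C, hC₀C, hCX, hC, hCc⟩ := hX.exists_superset hpc (hC₀.isCompact.insert b)
    (insert_subset hb hC₀X)
  have hbC : b ∈ C := hC₀C (mem_insert _ _)
  obtain ⟨K, hCK, hKX, hK, h⟩ := ht C hCX hC
  let L := pathComponentIn K b
  have hLK : L ⊆ K := pathComponentIn_subset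
  have hCL : C ⊆ L := fun x hx => (hCc.joinedIn b hbC x hx).mono hCK
  have hLc : IsPathConnected L := isPathConnected_pathComponentIn (hCK hbC)
  refine exists_simplyConnected_model hX.locStar (hLK.trans hKX) hCL (hK.pathComponentIn b)
    hC.isCompact ⟨b, hCL hbC⟩
    (fun x => nonempty_pathClass_of_joinedIn (hLc.joinedIn _ (hCL hbC) _ x.2)) ?_ hC₀
    ((subset_insert _ _).trans hC₀C)
  refine eq_top_iff.2 fun g _ => Subgroup.subset_normalClosure ?_
  obtain ⟨γ, hγ⟩ := Path.Homotopic.Quotient.mk_surjective (X := L) g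
  let γ' : Path (⟨b, hCK hbC⟩ : K) ⟨b, hCK hbC⟩ := γ.map (continuous_inclusion hLK)
  obtain ⟨y, δ, ⟨H, h0, h1, hs⟩, hδ0⟩ := h _ γ'
  have := contractibleSpace_unitInterval
  -- A free homotopy that starts in `L` cannot leave this path component of `K`.
  have hH : ∀ p, (H p : E) ∈ L := by
    intro p
    have hj : Joined (H (0, 0)) (H p) := (PathConnectedSpace.joined (0, 0) p).map H.continuous
    rw [h0] at hj
    have e : γ' 0 = ⟨b, hCK hbC⟩ := γ'.source
    rw [e] at hj
    exact (joinedIn_iff_joined (hCK hbC) (H p).2).2 hj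
  have hδL : ∀ t, (δ t : E) ∈ L := fun t => by
    have := hH (1, t)
    rw [h1] at this
    exact this
  have hyL : (y : E) ∈ L := by simpa using hδL 0
  let y' : ↥(L \ C) := ⟨y, hyL, y.2.2⟩
  let δ' : Path y' y' := ⟨⟨fun t => ⟨δ t, hδL t, (δ t).2.2⟩, by fun_prop⟩, by simp [y'],
    by simp [y']⟩
  have hfree : FreelyHomotopic γ (δ'.map (continuous_inclusion (sdiff_subset : L \ C ⊆ L))) := by
    refine ⟨⟨fun p => ⟨H p, hH p⟩, by fun_prop⟩, fun t => ?_, fun t => ?_, fun s => ?_⟩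
    · apply Subtype.ext
      change (H (0, t) : E) = γ t
      rw [h0]; rfl
    · apply Subtype.ext
      change (H (1, t) : E) = δ t
      rw [h1]; rfl
    · apply Subtype.ext
      change (H (s, 0) : E) = H (s, 1)
      rw [hs]
  obtain ⟨β, hβ⟩ := hfree.exists_conj
  refine ⟨y', pathClass δ', β, ?_, ?_⟩
  · exact Quotient.sound hδ0
  · rw [← hγ]
    exact hβ

theorem IsWgsc.isSimplyConnected (h : IsWgsc X) : IsSimplyConnected X := by
  obtain ⟨-, K, -, hKX, hK, hex⟩ := h
  have hKX' : ∀ j, K j ⊆ X := fun j => hKX ▸ subset_iUnion K j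
  refine simply_connected_iff_loops_nullhomotopic.2 ⟨?_, fun x γ => ?_⟩
  · refine isPathConnected_iff_pathConnectedSpace.1 (isPathConnected_iff.2 ⟨?_, ?_⟩)
    · exact (hK 0).2.nonempty.mono (hKX' 0)
    · intro x hx y hy
      obtain ⟨j, hj⟩ := hex {x, y} (by simp [insert_subset_iff, hx, hy])
        (toFinite _).isCompact
      exact ((hK j).2.isPathConnected.joinedIn x (hj (by simp)) y (hj (by simp))).mono (hKX' j)
  · obtain ⟨j, hj⟩ := hex (Subtype.val '' range γ) (by rintro _ ⟨z, -, rfl⟩; exact z.2)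
      ((isCompact_range γ.continuous).image continuous_subtype_val)
    have hγK : ∀ t, (γ t : E) ∈ K j := fun t => hj ⟨_, mem_range_self t, rfl⟩
    have hxK : (x : E) ∈ K j := by simpa using hγK 0
    let γ' : Path (⟨x, hxK⟩ : K j) ⟨x, hxK⟩ :=
      ⟨⟨fun t => ⟨γ t, hγK t⟩, by fun_prop⟩, by simp, by simp⟩
    have := (hK j).2.simplyConnectedSpace
    exact (SimplyConnectedSpace.paths_homotopic γ' (Path.refl _)).map
      ⟨inclusion (hKX' j), continuous_inclusion (hKX' j)⟩

/-- With one simply connected `K j` in both roles, the three conditions become trivial. -/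
theorem IsWgsc.hasSmallContent (h : IsWgsc X) : HasSmallContent X := by
  refine ⟨h.isSimplyConnected, h.1, fun C hCX hC => ?_⟩
  obtain ⟨-, K, -, hKX, hK, hex⟩ := h
  obtain ⟨j, hj⟩ := hex C hCX hC
  have := (hK j).2.simplyConnectedSpace
  have hc := (hK j).2.isPathConnected.isConnected
  refine ⟨K j, K j, hj, subset_rfl, hKX ▸ subset_iUnion K j, (hK j).1, hc, (hK j).1, hc,
    fun x γ => SimplyConnectedSpace.paths_homotopic _ _, fun x _ y _ h => h, fun x γ => ?_⟩
  exact ⟨γ, Path.Homotopic.refl _⟩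

/-- Non-compactness provides a point outside `C`. Contract the loop in `K j`, then drag the constant
loop along a path to that point. -/
theorem IsWgsc.isOneTame (h : IsWgsc X) : IsOneTame X := by
  intro C hCX hC
  obtain ⟨hnc, K, -, hKX, hK, hex⟩ := h
  obtain ⟨y, hyX, hyC⟩ : ∃ y ∈ X, y ∉ C := by
    by_contra! h
    exact hnc (hCX.antisymm h ▸ hC.isCompact)
  obtain ⟨j, hj⟩ := hex (insert y C) (insert_subset hyX hCX) (hC.isCompact.insert y)
  have hKjX : K j ⊆ X := hKX ▸ subset_iUnion K j
  refine ⟨K j, (subset_insert _ _).trans hj, hKjX, (hK j).1, fun x γ => ?_⟩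
  have := (hK j).2.simplyConnectedSpace
  have hyK : y ∈ K j := hj (mem_insert _ _)
  obtain ⟨F⟩ := SimplyConnectedSpace.paths_homotopic γ (Path.refl x)
  let p : Path x ⟨y, hyK⟩ := PathConnectedSpace.somePath _ _
  let G : ContinuousMap.Homotopy ((Path.refl x : Path x x) : C(I, K j))
      (ContinuousMap.const I ⟨y, hyK⟩) :=
    { toFun := fun q => p q.1, map_zero_left := by simp, map_one_left := by simp }
  let H := F.toHomotopy.trans G
  refine ⟨⟨y, hyK, hyC⟩, Path.refl _, ⟨H.toContinuousMap, fun t => H.apply_zero t,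
    fun t => H.apply_one t, fun s => ?_⟩, ?_⟩
  · change H (s, 0) = H (s, 1)
    simp only [H, ContinuousMap.Homotopy.trans_apply]
    split_ifs with h
    · exact (F.source _).trans (F.target _).symm
    · rfl
  · exact Path.Homotopic.refl _

end Tame

/-! ### Sets that every polyhedron containing them surrounds -/

section Cone

variable {E : Type*} [NormedAddCommGroup E] [NormedSpace ℝ E] {X C D : Set E}

/-- All weights of `e` are positive, so they stay nonnegative after a small move away from those of
`z`. -/
theorem exists_extend_of_mem_convexHull {t : Finset E} {w : E → ℝ} (hw : ∀ y ∈ t, 0 < w y)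
    (hw1 : ∑ y ∈ t, w y = 1) {z : E} (hz : z ∈ convexHull ℝ (t : Set E)) :
    ∃ ε : ℝ, 0 < ε ∧ ∀ e, e = ∑ y ∈ t, w y • y → e + ε • (e - z) ∈ convexHull ℝ (t : Set E) := by
  obtain ⟨a, ha, ha1, haz⟩ := Finset.mem_convexHull'.1 hz
  have h : ∀ᶠ ε : ℝ in 𝓝[>] 0, ∀ y ∈ t, 0 ≤ w y + ε * (w y - a y) := by
    refine (Filter.eventually_all_finset t).2 fun y hy => ?_
    have h1 : Filter.Tendsto (fun ε : ℝ => w y + ε * (w y - a y)) (𝓝[>] 0)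
        (𝓝 (w y + 0 * (w y - a y))) :=
      (Continuous.tendsto (by fun_prop) _).mono_left nhdsWithin_le_nhds
    rw [zero_mul, add_zero] at h1
    exact (h1.eventually (lt_mem_nhds (hw y hy))).mono fun _ h => h.le
  obtain ⟨ε, hε, hε0⟩ := (h.and self_mem_nhdsWithin).exists
  refine ⟨ε, hε0, fun e he => ?_⟩
  refine Finset.mem_convexHull'.2 ⟨fun y => w y + ε * (w y - a y), hε, ?_, ?_⟩
  · rw [Finset.sum_add_distrib, ← Finset.mul_sum, Finset.sum_sub_distrib, hw1, ha1]
    ring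
  · rw [he, ← haz]
    simp only [add_smul, mul_smul, sub_smul, Finset.sum_add_distrib, ← Finset.smul_sum,
      Finset.sum_sub_distrib]

/-- The radius excludes the hulls of those subsets of `s` that do not contain `z`. Move from `z`
towards `x` as far as the hull allows. A last point before `x` would be a positive combination of a
subset whose hull contains `z`, and the segment could be prolonged beyond it. -/
theorem eventually_cone_convexHull (s : Finset E) (z : E) :
    ∀ᶠ x in 𝓝 z, ∀ l ∈ Ioc (0 : ℝ) 1, z + l • (x - z) ∈ convexHull ℝ (s : Set E) →
      x ∈ convexHull ℝ (s : Set E) := by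
  classical
  obtain ⟨r, hr, h⟩ := exists_ball_of_finite_closed
    (fun t : s.powerset => convexHull ℝ (((t : Finset E) : Set E)))
    (fun t => isClosed_convexHull_finset (t : Finset E)) z
  filter_upwards [ball_mem_nhds z hr] with x hx l hl hxl
  let T : Set ℝ := {m ∈ Icc l 1 | z + m • (x - z) ∈ convexHull ℝ (s : Set E)}
  have hTc : IsCompact T := by
    refine isCompact_Icc.inter_right ((isClosed_convexHull_finset s).preimage ?_)
    fun_prop
  obtain ⟨m, ⟨hm, hmx⟩, hmax⟩ := hTc.exists_isGreatest ⟨l, ⟨le_rfl, hl.2⟩, hxl⟩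
  have hm0 : 0 < m := hl.1.trans_le hm.1
  rcases hm.2.eq_or_lt with rfl | hm1
  · simpa using hmx
  exfalso
  obtain ⟨w, hw, hw1, hwe⟩ := Finset.mem_convexHull'.1 hmx
  let t := s.filter fun y => w y ≠ 0
  have ht : t ⊆ s := Finset.filter_subset _ _
  have hwt : ∀ y ∈ t, 0 < w y := fun y hy =>
    lt_of_le_of_ne (hw y (ht hy)) (Finset.mem_filter.1 hy).2.symm
  have hs1 : ∑ y ∈ t, w y = 1 := by
    rw [← hw1]
    exact Finset.sum_filter_ne_zero s
  have hs2 : ∑ y ∈ t, w y • y = z + m • (x - z) := by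
    rw [← hwe]
    refine Finset.sum_subset ht fun y hy hyt => ?_
    have : w y = 0 := by
      by_contra h0
      exact hyt (Finset.mem_filter.2 ⟨hy, h0⟩)
    rw [this, zero_smul]
  have hd : dist (z + m • (x - z)) z < r := by
    rw [dist_eq_norm, add_sub_cancel_left, norm_smul, Real.norm_of_nonneg hm0.le]
    refine lt_of_le_of_lt ?_ (mem_ball.1 hx)
    rw [dist_eq_norm]
    exact mul_le_of_le_one_left (norm_nonneg _) hm.2
  have hz : z ∈ convexHull ℝ (t : Set E) := by
    refine h ⟨t, Finset.mem_powerset.2 ht⟩ (z + m • (x - z)) ?_ hd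
    exact Finset.mem_convexHull'.2 ⟨w, fun y hy => (hwt y hy).le, hs1, hs2⟩
  obtain ⟨ε, hε, hext⟩ := exists_extend_of_mem_convexHull hwt hs1 hz
  have h1 := convexHull_mono (Finset.coe_subset.2 ht) (hext _ hs2.symm)
  have h2 : z + m • (x - z) + ε • (z + m • (x - z) - z) = z + (m + ε * m) • (x - z) := by
    module
  rw [h2] at h1
  have hεm : 0 < ε * m := mul_pos hε hm0
  by_cases hle : m + ε * m ≤ 1
  · have := hmax ⟨⟨hm.1.trans (by linarith), hle⟩, h1⟩
    linarith
  -- If the prolongation overshoots, `x` lies between two points of the hull.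
  · have h3 : z + (1 : ℝ) • (x - z) ∈ convexHull ℝ (s : Set E) := by
      refine (convex_convexHull ℝ (s : Set E)).segment_subset hmx h1 ?_
      rw [segment_eq_image]
      have hne : ε * m ≠ 0 := hεm.ne'
      refine ⟨(1 - m) / (ε * m), ⟨div_nonneg (by linarith) hεm.le,
        (div_le_one hεm).2 (by linarith)⟩, ?_⟩
      have h4 : (1 : ℝ) = m + ((1 - m) / (ε * m)) * (ε * m) := by
        rw [div_mul_cancel₀ _ hne]; ring
      conv_rhs => rw [h4]
      module
    have := hmax ⟨⟨hl.2, le_rfl⟩, h3⟩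
    linarith

/-- A compact polyhedron is a cone near each point. -/
theorem IsCompactPolyhedron.eventually_cone (hD : IsCompactPolyhedron D) (z : E) :
    ∀ᶠ x in 𝓝 z, ∀ l ∈ Ioc (0 : ℝ) 1, z + l • (x - z) ∈ D → x ∈ D := by
  obtain ⟨S, hS, rfl⟩ := hD
  have h := (Filter.eventually_all_finite hS).2 fun s _ => eventually_cone_convexHull s z
  filter_upwards [h] with x hx l hl hxl
  obtain ⟨s, hs, hxs⟩ := mem_iUnion₂.1 hxl
  exact mem_iUnion₂.2 ⟨s, hs, hx s hs l hl hxs⟩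

/-- Suppose that `x` is close to `z` but not in `D`. Shrink `x` towards `z` by a factor `l`; some
point of `N` is within `(l * dist x z) ^ 2` of the result. Expanding by `l⁻¹` gives a point within
`l * dist x z ^ 2` of `x`, which is in `D` by the cone property. For small `l` this contradicts that
`D` is closed. The quadratic rate is what survives the rescaling. -/
theorem IsCompactPolyhedron.mem_nhdsWithin_of_net {N : Set E} (hD : IsCompactPolyhedron D)
    (hX : LocStar X) {z : E} (hzX : z ∈ X) (hzC : z ∈ C)
    (hN : ∀ᶠ x in 𝓝[X] z, ∃ s ∈ N, dist s x ≤ infDist x C ^ 2) (hND : N ⊆ D) :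
    D ∈ 𝓝[X] z := by
  obtain ⟨r₁, hr₁, hst⟩ := hX z hzX
  obtain ⟨r₂, hr₂, hcone⟩ := Metric.eventually_nhds_iff.1 (hD.eventually_cone z)
  obtain ⟨r₃, hr₃, hnet⟩ := Metric.eventually_nhds_iff.1 (eventually_nhdsWithin_iff.1 hN)
  have hr : 0 < min r₁ (min r₂ r₃) := by positivity
  filter_upwards [self_mem_nhdsWithin, mem_nhdsWithin_of_mem_nhds (ball_mem_nhds z hr)]
    with x hx hxr
  by_contra hxD
  have hx1 : dist x z < r₁ := (mem_ball.1 hxr).trans_le (min_le_left _ _)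
  have hx2 : dist x z < r₂ :=
    (mem_ball.1 hxr).trans_le ((min_le_right _ _).trans (min_le_left _ _))
  have hx3 : dist x z < r₃ :=
    (mem_ball.1 hxr).trans_le ((min_le_right _ _).trans (min_le_right _ _))
  obtain ⟨ε, hε, hεD⟩ := Metric.mem_nhds_iff.1 (hD.isCompact.isClosed.isOpen_compl.mem_nhds hxD)
  -- The second term keeps the rescaled point where the cone property holds.
  set ε' := min ε (r₂ - dist x z) with hε'
  have hε'0 : 0 < ε' := lt_min hε (by linarith)
  have hd0 : 0 ≤ dist x z := dist_nonneg
  have hden : 0 < dist x z ^ 2 + 1 := by positivity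
  let l := min 1 (ε' / (2 * (dist x z ^ 2 + 1)))
  have hl0 : 0 < l := lt_min one_pos (by positivity)
  have hl1 : l ≤ 1 := min_le_left _ _
  have hlx : l * dist x z ^ 2 < ε' := by
    have h1 : l * (2 * (dist x z ^ 2 + 1)) ≤ ε' := by
      rw [← le_div_iff₀ (by positivity)]
      exact min_le_right _ _
    nlinarith [sq_nonneg (dist x z)]
  have hxl : z + l • (x - z) ∈ X ∩ ball z r₁ := by
    have := starConvex_iff_segment_subset.1 hst ⟨hx, hx1⟩
    refine this ?_
    rw [segment_eq_image']
    exact ⟨l, ⟨hl0.le, hl1⟩, rfl⟩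
  have hdl : dist (z + l • (x - z)) z = l * dist x z := by
    rw [dist_eq_norm, add_sub_cancel_left, norm_smul, Real.norm_of_nonneg hl0.le, dist_eq_norm]
  obtain ⟨s, hsN, hs⟩ := hnet (y := z + l • (x - z))
    (by rw [hdl]; exact (mul_le_of_le_one_left hd0 hl1).trans_lt hx3) hxl.1
  have hs' : dist s (z + l • (x - z)) ≤ (l * dist x z) ^ 2 := by
    refine hs.trans (pow_le_pow_left₀ infDist_nonneg ?_ 2)
    exact (infDist_le_dist_of_mem hzC).trans hdl.le
  set x' := z + l⁻¹ • (s - z) with hx'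
  have hsx' : z + l • (x' - z) = s := by
    rw [hx', add_sub_cancel_left, smul_smul, mul_inv_cancel₀ hl0.ne', one_smul]
    abel
  have hxx' : dist x' x < ε' := by
    have h1 : x' - x = l⁻¹ • (s - (z + l • (x - z))) := by
      have : x = z + l⁻¹ • l • (x - z) := by
        rw [smul_smul, inv_mul_cancel₀ hl0.ne', one_smul]; abel
      conv_lhs => rw [this]
      rw [hx']
      module
    rw [dist_eq_norm, h1, norm_smul, norm_inv, Real.norm_of_nonneg hl0.le, ← dist_eq_norm]
    calc l⁻¹ * dist s (z + l • (x - z)) ≤ l⁻¹ * (l * dist x z) ^ 2 := by gcongr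
      _ = l * dist x z ^ 2 := by field_simp
      _ < ε' := hlx
  have hx'D : x' ∈ D := by
    refine hcone (y := x') ?_ l ⟨hl0, hl1⟩ (by rw [hsx']; exact hND hsN)
    calc dist x' z ≤ dist x' x + dist x z := dist_triangle _ _ _
      _ < (r₂ - dist x z) + dist x z := by
        gcongr
        exact hxx'.trans_le (min_le_right _ _)
      _ = r₂ := by ring
  exact hεD (mem_ball.2 (hxx'.trans_le (min_le_left _ _))) hx'D

theorem IsPolyhedron.exists_compact_nhds (hX : IsPolyhedron X) (hC : IsCompact C) (hCX : C ⊆ X) :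
    ∃ R ⊆ X, IsCompactPolyhedron R ∧ ∀ z ∈ C, R ∈ 𝓝[X] z := by
  choose! P hP1 hP2 hP3 using hX
  choose! U hU1 hU2 using fun x (hx : x ∈ X) => mem_nhdsWithin.1 (hP3 x hx)
  obtain ⟨t, ht, hcov⟩ := hC.elim_nhds_subcover U fun x hx =>
    (hU1 x (hCX hx)).mem_nhds (hU2 x (hCX hx)).1
  refine ⟨⋃ x ∈ t, P x, iUnion₂_subset fun x hx => hP2 x (hCX (ht x hx)),
    isCompactPolyhedron_biUnion t.finite_toSet fun x hx => hP1 x (hCX (ht x hx)), fun z hz => ?_⟩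
  obtain ⟨x, hx, hzx⟩ := mem_iUnion₂.1 (hcov hz)
  have hxX := hCX (ht x hx)
  refine Filter.mem_of_superset (mem_nhdsWithin.2 ⟨U x, hU1 x hxX, hzx, (hU2 x hxX).2⟩) ?_
  exact subset_biUnion_of_mem (u := P) hx

/-- A compact set `C` has a compact superset `N`, with isolated points outside `C`, that accumulates
at `C` fast. -/
theorem exists_fast_net (hC : IsCompact C) (hne : C.Nonempty) {R : Set E} (hR : IsCompact R)
    (hCR : C ⊆ R) :
    ∃ N, C ⊆ N ∧ N ⊆ R ∧ IsCompact N ∧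
      (∀ z ∉ C, ∃ r > 0, N ∩ ball z r ⊆ {z}) ∧
      ∀ x ∈ R, infDist x C < 1 → ∃ s ∈ N, dist s x ≤ infDist x C ^ 2 := by
  -- Dyadic shells around `C`, each given a finite net whose mesh is the square of the inner radius.
  -- Near a point off `C` only finitely many shells are visible, so the nets accumulate only at `C`.
  let A : ℕ → Set E := fun n => R ∩ (infDist · C) ⁻¹' Icc ((1 / 2) ^ (n + 1)) ((1 / 2) ^ n)
  have hA : ∀ n, IsCompact (A n) := fun n =>
    hR.inter_right (isClosed_Icc.preimage (continuous_infDist_pt C))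
  have hpos : ∀ n : ℕ, (0 : ℝ) < ((1 / 2) ^ (n + 1)) ^ 2 := fun n => by positivity
  choose t htA htf hcov using fun n => (hA n).finite_cover_balls (hpos n)
  have hfin : ∀ z ∉ C, ∃ r > 0, ((⋃ n, t n) ∩ ball z r).Finite ∧ C ∩ ball z r = ∅ := by
    intro z hz
    have hd : 0 < infDist z C := (hC.isClosed.notMem_iff_infDist_pos hne).1 hz
    obtain ⟨m, hm⟩ := exists_pow_lt_of_lt_one (half_pos hd) (by norm_num : (1 / 2 : ℝ) < 1)
    have hfar : ∀ y ∈ ball z (infDist z C / 2), infDist z C / 2 < infDist y C := by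
      intro y hy
      have := infDist_le_infDist_add_dist (s := C) (x := z) (y := y)
      rw [dist_comm] at this
      have := mem_ball.1 hy
      linarith
    refine ⟨infDist z C / 2, half_pos hd, ?_, ?_⟩
    · refine ((finite_lt_nat m).biUnion fun n _ => htf n).subset ?_
      rintro y ⟨hy, hyz⟩
      obtain ⟨n, hn⟩ := mem_iUnion.1 hy
      refine mem_iUnion₂.2 ⟨n, ?_, hn⟩
      by_contra hnm
      have h1 : infDist y C ≤ (1 / 2) ^ n := (htA n hn).2.2
      have h2 : ((1 / 2) ^ n : ℝ) ≤ (1 / 2) ^ m :=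
        pow_le_pow_of_le_one (by norm_num) (by norm_num) (not_lt.1 hnm)
      have := hfar y hyz
      linarith
    · refine eq_empty_iff_forall_notMem.2 fun y hy => ?_
      have h1 := hfar y hy.2
      rw [infDist_zero_of_mem hy.1] at h1
      linarith
  have hiso : ∀ z ∉ C, ∃ r > 0, (C ∪ ⋃ n, t n) ∩ ball z r ⊆ {z} := by
    intro z hz
    obtain ⟨r, hr, hf, he⟩ := hfin z hz
    have hop : IsOpen (((⋃ n, t n) ∩ ball z r) \ {z})ᶜ := hf.sdiff.isClosed.isOpen_compl
    obtain ⟨r', hr', h'⟩ := Metric.mem_nhds_iff.1 (hop.mem_nhds (x := z) (by simp))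
    refine ⟨min r r', lt_min hr hr', ?_⟩
    rintro y ⟨hy | hy, hyr⟩
    · have : y ∈ C ∩ ball z r := ⟨hy, ball_subset_ball (min_le_left _ _) hyr⟩
      rw [he] at this
      exact this.elim
    · by_contra hyz
      exact h' (ball_subset_ball (min_le_right _ _) hyr)
        ⟨⟨hy, ball_subset_ball (min_le_left _ _) hyr⟩, hyz⟩
  have hNR : C ∪ ⋃ n, t n ⊆ R := union_subset hCR (iUnion_subset fun n => (htA n).trans
    inter_subset_left)
  refine ⟨C ∪ ⋃ n, t n, subset_union_left, hNR, hR.of_isClosed_subset ?_ hNR, hiso, ?_⟩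
  · refine isOpen_compl_iff.1 (Metric.isOpen_iff.2 fun z hz => ?_)
    obtain ⟨r, hr, h⟩ := hiso z fun h => hz (Or.inl h)
    refine ⟨r, hr, fun y hy hyN => ?_⟩
    obtain rfl : y = z := h ⟨hyN, hy⟩
    exact hz hyN
  · intro x hx hx1
    by_cases hxC : x ∈ C
    · exact ⟨x, Or.inl hxC, by simp [sq_nonneg]⟩
    have hd : 0 < infDist x C := (hC.isClosed.notMem_iff_infDist_pos hne).1 hxC
    obtain ⟨n, hn1, hn2⟩ := exists_nat_pow_near_of_lt_one hd hx1.le (by norm_num : (0 : ℝ) < 1 / 2)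
      (by norm_num)
    obtain ⟨s, hs, hsx⟩ := mem_iUnion₂.1 (hcov n ⟨hx, hn1.le, hn2⟩)
    refine ⟨s, Or.inr (mem_iUnion.2 ⟨n, hs⟩), ?_⟩
    rw [dist_comm]
    exact (mem_ball.1 hsx).le.trans (pow_le_pow_left₀ (by positivity) hn1.le 2)

/-- A compact subset `C` of a polyhedron `X` has a compact superset `N` in `X`, with isolated
points outside `C`, such that all compact subpolyhedra containing `N` are neighbourhoods of `C`. -/
theorem IsPolyhedron.exists_surrounding_set (hX : IsPolyhedron X) (hC : IsCompact C)
    (hne : C.Nonempty) (hCX : C ⊆ X) :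
    ∃ N, C ⊆ N ∧ N ⊆ X ∧ IsCompact N ∧ (∀ z ∉ C, ∃ r > 0, N ∩ ball z r ⊆ {z}) ∧
      ∀ D, IsCompactPolyhedron D → N ⊆ D → ∀ z ∈ C, D ∈ 𝓝[X] z := by
  obtain ⟨R, hRX, hR, hRn⟩ := hX.exists_compact_nhds hC hCX
  obtain ⟨N, h1, h2, h3, h4, h5⟩ := exists_fast_net hC hne hR.isCompact
    fun z hz => mem_of_mem_nhdsWithin (hCX hz) (hRn z hz)
  refine ⟨N, h1, h2.trans hRX, h3, h4, fun D hD hND z hz => ?_⟩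
  refine hD.mem_nhdsWithin_of_net hX.locStar (hCX hz) hz ?_ hND
  filter_upwards [hRn z hz, mem_nhdsWithin_of_mem_nhds (ball_mem_nhds z one_pos)] with x hx hx1
  exact h5 x hx ((infDist_le_dist_of_mem hz).trans_lt (mem_ball.1 hx1))

end Cone

/-! ### Functors from path classes to a group -/

section Functors

variable {M G : Type*} [TopologicalSpace M] [Group G]

/-- Multiplicativity of a function on the path classes between points of a set. -/
def IsPathFunctor {B : Set M} (θ : ∀ x y : B, PathClass (x : M) y → G) : Prop :=
  ∀ x y z p q, θ x z (p.trans q) = θ x y p * θ y z q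

theorem IsPathFunctor.refl {B : Set M} {θ : ∀ x y : B, PathClass (x : M) y → G}
    (h : IsPathFunctor θ) (x : B) : θ x x (Path.Homotopic.Quotient.refl _) = 1 := by
  have := h x x x (Path.Homotopic.Quotient.refl _) (Path.Homotopic.Quotient.refl _)
  simpa using this

theorem IsPathFunctor.symm {B : Set M} {θ : ∀ x y : B, PathClass (x : M) y → G}
    (h : IsPathFunctor θ) (x y : B) (p : PathClass (x : M) y) :
    θ y x p.symm = (θ x y p)⁻¹ := by
  rw [eq_inv_iff_mul_eq_one, ← h, Path.Homotopic.Quotient.symm_trans, h.refl]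

/-- A functor on the path classes between points of `B` extends to all path classes. -/
theorem exists_functor_extension {Y : Type*} [TopologicalSpace Y] (φ : C(M, Y)) {B : Set M}
    {θ : ∀ x y : B, PathClass (x : M) y → G} (hθ : IsPathFunctor θ)
    (hφ : ∀ (x y : B) (p q : PathClass (x : M) y), p.map φ = q.map φ → θ x y p = θ x y q) :
    ∃ Θ : ∀ x y : M, PathClass x y → G,
      (∀ x y z p q, Θ x z (p.trans q) = Θ x y p * Θ y z q) ∧
      (∀ x y (p q : PathClass x y), p.map φ = q.map φ → Θ x y p = Θ x y q) ∧
      ∀ (x y : B) (p : PathClass (x : M) y), Θ x y p = θ x y p := by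
  classical
  -- Reach `x` by a path from `B`, with trivial value under `θ` if `x ∈ B`, so that the extension
  -- restricts to `θ`. Components that miss `B` get the value 1.
  have hfr : ∀ x : M, (∃ d : B, Joined (d : M) x) → ∃ (d : B) (p : PathClass (d : M) x),
      ∀ hx : x ∈ B, θ d ⟨x, hx⟩ p = 1 := by
    rintro x ⟨d, hd⟩
    by_cases hx : x ∈ B
    · exact ⟨⟨x, hx⟩, Path.Homotopic.Quotient.refl _, fun _ => hθ.refl ⟨x, hx⟩⟩
    · exact ⟨d, (PathClass.nonempty_of_joined hd).some, fun h => absurd h hx⟩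
  choose r f hf using hfr
  have hjoin : ∀ {x y : M}, PathClass x y → (∃ d : B, Joined (d : M) x) →
      ∃ d : B, Joined (d : M) y := fun q ⟨d, hd⟩ => ⟨d, hd.trans q.joined⟩
  let Θ : ∀ x y : M, PathClass x y → G := fun x y q =>
    if h : ∃ d : B, Joined (d : M) x then
      θ (r x h) (r y (hjoin q h)) ((f x h).trans (q.trans (f y (hjoin q h)).symm)) else 1
  refine ⟨Θ, fun x y z p q => ?_, fun x y p q hpq => ?_, fun x y p => ?_⟩
  · by_cases h : ∃ d : B, Joined (d : M) x
    · have h' := hjoin p h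
      simp only [Θ, dif_pos h, dif_pos h']
      rw [← hθ]
      congr 1
      simp only [Path.Homotopic.Quotient.trans_assoc, PathClass.symm_trans_cancel_left]
    · have h' : ¬ ∃ d : B, Joined (d : M) y := fun h' => h (hjoin p.symm h')
      simp only [Θ, dif_neg h, dif_neg h', mul_one]
  · by_cases h : ∃ d : B, Joined (d : M) x
    · simp only [Θ, dif_pos h]
      refine hφ _ _ _ _ ?_
      rw [map_trans, map_trans, map_trans, map_trans, hpq]
    · simp only [Θ, dif_neg h]
  · have h : ∃ d : B, Joined (d : M) x := ⟨x, Joined.refl _⟩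
    have h' := hjoin p h
    simp only [Θ, dif_pos h]
    rw [hθ _ x _, hθ _ y _, hf x h x.2, hθ.symm, hf y h' y.2]
    simp

theorem path_functor_congr {c : ∀ x y : M, PathClass x y → G}
    (hc : ∀ x y (p q : PathClass x y), c x y p = c x y q) {w w' x : M} (h : w = w')
    (p : PathClass w x) (q : PathClass w' x) : c w x p = c w' x q := by
  subst h
  exact hc _ _ _ _

/-- A functor with trivial holonomy is a coboundary, with prescribed values on a set where they are
compatible. -/
theorem exists_coboundary {c : ∀ x y : M, PathClass x y → G}
    (hmul : ∀ x y z p q, c x z (p.trans q) = c x y p * c y z q)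
    (hc : ∀ x y (p q : PathClass x y), c x y p = c x y q) (B : Set M) (k : M → G)
    (hk : ∀ x ∈ B, ∀ y ∈ B, ∀ q : PathClass x y, k y = k x * c x y q) :
    ∃ h : M → G, (∀ x y (q : PathClass x y), h y = h x * c x y q) ∧ ∀ x ∈ B, h x = k x := by
  classical
  -- One base point per path component, in `B` whenever possible, so that `k` normalises the
  -- primitive there.
  have hρ : ∃ ρ : M → M, (∀ x, Joined (ρ x) x) ∧ (∀ x y, Joined x y → ρ x = ρ y) ∧
      ∀ x ∈ B, ρ x ∈ B := by
    have hcomp : ∀ S : Set M, S.Nonempty → ∃ w ∈ S, (S ∩ B).Nonempty → w ∈ B := by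
      rintro S ⟨x, hx⟩
      by_cases h : (S ∩ B).Nonempty
      · exact ⟨h.some, h.some_mem.1, fun _ => h.some_mem.2⟩
      · exact ⟨x, hx, fun h' => absurd h' h⟩
    choose w hw hwB using hcomp
    refine ⟨fun x => w (pathComponent x) ⟨x, mem_pathComponent_self x⟩, fun x => ?_,
      fun x y h => ?_, fun x hx => ?_⟩
    · exact (hw _ ⟨x, mem_pathComponent_self x⟩).symm
    · simp only [pathComponent_congr (mem_pathComponent_iff.2 h.symm)]
    · exact hwB _ ⟨x, mem_pathComponent_self x⟩ ⟨x, mem_pathComponent_self x, hx⟩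
  obtain ⟨ρ, hρ1, hρ2, hρ3⟩ := hρ
  have q : ∀ x, PathClass (ρ x) x := fun x => (PathClass.nonempty_of_joined (hρ1 x)).some
  refine ⟨fun x => (if ρ x ∈ B then k (ρ x) else 1) * c (ρ x) x (q x), fun x y p => ?_,
    fun x hx => ?_⟩
  · have e := hρ2 x y p.joined
    simp only [← e]
    rw [mul_assoc, ← hmul, path_functor_congr hc e.symm (q y) ((q x).trans p)]
  · simp only [if_pos (hρ3 x hx)]
    exact (hk _ (hρ3 x hx) _ hx _).symm

end Functors

/-! ### Local systems and small content -/

section GridCocycle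

variable {E : Type*} [NormedAddCommGroup E] [NormedSpace ℝ E] {G : Type*} [Group G]
  {Z L : Set E} {𝒰 : Set (Set E)}

theorem functor_seg_of_eq {ϑ : ∀ x y : L, PathClass x y → G}
    (hϑ : ∀ x y z p q, ϑ x z (p.trans q) = ϑ x y p * ϑ y z q) {x y : L} (e : x = y)
    (h : segment ℝ (x : E) y ⊆ L) : ϑ x y (seg x y h) = 1 := by
  subst e
  have := hϑ x x x (seg x x h) (seg x x h)
  rw [seg_trans_of_eq rfl rfl h h h] at this
  simpa using this

/-- A local system on the loops of `L` that extends to a locally defined cocycle on `Z` is trivial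
on loops that are null-homotopic in `Z`. -/
theorem NullGrid.functor_eq_one {y : L} {g : PathClass y y} (N : NullGrid Z L 𝒰 g)
    {θ : E → E → G}
    (hθ : ∀ u ∈ 𝒰, ∀ x y z, convexHull ℝ {x, y, z} ⊆ Z ∩ u → θ x y * θ y z = θ x z)
    {ϑ : ∀ x y : L, PathClass x y → G}
    (hϑ : ∀ x y z p q, ϑ x z (p.trans q) = ϑ x y p * ϑ y z q)
    (hθϑ : ∀ u ∈ 𝒰, ∀ (x y : L) (h : segment ℝ (x : E) y ⊆ L), segment ℝ (x : E) y ⊆ Z ∩ u →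
      θ x y = ϑ x y (seg x y h)) : ϑ y y g = 1 := by
  have tri : ∀ {p q r : E}, SmallTriangle Z 𝒰 p q r → ∀ x ∈ ({p, q, r} : Set E),
      ∀ y ∈ ({p, q, r} : Set E), ∀ z ∈ ({p, q, r} : Set E), θ x y * θ y z = θ x z := by
    rintro p q r ⟨u, hu, h⟩ x hx y hy z hz
    refine hθ u hu x y z (Subset.trans (convexHull_mono ?_) h)
    rintro _ (rfl | rfl | rfl) <;> assumption
  have sq := square_of_triangles (Q := SmallTriangle Z 𝒰) (fun h => h.rotate) (fun h => h.swap)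
    N.tri_h N.tri_v
  have one : ∀ {p q r : E}, SmallTriangle Z 𝒰 p q r → θ p p = 1 := by
    intro p q r h
    have := tri h p (by simp) p (by simp) p (by simp)
    simpa using this
  have inv : ∀ {p q r : E}, SmallTriangle Z 𝒰 p q r → θ q p = (θ p q)⁻¹ := by
    intro p q r h
    have := tri h p (by simp) q (by simp) p (by simp)
    rw [one h] at this
    exact eq_inv_of_mul_eq_one_right this
  have hy : θ (y : E) y = 1 := by
    rcases sq 0 0 with ⟨h, -⟩ | ⟨h, -⟩
    · have := one h
      rwa [N.boundary 0 0 (Or.inl rfl)] at this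
    · have := one h.rotate
      rwa [N.boundary 0 0 (Or.inl rfl)] at this
  -- Integrate the cocycle over the grid, starting from `ϑ` on the bottom polygon. The three
  -- constant sides contribute nothing, so the value at the end of the bottom row, `ϑ y y g`, equals
  -- the initial value 1.
  obtain ⟨t, ht0, hth, htv⟩ := exists_grid_section (T := fun _ _ => G)
    (fun a b x => x * θ (N.w a b) (N.w (a + 1) b)) (fun a b x => x * θ (N.w a b) (N.w a (b + 1)))
    (fun a b x => by
      rw [mul_assoc, mul_assoc]
      congr 1
      rcases sq a b with ⟨h, h'⟩ | ⟨h, h'⟩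
      · rw [tri h _ (by simp) _ (by simp) _ (by simp), tri h' _ (by simp) _ (by simp) _ (by simp)]
      · have e1 := tri h (N.w (a + 1) b) (by simp) (N.w a b) (by simp) (N.w a (b + 1)) (by simp)
        have e2 := tri h' (N.w (a + 1) b) (by simp) (N.w (a + 1) (b + 1)) (by simp)
          (N.w a (b + 1)) (by simp)
        have e3 := inv h
        have e4 := inv (h'.rotate)
        rw [e3, e4, inv_mul_eq_iff_eq_mul, ← mul_assoc, e1, ← e2, mul_inv_cancel_right])
    (fun a => ϑ _ _ (N.τ a)) (fun a => by
      rw [← N.τ_succ a, hϑ]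
      congr 1
      rcases sq a 0 with ⟨⟨u, hu, h⟩, -⟩ | ⟨⟨u, hu, h⟩, -⟩
      · refine hθϑ u hu ⟨_, N.bot_mem a⟩ ⟨_, N.bot_mem (a + 1)⟩ (N.bot_seg a)
          (Subset.trans ?_ h)
        exact segment_subset_convexHull (by simp) (by simp)
      · refine hθϑ u hu ⟨_, N.bot_mem a⟩ ⟨_, N.bot_mem (a + 1)⟩ (N.bot_seg a)
          (Subset.trans ?_ h)
        exact segment_subset_convexHull (by simp) (by simp))
  have hcol : ∀ a, (a = 0 ∨ 2 * N.n ≤ a) → ∀ b, t a b = t a 0 := by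
    intro a ha b
    induction b with
    | zero => rfl
    | succ b ih =>
      rw [← htv, N.boundary a b (by tauto), N.boundary a (b + 1) (by tauto), hy, mul_one, ih]
  have hrow : ∀ a, t a (2 * N.n) = t 0 (2 * N.n) := by
    intro a
    induction a with
    | zero => rfl
    | succ a ih =>
      rw [← hth, N.boundary a _ (Or.inr (Or.inr le_rfl)),
        N.boundary (a + 1) _ (Or.inr (Or.inr le_rfl)), hy, mul_one, ih]
  have e : ∀ a, (a = 0 ∨ 2 * N.n ≤ a) → y = ⟨N.w a 0, N.bot_mem a⟩ := fun a ha =>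
    Subtype.ext (N.boundary a 0 (by tauto)).symm
  have hs : ∀ a, (a = 0 ∨ 2 * N.n ≤ a) → segment ℝ (y : E) (N.w a 0) ⊆ L := fun a ha => by
    rw [N.boundary a 0 (by tauto), segment_same]
    exact singleton_subset_iff.2 y.2
  have h1 : t 0 0 = 1 := by
    rw [ht0, N.τ_zero (hs 0 (Or.inl rfl)), functor_seg_of_eq hϑ (e 0 (Or.inl rfl))]
  have h2 : t (2 * N.n) 0 = ϑ y y g := by
    rw [ht0, N.τ_last (hs _ (Or.inr le_rfl)), hϑ, functor_seg_of_eq hϑ (e _ (Or.inr le_rfl)),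
      mul_one]
  rw [← h2, ← hcol _ (Or.inr le_rfl) (2 * N.n), hrow, hcol 0 (Or.inl rfl), h1]

end GridCocycle

/-! ### The local system that kills loops, and its extension over a complement -/

section SmallContent

variable {E : Type*} [NormedAddCommGroup E] [NormedSpace ℝ E]

/-- Closing up paths by chosen paths from `b` turns the quotient map of the fundamental group into a
functor on path classes. The opposite group corrects for the order of multiplication in
`FundamentalGroup`. -/
theorem exists_killing_functor {X C L : Set E} (hLX : L ⊆ X) (b : L)
    (hb : ∀ x, Nonempty (PathClass b x)) :
    ∃ ϑ : ∀ x y : L, PathClass x y →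
        (FundamentalGroup L b ⧸ Subgroup.normalClosure (killedLoops C hLX b))ᵐᵒᵖ,
      (∀ x y z p q, ϑ x z (p.trans q) = ϑ x y p * ϑ y z q) ∧
      (∀ g : PathClass b b, ϑ b b g = 1 →
        (g : FundamentalGroup L b) ∈ Subgroup.normalClosure (killedLoops C hLX b)) ∧
      ∀ (x : ↥(L \ C)) (δ : PathClass x x),
        PathClass.incl (sdiff_subset_sdiff_left hLX : L \ C ⊆ X \ C) δ =
          Path.Homotopic.Quotient.refl _ →
        ϑ ⟨x.1, x.2.1⟩ ⟨x.1, x.2.1⟩ (PathClass.incl sdiff_subset δ) = 1 := by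
  have f := fun x => (hb x).some
  let N := Subgroup.normalClosure (killedLoops C hLX b)
  let κ : ∀ x y : L, PathClass x y → FundamentalGroup L b :=
    fun x y p => (f x).trans (p.trans (f y).symm)
  have hκ : ∀ x y z p q, κ x z (p.trans q) = κ y z q * κ x y p := by
    intro x y z p q
    change (f x).trans ((p.trans q).trans (f z).symm) =
      ((f x).trans (p.trans (f y).symm)).trans ((f y).trans (q.trans (f z).symm))
    simp only [Path.Homotopic.Quotient.trans_assoc, PathClass.symm_trans_cancel_left]
  refine ⟨fun x y p => MulOpposite.op (QuotientGroup.mk (κ x y p)), ?_, ?_, ?_⟩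
  · intro x y z p q
    beta_reduce
    rw [hκ, QuotientGroup.mk_mul, MulOpposite.op_mul]
  · intro g hg
    have h1 : (QuotientGroup.mk (κ b b g) : FundamentalGroup L b ⧸ N) = 1 :=
      MulOpposite.op_injective hg
    rw [QuotientGroup.eq_one_iff] at h1
    -- The chosen path `f b` may be a nontrivial loop; normality absorbs conjugation by it.
    let φ : FundamentalGroup L b := f b
    let γ : FundamentalGroup L b := g
    have h2 : κ b b g = φ⁻¹ * γ * φ := rfl
    have h3 := (inferInstance : N.Normal).conj_mem _ h1 φ
    have h4 : φ * (φ⁻¹ * γ * φ) * φ⁻¹ = γ := by group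
    rw [h2, h4] at h3
    exact h3
  · intro x δ hδ
    rw [← MulOpposite.op_one]
    refine congrArg MulOpposite.op ((QuotientGroup.eq_one_iff _).2 ?_)
    refine Subgroup.subset_normalClosure ?_
    exact ⟨x, δ, f _, hδ, rfl⟩

variable {X C C₁ D D' : Set E} {G : Type*} [Group G] {ϑ : ∀ x y : D, PathClass x y → G}

/-- On `D \ C` the functor sees only classes in `X \ C`: paths that agree there differ by a killed
loop. -/
theorem killing_functor_congr (hDX : D ⊆ X)
    (hmul : ∀ x y z p q, ϑ x z (p.trans q) = ϑ x y p * ϑ y z q)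
    (hkill : ∀ (x : ↥(D \ C)) (δ : PathClass x x),
        PathClass.incl (sdiff_subset_sdiff_left hDX : D \ C ⊆ X \ C) δ =
          Path.Homotopic.Quotient.refl _ →
        ϑ ⟨x.1, x.2.1⟩ ⟨x.1, x.2.1⟩ (PathClass.incl sdiff_subset δ) = 1)
    {x y : ↥(D \ C)} (p q : PathClass x y)
    (h : PathClass.incl (sdiff_subset_sdiff_left hDX : D \ C ⊆ X \ C) p =
      PathClass.incl (sdiff_subset_sdiff_left hDX) q) :
    ϑ ⟨x.1, x.2.1⟩ ⟨y.1, y.2.1⟩ (PathClass.incl sdiff_subset p) =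
      ϑ ⟨x.1, x.2.1⟩ ⟨y.1, y.2.1⟩ (PathClass.incl sdiff_subset q) := by
  have h1 := hkill x (p.trans q.symm) (by
    rw [PathClass.incl_trans, PathClass.incl_symm, h]
    simp)
  have h2 : PathClass.incl (sdiff_subset : D \ C ⊆ D) p =
      (PathClass.incl (sdiff_subset : D \ C ⊆ D) (p.trans q.symm)).trans
        (PathClass.incl sdiff_subset q) := by
    rw [PathClass.incl_trans, PathClass.incl_symm]
    simp [Path.Homotopic.Quotient.trans_assoc]
  rw [h2, hmul, h1, one_mul]

/-- If paths in `D' \ C₁` between points of `D` can be pushed into `D \ C₁`, a functor on the path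
classes of `D` extends over `D' \ C₁`. -/
theorem exists_complement_functor (hC : C ⊆ C₁) (hDD : D ⊆ D') (hD'X : D' ⊆ X)
    (hmul : ∀ x y z p q, ϑ x z (p.trans q) = ϑ x y p * ϑ y z q)
    (hkill : ∀ (x : ↥(D \ C)) (δ : PathClass x x),
        PathClass.incl (sdiff_subset_sdiff_left (hDD.trans hD'X) : D \ C ⊆ X \ C) δ =
          Path.Homotopic.Quotient.refl _ →
        ϑ ⟨x.1, x.2.1⟩ ⟨x.1, x.2.1⟩ (PathClass.incl sdiff_subset δ) = 1)
    (hrep : ∀ (x y : ↥(D \ C₁)) (q : PathClass (⟨x, hDD x.2.1, x.2.2⟩ : ↥(D' \ C₁))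
        ⟨y, hDD y.2.1, y.2.2⟩), ∃ p : PathClass x y,
        PathClass.incl (sdiff_subset_sdiff (hDD.trans hD'X) hC : D \ C₁ ⊆ X \ C) p =
          PathClass.incl (sdiff_subset_sdiff hD'X hC) q) :
    ∃ Θ : ∀ x y : ↥(D' \ C₁), PathClass x y → G,
      (∀ x y z p q, Θ x z (p.trans q) = Θ x y p * Θ y z q) ∧
      (∀ x y (p q : PathClass x y),
        PathClass.incl (sdiff_subset_sdiff hD'X hC : D' \ C₁ ⊆ X \ C) p =
          PathClass.incl (sdiff_subset_sdiff hD'X hC) q → Θ x y p = Θ x y q) ∧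
      ∀ (x y : ↥(D' \ C₁)) (hx : x.1 ∈ D) (hy : y.1 ∈ D) (q : PathClass x y)
        (p : PathClass (⟨x.1, hx, fun h => x.2.2 (hC h)⟩ : ↥(D \ C))
          ⟨y.1, hy, fun h => y.2.2 (hC h)⟩),
        PathClass.incl (sdiff_subset_sdiff_left (hDD.trans hD'X) : D \ C ⊆ X \ C) p =
          PathClass.incl (sdiff_subset_sdiff hD'X hC) q →
        Θ x y q = ϑ ⟨x.1, hx⟩ ⟨y.1, hy⟩ (PathClass.incl sdiff_subset p) := by
  have hW := @killing_functor_congr E _ _ X C D G _ ϑ (hDD.trans hD'X) hmul hkill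
  let B : Set ↥(D' \ C₁) := {x | x.1 ∈ D}
  choose P hP using fun (x y : B) (q : PathClass (x : ↥(D' \ C₁)) y) =>
    hrep ⟨x.1.1, x.2, x.1.2.2⟩ ⟨y.1.1, y.2, y.1.2.2⟩ q
  -- Push the path into `D \ C₁` and evaluate `ϑ`. The choice does not matter, by `hW`.
  let θ : ∀ x y : B, PathClass (x : ↥(D' \ C₁)) y → G := fun x y q =>
    ϑ ⟨x.1.1, x.2⟩ ⟨y.1.1, y.2⟩ (PathClass.incl sdiff_subset (P x y q))
  have hDC : D \ C₁ ⊆ D \ C := sdiff_subset_sdiff_right hC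
  have key : ∀ (x y : B) (q : PathClass (x : ↥(D' \ C₁)) y)
      (p : PathClass (⟨x.1.1, x.2, fun h => x.1.2.2 (hC h)⟩ : ↥(D \ C))
          ⟨y.1.1, y.2, fun h => y.1.2.2 (hC h)⟩),
      PathClass.incl (sdiff_subset_sdiff_left (hDD.trans hD'X) : D \ C ⊆ X \ C) p =
          PathClass.incl (sdiff_subset_sdiff hD'X hC) q →
      θ x y q = ϑ ⟨x.1.1, x.2⟩ ⟨y.1.1, y.2⟩ (PathClass.incl sdiff_subset p) := by
    intro x y q p h
    have h1 := hW (PathClass.incl hDC (P x y q)) p (by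
      rw [PathClass.incl_incl, h]
      exact hP x y q)
    rw [PathClass.incl_incl] at h1
    exact h1
  obtain ⟨Θ, h1, h2, h3⟩ := exists_functor_extension
    (⟨inclusion (sdiff_subset_sdiff hD'X hC : D' \ C₁ ⊆ X \ C), continuous_inclusion _⟩ :
      C(↥(D' \ C₁), ↥(X \ C))) (θ := θ) (by
    intro x y z p q
    rw [key x z (p.trans q) ((PathClass.incl hDC (P x y p)).trans (PathClass.incl hDC (P y z q))) (by
      rw [PathClass.incl_trans, PathClass.incl_incl, PathClass.incl_incl, PathClass.incl_trans]
      exact congrArg₂ Path.Homotopic.Quotient.trans (hP x y p) (hP y z q))]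
    rw [PathClass.incl_trans, hmul, PathClass.incl_incl, PathClass.incl_incl]) (by
    intro x y p q h
    rw [key x y p (PathClass.incl hDC (P x y q)) (by
      rw [PathClass.incl_incl]
      exact (hP x y q).trans h.symm), PathClass.incl_incl])
  exact ⟨Θ, h1, h2, fun x y hx hy q p h => (h3 ⟨x, hx⟩ ⟨y, hy⟩ q).trans (key ⟨x, hx⟩ ⟨y, hy⟩ q p h)⟩

theorem PathClass.eq_of_starConvex {V : Set E} {z : E} (hV : StarConvex ℝ z V) {x y : V}
    (p q : PathClass x y) : p = q := by
  have : ContractibleSpace V := hV.contractibleSpace ⟨_, x.2⟩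
  exact Subsingleton.elim p q

end SmallContent

/-! ### Trivialising the local systems on a star -/

section StarCoboundary

variable {E : Type*} [NormedAddCommGroup E] [NormedSpace ℝ E]
variable {X C C₁ D D' : Set E} {G : Type*} [Group G] {ϑ : ∀ x y : D, PathClass x y → G}
  {Θ : ∀ x y : ↥(D' \ C₁), PathClass x y → G}

/-- On a star `V` about a point of `D` outside `C`, the local systems on `D` and on `D' \ C₁`
are the coboundary of a function. -/
theorem exists_star_coboundary (hC : C ⊆ C₁) (hDD : D ⊆ D') (hD'X : D' ⊆ X)
    (hmul : ∀ x y z p q, ϑ x z (p.trans q) = ϑ x y p * ϑ y z q)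
    (hW : ∀ (x y : ↥(D \ C)) (p q : PathClass x y),
      PathClass.incl (sdiff_subset_sdiff_left (hDD.trans hD'X) : D \ C ⊆ X \ C) p =
        PathClass.incl (sdiff_subset_sdiff_left (hDD.trans hD'X)) q →
      ϑ ⟨x.1, x.2.1⟩ ⟨y.1, y.2.1⟩ (PathClass.incl sdiff_subset p) =
        ϑ ⟨x.1, x.2.1⟩ ⟨y.1, y.2.1⟩ (PathClass.incl sdiff_subset q))
    (hrep : ∀ (x y : ↥(D \ C₁)) (q : PathClass (⟨x, hDD x.2.1, x.2.2⟩ : ↥(D' \ C₁))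
        ⟨y, hDD y.2.1, y.2.2⟩), ∃ p : PathClass x y,
        PathClass.incl (sdiff_subset_sdiff (hDD.trans hD'X) hC : D \ C₁ ⊆ X \ C) p =
          PathClass.incl (sdiff_subset_sdiff hD'X hC) q)
    (hΘ : ∀ x y z p q, Θ x z (p.trans q) = Θ x y p * Θ y z q)
    (hΘ2 : ∀ x y (p q : PathClass x y),
        PathClass.incl (sdiff_subset_sdiff hD'X hC : D' \ C₁ ⊆ X \ C) p =
          PathClass.incl (sdiff_subset_sdiff hD'X hC) q → Θ x y p = Θ x y q)
    (hΘ3 : ∀ (x y : ↥(D' \ C₁)) (hx : x.1 ∈ D) (hy : y.1 ∈ D) (q : PathClass x y)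
        (p : PathClass (⟨x.1, hx, fun h => x.2.2 (hC h)⟩ : ↥(D \ C))
          ⟨y.1, hy, fun h => y.2.2 (hC h)⟩),
        PathClass.incl (sdiff_subset_sdiff_left (hDD.trans hD'X) : D \ C ⊆ X \ C) p =
          PathClass.incl (sdiff_subset_sdiff hD'X hC) q →
        Θ x y q = ϑ ⟨x.1, hx⟩ ⟨y.1, hy⟩ (PathClass.incl sdiff_subset p))
    {V : Set E} {z : E} (hzD : z ∈ D) (hVD' : V ⊆ D') (hV : StarConvex ℝ z V)
    (hVD : StarConvex ℝ z (D ∩ V)) (hVC : Disjoint V C) (hVC₁ : V ∩ C₁ ⊆ {z}) (hzV : z ∈ V) :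
    ∃ H : E → G,
      (∀ (x y : ↥(D' \ C₁)) (h : segment ℝ (x : E) y ⊆ D' \ C₁), segment ℝ (x : E) y ⊆ V \ {z} →
        Θ x y (seg x y h) = (H x)⁻¹ * H y) ∧
      ∀ (x y : D) (h : segment ℝ (x : E) y ⊆ D), segment ℝ (x : E) y ⊆ V →
        ϑ x y (seg x y h) = (H x)⁻¹ * H y := by
  classical
  have hT : V \ {z} ⊆ D' \ C₁ := fun x hx => ⟨hVD' hx.1, fun h => hx.2 (hVC₁ ⟨hx.1, h⟩)⟩
  have hVX : V ⊆ X \ C := fun x hx => ⟨hD'X (hVD' hx), disjoint_left.1 hVC hx⟩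
  have hTV : V \ {z} ⊆ V := sdiff_subset
  have hDC : D \ C₁ ⊆ D \ C := sdiff_subset_sdiff_right hC
  have hrad : ∀ x ∈ D ∩ V, segment ℝ z x ⊆ D ∩ V := fun x hx =>
    starConvex_iff_segment_subset.1 hVD hx
  have hDVC : D ∩ V ⊆ D \ C := fun x hx => ⟨hx.1, disjoint_left.1 hVC hx.2⟩
  let c : ∀ x y : ↥(V \ {z}), PathClass x y → G := fun x y p => Θ _ _ (PathClass.incl hT p)
  let k₀ : ∀ x, x ∈ D ∩ V → G := fun x hx =>
    ϑ ⟨z, hzD⟩ ⟨x, hx.1⟩ (seg ⟨z, hzD⟩ ⟨x, hx.1⟩ ((hrad x hx).trans inter_subset_left))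
  let k : ↥(V \ {z}) → G := fun x => if h : (x : E) ∈ D then k₀ x ⟨h, x.2.1⟩ else 1
  -- `Θ` has no holonomy on `V \ {z}`, as it depends only on classes in `X \ C`, where the star `V`
  -- is contractible. Since `V \ {z}` may be disconnected, the primitive is normalised at points of
  -- `D` by `ϑ` along the radius from `z`. These values fit with `Θ`: by `hrep` a path between two
  -- such points can be moved into `D \ C₁`, and following one radius by it gives the class of the
  -- other radius in `X \ C`.
  obtain ⟨h, hh, hhk⟩ := exists_coboundary (c := c) (fun x y w p q => by
      simp only [c]
      rw [PathClass.incl_trans, hΘ]) (fun x y p q => by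
      refine hΘ2 _ _ _ _ ?_
      rw [PathClass.incl_incl, PathClass.incl_incl]
      have := congrArg (PathClass.incl hVX)
        (PathClass.eq_of_starConvex hV (PathClass.incl hTV p) (PathClass.incl hTV q))
      rw [PathClass.incl_incl, PathClass.incl_incl] at this
      exact this) {x | (x : E) ∈ D} k (by
      intro x hx y hy q
      have hx' : (x : E) ∈ D := hx
      have hy' : (y : E) ∈ D := hy
      simp only [k, dif_pos hx', dif_pos hy']
      obtain ⟨P, hP⟩ := hrep ⟨x, hx, (hT x.2).2⟩ ⟨y, hy, (hT y.2).2⟩ (PathClass.incl hT q)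
      have e1 : c x y q = ϑ ⟨x, hx⟩ ⟨y, hy⟩ (PathClass.incl sdiff_subset (PathClass.incl hDC P)) :=
        hΘ3 ⟨x, hT x.2⟩ ⟨y, hT y.2⟩ hx' hy' _ (PathClass.incl hDC P)
          (by rw [PathClass.incl_incl]; exact hP)
      have sx := (hrad x ⟨hx, x.2.1⟩).trans hDVC
      have sy := (hrad y ⟨hy, y.2.1⟩).trans hDVC
      let z' : ↥(D \ C) := ⟨z, hDVC ⟨hzD, hzV⟩⟩
      have e2 := hW z' ⟨y, hDVC ⟨hy, y.2.1⟩⟩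
        ((seg z' ⟨x, hDVC ⟨hx, x.2.1⟩⟩ sx).trans (PathClass.incl hDC P)) (seg z' _ sy) (by
        rw [PathClass.incl_trans, PathClass.incl_incl]
        have e3 := congrArg (PathClass.incl hVX) (PathClass.eq_of_starConvex hV
          ((seg ⟨z, hzV⟩ ⟨x, x.2.1⟩ ((hrad x ⟨hx, x.2.1⟩).trans inter_subset_right)).trans
            (PathClass.incl hTV q))
          (seg ⟨z, hzV⟩ ⟨y, y.2.1⟩ ((hrad y ⟨hy, y.2.1⟩).trans inter_subset_right)))
        rw [PathClass.incl_trans, PathClass.incl_incl] at e3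
        refine Eq.trans ?_ e3
        refine congrArg (Path.Homotopic.Quotient.trans _) ?_
        rw [PathClass.incl_incl] at hP
        exact hP)
      rw [PathClass.incl_trans, hmul] at e2
      rw [e1]
      exact e2.symm)
  let H : E → G := fun x => if hx : x ∈ V \ {z} then h ⟨x, hx⟩ else 1
  have hH : ∀ x (hx : x ∈ D ∩ V), H x = k₀ x hx := by
    intro x hx
    by_cases hxz : x = z
    · subst hxz
      simp only [H, k₀]
      rw [dif_neg (by simp), functor_seg_of_eq hmul rfl]
    · have hx' : x ∈ V \ {z} := ⟨hx.2, hxz⟩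
      simp only [H]
      rw [dif_pos hx', hhk _ hx.1]
      simp only [k]
      rw [dif_pos hx.1]
  refine ⟨H, ?_, ?_⟩
  · intro x y hs hsV
    have hx := hsV (left_mem_segment ℝ _ _)
    have hy := hsV (right_mem_segment ℝ _ _)
    simp only [H]
    rw [dif_pos hx, dif_pos hy, hh ⟨x.1, hx⟩ ⟨y.1, hy⟩ (seg ⟨x.1, hx⟩ ⟨y.1, hy⟩ hsV),
      inv_mul_cancel_left]
    rfl
  · intro x y hs hsV
    have hx : (x : E) ∈ D ∩ V := ⟨x.2, hsV (left_mem_segment ℝ _ _)⟩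
    have hy : (y : E) ∈ D ∩ V := ⟨y.2, hsV (right_mem_segment ℝ _ _)⟩
    rw [hH x hx, hH y hy, eq_inv_mul_iff_mul_eq]
    simp only [k₀]
    rw [← hmul, seg_trans_of_starConvex (inter_subset_left : D ∩ V ⊆ D) hVD ⟨z, hzD⟩ x y (hrad x hx)
      (subset_inter hs hsV) (hrad y hy)]

end StarCoboundary

/-! ### Gluing the local systems over `D'` -/

section Cocycle

variable {E : Type*} [NormedAddCommGroup E] [NormedSpace ℝ E]
variable {X C C₁ D D' : Set E}

/-- The main step from small content to the disc complexes: the loops of `D \ C` that are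
null-homotopic in `X \ C` generate the fundamental group of `D` normally. -/
theorem normalClosure_killedLoops_eq_top (hC : C ⊆ C₁) (hC₁ : IsClosed C₁) (hC₁D : C₁ ⊆ D)
    (hDD : D ⊆ D') (hD'X : D' ⊆ X) (hD : LocStar D) (hD' : LocStar D') (b : D)
    (hb : ∀ x, Nonempty (PathClass b x))
    (hrep : ∀ (x y : ↥(D \ C₁)) (q : PathClass (⟨x, hDD x.2.1, x.2.2⟩ : ↥(D' \ C₁))
        ⟨y, hDD y.2.1, y.2.2⟩), ∃ p : PathClass x y,
        PathClass.incl (sdiff_subset_sdiff (hDD.trans hD'X) hC : D \ C₁ ⊆ X \ C) p =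
          PathClass.incl (sdiff_subset_sdiff hD'X hC) q)
    (hnull : ∀ g : PathClass b b, PathClass.incl hDD g = Path.Homotopic.Quotient.refl _)
    (hiso : ∀ z ∉ C, ∃ r > 0, C₁ ∩ ball z r ⊆ {z})
    (hnhds : ∀ z ∈ C, D ∈ 𝓝[D'] z) :
    Subgroup.normalClosure (killedLoops C (hDD.trans hD'X) b) = ⊤ := by
  classical
  obtain ⟨ϑ, hmul, hone, hkill⟩ := exists_killing_functor (C := C) (hDD.trans hD'X) b hb
  have hW := @killing_functor_congr E _ _ X C D _ _ ϑ (hDD.trans hD'X) hmul hkill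
  obtain ⟨Θ, hΘ, hΘ2, hΘ3⟩ := exists_complement_functor hC hDD hD'X hmul hkill hrep
  have hstar : ∀ z : E, z ∈ C₁ → z ∉ C → ∃ (V : Set E) (H : E →
      (FundamentalGroup D b ⧸ Subgroup.normalClosure (killedLoops C (hDD.trans hD'X) b))ᵐᵒᵖ),
      V ∈ 𝓝[D'] z ∧ V ∩ C₁ ⊆ {z} ∧ V ⊆ D' ∧
      (∀ (x y : ↥(D' \ C₁)) (h : segment ℝ (x : E) y ⊆ D' \ C₁), segment ℝ (x : E) y ⊆ V \ {z} →
        Θ x y (seg x y h) = (H x)⁻¹ * H y) ∧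
      ∀ (x y : D) (h : segment ℝ (x : E) y ⊆ D), segment ℝ (x : E) y ⊆ V →
        ϑ x y (seg x y h) = (H x)⁻¹ * H y := by
    intro z hz hzC
    obtain ⟨r₁, hr₁, h₁⟩ := hiso z hzC
    obtain ⟨r₂, hr₂, h₂⟩ := hD z (hC₁D hz)
    obtain ⟨r₃, hr₃, h₃⟩ := hD' z (hDD (hC₁D hz))
    have hr : 0 < min r₁ (min r₂ r₃) := by positivity
    have hVC₁ : (D' ∩ ball z (min r₁ (min r₂ r₃))) ∩ C₁ ⊆ {z} := fun x hx =>
      h₁ ⟨hx.2, ball_subset_ball (min_le_left _ _) hx.1.2⟩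
    have hDV : D ∩ (D' ∩ ball z (min r₁ (min r₂ r₃))) = D ∩ ball z (min r₁ (min r₂ r₃)) := by
      rw [← inter_assoc, inter_eq_left.2 hDD]
    obtain ⟨H, hH1, hH2⟩ := exists_star_coboundary hC hDD hD'X hmul (fun x y => hW) hrep hΘ hΘ2 hΘ3
      (V := D' ∩ ball z (min r₁ (min r₂ r₃))) (hC₁D hz) inter_subset_left
      (h₃.inter_ball_mono hr ((min_le_right _ _).trans (min_le_right _ _)))
      (by
        rw [hDV]
        exact h₂.inter_ball_mono hr ((min_le_right _ _).trans (min_le_left _ _)))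
      (disjoint_left.2 fun x hx hxC => by
        have : x = z := hVC₁ ⟨hx, hC hxC⟩
        exact hzC (this ▸ hxC)) hVC₁ ⟨hDD (hC₁D hz), mem_ball_self hr⟩
    exact ⟨_, H, inter_mem_nhdsWithin _ (ball_mem_nhds z hr), hVC₁, inter_subset_left, hH1, hH2⟩
  choose! V H hVn hVC₁ hVD' hH1 hH2 using hstar
  -- The glued cocycle on segments. That the three definitions agree on overlaps is the content of
  -- `f1`, `f2` and `f3`; in the last case the star is determined by the only point of `C₁` on the
  -- segment.
  let θ : E → E →
      (FundamentalGroup D b ⧸ Subgroup.normalClosure (killedLoops C (hDD.trans hD'X) b))ᵐᵒᵖ :=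
    fun x y =>
      if h : segment ℝ x y ⊆ D then
        ϑ ⟨x, h (left_mem_segment ℝ _ _)⟩ ⟨y, h (right_mem_segment ℝ _ _)⟩ (seg _ _ h)
      else if h : segment ℝ x y ⊆ D' \ C₁ then
        Θ ⟨x, h (left_mem_segment ℝ _ _)⟩ ⟨y, h (right_mem_segment ℝ _ _)⟩ (seg _ _ h)
      else if h : ∃ z, z ∈ C₁ ∧ z ∉ C ∧ segment ℝ x y ⊆ V z then
        (H h.choose x)⁻¹ * H h.choose y
      else 1
  have f1 : ∀ (x y : D) (h : segment ℝ (x : E) y ⊆ D), θ x y = ϑ x y (seg x y h) :=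
    fun x y h => dif_pos h
  have f2 : ∀ (x y : ↥(D' \ C₁)) (h : segment ℝ (x : E) y ⊆ D' \ C₁),
      θ x y = Θ x y (seg x y h) := by
    intro x y h
    by_cases h' : segment ℝ (x : E) y ⊆ D
    · have hx := h' (left_mem_segment ℝ _ _)
      have hy := h' (right_mem_segment ℝ _ _)
      have hs : segment ℝ (x : E) y ⊆ D \ C := fun w hw => ⟨h' hw, fun hwC => (h hw).2 (hC hwC)⟩
      refine (f1 ⟨x.1, hx⟩ ⟨y.1, hy⟩ h').trans ?_
      exact (hΘ3 x y hx hy (seg x y h) (seg (A := D \ C) ⟨x.1, hx, fun h => x.2.2 (hC h)⟩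
        ⟨y.1, hy, fun h => y.2.2 (hC h)⟩ hs) rfl).symm
    · simp only [θ]
      rw [dif_neg h', dif_pos h]
  have f3 : ∀ z, z ∈ C₁ → z ∉ C → ∀ x y, segment ℝ x y ⊆ V z → θ x y = (H z x)⁻¹ * H z y := by
    intro z hz hzC x y hs
    by_cases h1 : segment ℝ x y ⊆ D
    · have hx := h1 (left_mem_segment ℝ _ _)
      have hy := h1 (right_mem_segment ℝ _ _)
      rw [← hH2 z hz hzC ⟨x, hx⟩ ⟨y, hy⟩ h1 hs]
      exact f1 ⟨x, hx⟩ ⟨y, hy⟩ h1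
    by_cases h2 : segment ℝ x y ⊆ D' \ C₁
    · have hx := h2 (left_mem_segment ℝ _ _)
      have hy := h2 (right_mem_segment ℝ _ _)
      rw [← hH1 z hz hzC ⟨x, hx⟩ ⟨y, hy⟩ h2
        fun w hw => ⟨hs hw, fun hwz => (h2 hw).2 (hwz ▸ hz)⟩]
      exact f2 ⟨x, hx⟩ ⟨y, hy⟩ h2
    have h3 : ∃ z, z ∈ C₁ ∧ z ∉ C ∧ segment ℝ x y ⊆ V z := ⟨z, hz, hzC, hs⟩
    simp only [θ]
    rw [dif_neg h1, dif_neg h2, dif_pos h3]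
    obtain ⟨w, hw, hwn⟩ := not_subset.1 h2
    have hwC₁ : w ∈ C₁ := by
      by_contra hwC
      exact hwn ⟨hVD' z hz hzC (hs hw), hwC⟩
    have e1 : w = z := hVC₁ z hz hzC ⟨hs hw, hwC₁⟩
    obtain ⟨g1, g2, g3⟩ := h3.choose_spec
    have e2 : w = h3.choose := hVC₁ _ g1 g2 ⟨g3 hw, hwC₁⟩
    rw [← e2, e1]
  -- `D` is a neighbourhood of the points of `C`, the stars are neighbourhoods of the other points
  -- of `C₁`, and `D' \ C₁` takes care of the rest.
  let 𝒰 : Set (Set E) := {D, D' \ C₁} ∪ V '' {z | z ∈ C₁ ∧ z ∉ C}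
  have h𝒰 : ∀ z ∈ D', ∃ u ∈ 𝒰, u ∈ 𝓝[D'] z := by
    intro z hz
    by_cases hzC₁ : z ∈ C₁
    · by_cases hzC : z ∈ C
      · exact ⟨D, Or.inl (Or.inl rfl), hnhds z hzC⟩
      · exact ⟨V z, Or.inr ⟨z, ⟨hzC₁, hzC⟩, rfl⟩, hVn z hzC₁ hzC⟩
    · exact ⟨D' \ C₁, Or.inl (Or.inr rfl),
        inter_mem_nhdsWithin _ (hC₁.isOpen_compl.mem_nhds hzC₁)⟩
  refine eq_top_iff.2 fun g _ => hone g ?_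
  obtain ⟨N⟩ := exists_nullGrid hD' hD hDD 𝒰 h𝒰 g (hnull g)
  refine N.functor_eq_one (θ := θ) ?_ hmul (fun _ _ x y h _ => f1 x y h)
  intro u hu x y z h
  have hxy : segment ℝ x y ⊆ u := (segment_subset_convexHull (by simp) (by simp)).trans
    (h.trans inter_subset_right)
  have hyz : segment ℝ y z ⊆ u := (segment_subset_convexHull (by simp) (by simp)).trans
    (h.trans inter_subset_right)
  have hxz : segment ℝ x z ⊆ u := (segment_subset_convexHull (by simp) (by simp)).trans
    (h.trans inter_subset_right)
  have hx := hxy (left_mem_segment ℝ _ _)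
  have hy := hyz (left_mem_segment ℝ _ _)
  have hz := hxz (right_mem_segment ℝ _ _)
  have hhull := h.trans inter_subset_right
  rcases hu with (rfl | hu) | ⟨w, ⟨hw, hwC⟩, rfl⟩
  · rw [f1 ⟨x, hx⟩ ⟨y, hy⟩ hxy, f1 ⟨y, hy⟩ ⟨z, hz⟩ hyz, f1 ⟨x, hx⟩ ⟨z, hz⟩ hxz, ← hmul,
      seg_trans ⟨x, hx⟩ ⟨y, hy⟩ ⟨z, hz⟩ hhull]
  · rw [mem_singleton_iff] at hu
    subst hu
    rw [f2 ⟨x, hx⟩ ⟨y, hy⟩ hxy, f2 ⟨y, hy⟩ ⟨z, hz⟩ hyz, f2 ⟨x, hx⟩ ⟨z, hz⟩ hxz, ← hΘ,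
      seg_trans ⟨x, hx⟩ ⟨y, hy⟩ ⟨z, hz⟩ hhull]
  · rw [f3 w hw hwC x y hxy, f3 w hw hwC y z hyz, f3 w hw hwC x z hxz]
    group

end Cocycle

/-! ### Small content implies qsf -/

section SmallContentQsf

variable {E : Type*} [NormedAddCommGroup E] [NormedSpace ℝ E] {X : Set E}

/-- Small content is applied to the surrounding set `C₁`, which forces `D` to be a neighbourhood of
the original compact set. A base point is adjoined to the latter because `exists_surrounding_set`
needs it nonempty. -/
theorem HasSmallContent.isQsf (hX : IsPolyhedron X) (h : HasSmallContent X) : IsQsf X := by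
  obtain ⟨hsc, hnc, h⟩ := h
  refine ⟨hsc, hnc, fun C₀ hC₀X hC₀ => ?_⟩
  obtain ⟨b, hbX⟩ := hsc.nonempty
  obtain ⟨C₁, hCC₁, hC₁X, hC₁, hiso, hsurr⟩ := hX.exists_surrounding_set
    (hC₀.isCompact.insert b) (insert_nonempty b C₀) (insert_subset hbX hC₀X)
  obtain ⟨D, D', hC₁D, hDD, hD'X, hD, hDc, hD', -, hnull, hjoin, hloop⟩ := h C₁ hC₁X hC₁
  have hDpc := (isCompactPolyhedron_iff.1 hD).2.isPathConnected hDc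
  have hbD : b ∈ D := hC₁D (hCC₁ (mem_insert _ _))
  have hb : ∀ x : D, Nonempty (PathClass ⟨b, hbD⟩ x) := fun x =>
    nonempty_pathClass_of_joinedIn (hDpc.joinedIn _ hbD _ x.2)
  have hCD : insert b C₀ ⊆ D := hCC₁.trans hC₁D
  refine exists_simplyConnected_model hX.locStar (hDD.trans hD'X) hCD hD
    (hC₀.isCompact.insert b) ⟨b, hbD⟩ hb ?_ hC₀ (subset_insert _ _)
  refine normalClosure_killedLoops_eq_top hCC₁ hC₁.isClosed hC₁D hDD hD'X hD.locStar hD'.locStar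
    _ hb ?_ ?_ hiso fun z hz => nhdsWithin_mono z hD'X (hsurr D hD hC₁D z hz)
  · intro x y q
    have hxy : JoinedIn (D' \ C₁) (x : E) y :=
      (joinedIn_iff_joined (F := D' \ C₁) ⟨hDD x.2.1, x.2.2⟩ ⟨hDD y.2.1, y.2.2⟩).2 q.joined
    -- Condition (2) supplies `t` in `D \ C₁` with the ends of `q`. Condition (3) pushes the loop
    -- formed by `q` and the reverse of `t` to a loop `δ` in `D \ C₁`, and `δ` followed by `t`
    -- represents `q`.
    obtain ⟨t⟩ := nonempty_pathClass_of_joinedIn (hjoin x x.2.1 y y.2.1 hxy)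
    have hDD₁ : D \ C₁ ⊆ D' \ C₁ := sdiff_subset_sdiff_left hDD
    obtain ⟨γ, hγ⟩ := Path.Homotopic.Quotient.mk_surjective
      (q.trans (PathClass.incl hDD₁ t).symm)
    obtain ⟨δ, hδ⟩ := hloop x γ
    have hδ' : PathClass.incl (sdiff_subset_sdiff_left hD'X : D' \ C₁ ⊆ X \ C₁) (pathClass γ) =
        PathClass.incl (sdiff_subset_sdiff_left (hDD.trans hD'X) : D \ C₁ ⊆ X \ C₁)
          (pathClass δ) := Quotient.sound hδ
    have hδ2 := congrArg (PathClass.incl (sdiff_subset_sdiff_right hCC₁ :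
      X \ C₁ ⊆ X \ (insert b C₀))) hδ'
    rw [PathClass.incl_incl, PathClass.incl_incl] at hδ2
    refine ⟨(pathClass δ).trans t, ?_⟩
    rw [PathClass.incl_trans, ← hδ2]
    change (PathClass.incl _ (Path.Homotopic.Quotient.mk γ)).trans _ = _
    rw [hγ, PathClass.incl_trans, PathClass.incl_symm, PathClass.incl_incl]
    simp [Path.Homotopic.Quotient.trans_assoc]
  · intro g
    obtain ⟨γ, rfl⟩ := Path.Homotopic.Quotient.mk_surjective g
    exact Quotient.sound (hnull _ γ)

end SmallContentQsf

theorem proposition3p1 {E : Type*} [NormedAddCommGroup E] [NormedSpace ℝ E]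
    (X : Set E) (hX : IsPolyhedron X) :
    (IsWgsc X → HasSmallContent X ∧ IsOneTame X) ∧
    ((IsConnected X ∧ IsOneTame X) ∨ HasSmallContent X → IsQsf X) := by
  refine ⟨fun h => ⟨h.hasSmallContent, h.isOneTame⟩, ?_⟩
  rintro (⟨hc, ht⟩ | h)
  · exact ht.isQsf hX hc
  · exact h.isQsf hX
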